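/- Let $E$ be a complex inner product space of finite dimension $n$ with a complete flag $E=W_0\supset W_1\supset\dots\supset W_n=\{0\}$, $\dim W_m=n-m$, and let $1\le k\le n$. Let $E_i$ be the orthogonal complement of $W_i$ in $W_{i-1}$ and $A=\bigoplus_{i=1}^n i\,\mathrm{id}_{E_i}$. On the unitary group $\mathcal U(E)$ consider the vector field $U\mapsto A-UAU$, the gradient (up to a positive constant factor) of $f(U)=\mathrm{Re}\,\mathrm{Tr}(AU)$. Let $U_{\{k\}}=-\mathrm{id}_{E_k}\oplus \mathrm{id}_{E_k^\perp}$, a critical point of $f$, and let $U(U_{\{k\}})$ be its unstable manifold, i.e. the set of initial points of the trajectories that converge to $U_{\{k\}}$ as $t\to-\infty$. Regard $\mathcal U(W_k^\perp)$ as the set of elements of $\mathcal U(E)$ that are the identity on $W_k$, and put $$U(U_\kappa)=\{U\in\mathcal U(W_k^\perp)\;:\;\dim\bigl(\mathrm{Ker}(1-U)\cap W_k^\perp\bigr)=k-1\}.$$ Let $\mathrm{Tc}_k(\tilde U,d)$ be the odd Chern-Weil form of degree $2k-1$ on $\mathcal U(E)$: the integral over $t\in[0,1]$ (integration over the fibre,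 fibre first) of the Chern form $c_k\bigl(\tfrac{i}{2\pi}F\bigr)$, where $c_k$ is the $k$-th elementary symmetric polynomial in the eigenvalues and $F$ is the curvature of the connection $d+t\,g^{-1}dg$ on the trivial bundle with fibre $E$ over $[0,1]\times\mathcal U(E)$. Let $\phi:S^1\times\mathbb P(W_k^\perp)\to\mathcal U(W_k^\perp)$, $\phi(\lambda,L)=\lambda\,\mathrm{id}_L\oplus\mathrm{id}_{L^\perp}$, and give $S^1\times\mathbb P(W_k^\perp)$ the product of the counterclockwise and the complex orientation. Orient the $(2k-1)$-dimensional manifold $U(U_\kappa)$, and with it $U(U_{\{k\}})$, so that $\phi$, restricted to $\{\lambda\ne1\}$, is orientation reversing. Then both of the following integrals converge absolutely, and $$\int_{U(U_{\{k\}})}\mathrm{Tc}_k(\tilde U,d)=\int_{\overline{U(U_\kappa)}}\mathrm{Tc}_k(\tilde U,d)=1 .$$ (The integral over the closure is taken over its oriented smooth part; the rest has $(2k-1)$-dimensional Hausdorff measure zero.) -/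

import Mathlib

open Filter Topology MeasureTheory Module
open scoped ContDiff

noncomputable section

namespace OddChern

/-! ### Integration of forms over oriented (possibly singular) subsets of a normed space -/

section Integration

variable {V : Type*} [NormedAddCommGroup V] [NormedSpace ℝ V]

/-- `ψ : Ω → S` is a smooth local parametrization, with `Ω` open in `ℝ^d`: a smooth injective
immersion which is a homeomorphism onto a relatively open subset of `S`. -/
structure IsLocalParam {d : ℕ} (S : Set V) (ψ : (Fin d → ℝ) → V) (Ω : Set (Fin d → ℝ)) :
    Prop where
  isOpen : IsOpen Ω
  smooth : ContDiffOn ℝ ∞ ψ Ω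
  immersion : ∀ x ∈ Ω, Function.Injective (fderiv ℝ ψ x)
  injOn : Set.InjOn ψ Ω
  isOpen_image : ∀ Ω' ⊆ Ω, IsOpen Ω' → ∃ O : Set V, IsOpen O ∧ ψ '' Ω' = S ∩ O

/-- The coefficient of `ψ^*α` with respect to `dx₁ ∧ ⋯ ∧ dx_d`, for a form `α` of degree `d`. -/
def pullbackCoeff {d : ℕ} (α : V → (Fin d → V) → ℂ) (ψ : (Fin d → ℝ) → V) (x : Fin d → ℝ) : ℂ :=
  α (ψ x) (fun i => fderiv ℝ ψ x (Pi.single i 1))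

variable [MeasurableSpace V] [BorelSpace V]

/-- A decomposition of `S`, up to a set of `d`-dimensional Hausdorff measure zero, into countably
many disjoint pieces `ψ i (K i)`, where `ψ i : Ω i → S` are local parametrizations which are
positively oriented (`pos` says which parametrizations are positively oriented) and
`K i ⊆ Ω i` are measurable. -/
structure OrientedDecomposition {d : ℕ} (S : Set V)
    (pos : ((Fin d → ℝ) → V) → Set (Fin d → ℝ) → Prop) where
  ψ : ℕ → (Fin d → ℝ) → V
  Ω : ℕ → Set (Fin d → ℝ)
  K : ℕ → Set (Fin d → ℝ)
  isLocalParam : ∀ i, IsLocalParam S (ψ i) (Ω i)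
  positive : ∀ i, pos (ψ i) (Ω i)
  subset : ∀ i, K i ⊆ Ω i
  measurable : ∀ i, MeasurableSet (K i)
  disjoint : ∀ i j, i ≠ j → Disjoint (ψ i '' K i) (ψ j '' K j)
  null : Measure.hausdorffMeasure (d : ℝ) (S \ ⋃ i, ψ i '' K i) = 0

/-- `∫_S α = c` for the oriented `d`-dimensional set `S`: oriented decompositions exist, and for
each of them the integral converges absolutely and its value, computed piece by piece in the
parameters, is `c`. -/
def HasIntegral {d : ℕ} (S : Set V) (pos : ((Fin d → ℝ) → V) → Set (Fin d → ℝ) → Prop)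
    (α : V → (Fin d → V) → ℂ) (c : ℂ) : Prop :=
  Nonempty (OrientedDecomposition S pos) ∧
  ∀ D : OrientedDecomposition S pos,
    (∀ i, IntegrableOn (pullbackCoeff α (D.ψ i)) (D.K i)) ∧
    Summable (fun i => ∫ x in D.K i, ‖pullbackCoeff α (D.ψ i) x‖) ∧
    HasSum (fun i => ∫ x in D.K i, pullbackCoeff α (D.ψ i) x) c

end Integration

variable {E : Type*} [NormedAddCommGroup E] [InnerProductSpace ℂ E] [FiniteDimensional ℂ E]

/-! ### The odd Chern-Weil forms of the tautological gauge transform -/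

/-- The invariant polynomial `c_k`: the `k`-th elementary symmetric polynomial in the
eigenvalues of an endomorphism. -/
def elemSymm (k : ℕ) (M : E →L[ℂ] E) : ℂ :=
  (M : E →ₗ[ℂ] E).charpoly.roots.esymm k

/-- The symmetric `k`-linear form `P(M₁, …, M_k)` with `P(M, …, M) = P(M)` attached to a homogeneous
polynomial `P` of degree `k`, by the polarization formula. -/
def polarization {k : ℕ} (P : (E →L[ℂ] E) → ℂ) (M : Fin k → (E →L[ℂ] E)) : ℂ :=
  (k.factorial : ℂ)⁻¹ * ∑ s : Finset (Fin k), (-1) ^ (k - s.card) * P (∑ i ∈ s, M i)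

section Curvature

variable {B : Type*} [NormedAddCommGroup B] [NormedSpace ℝ B]

/-- The curvature `F = dθ + θ ∧ θ` of the connection `d + θ` on the trivial bundle with fibre `E`
over (an open subset of) `B`. -/
def curvature (θ : B → B →L[ℝ] (E →L[ℂ] E)) (p v w : B) : E →L[ℂ] E :=
  fderiv ℝ θ p v w - fderiv ℝ θ p w v + (θ p v * θ p w - θ p w * θ p v)

/-- The Chern form `c_k(i F / 2π)` of the connection `d + θ`, a form of degree `2k`, evaluated at
tangent vectors `v₁, …, v_{2k}`. -/
def chernForm (k : ℕ) (θ : B → B →L[ℝ] (E →L[ℂ] E)) (p : B) (v : Fin (2 * k) → B) : ℂ :=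
  (Complex.I / (2 * Real.pi)) ^ k * ((2 : ℂ) ^ k)⁻¹ *
    ∑ σ : Equiv.Perm (Fin (2 * k)), ((Equiv.Perm.sign σ : ℤ) : ℂ) *
      polarization (elemSymm k) (fun i : Fin k =>
        curvature θ p (v (σ ⟨2 * i, by omega⟩)) (v (σ ⟨2 * i + 1, by omega⟩)))

end Curvature

/-- The connection form `t g⁻¹dg` at `(t, g)`: the affine path `(1 - t) d + t g⁻¹ d g` from the
trivial connection `d` to its transform under the tautological gauge transform `g ↦ g`, as one
connection on the trivial bundle over `[0,1] × GL(E)`. -/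
def pathConnection (p : ℝ × (E →L[ℂ] E)) : (ℝ × (E →L[ℂ] E)) →L[ℝ] (E →L[ℂ] E) :=
  p.1 • ((ContinuousLinearMap.mul ℝ (E →L[ℂ] E) (Ring.inverse p.2)).comp
    (ContinuousLinearMap.snd ℝ ℝ (E →L[ℂ] E)))

/-- The odd Chern-Weil form `Tc_k` of the tautological gauge transform and the trivial connection:
the integral over `t ∈ [0,1]` (fibre first) of the Chern form of `pathConnection`. It is written
on `GL(E)`; the form on `U(E)` is its restriction to vectors tangent to `U(E)`. -/
def Tc (k : ℕ) (g : E →L[ℂ] E) (X : Fin (2 * k - 1) → (E →L[ℂ] E)) : ℂ :=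
  ∫ t in (0 : ℝ)..1, chernForm k (pathConnection (E := E)) (t, g)
    (fun j => if h : (j : ℕ) = 0 then (1, 0) else (0, X ⟨j - 1, by omega⟩))

/-! ### The gradient flow on the unitary group -/

/-- The unitary group `U(E)`, as a subset of `End(E)`. -/
def unitaryOps (E : Type*) [NormedAddCommGroup E] [InnerProductSpace ℂ E]
    [FiniteDimensional ℂ E] : Set (E →L[ℂ] E) :=
  haveI := FiniteDimensional.complete ℂ E
  {U | U ∈ unitary (E →L[ℂ] E)}

/-- `E_i`, the orthogonal complement of `W_i` in `W_{i-1}`, for `i ≥ 1`. -/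
def flagLine (W : ℕ → Submodule ℂ E) (i : ℕ) : Submodule ℂ E := W (i - 1) ⊓ (W i)ᗮ

/-- The self-adjoint endomorphism `A = ⊕ i • id_{E_i}`, `1 ≤ i ≤ n = dim E`. -/
def flagOp (W : ℕ → Submodule ℂ E) : E →L[ℂ] E :=
  ∑ i ∈ Finset.Icc 1 (finrank ℂ E), (i : ℂ) • (flagLine W i).starProjection

/-- The critical point `U_{k}` of `U ↦ Re Tr (A U)`: it is `-1` on `E_k` and `1` on its orthogonal
complement. -/
def critPoint (W : ℕ → Submodule ℂ E) (k : ℕ) : E →L[ℂ] E :=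
  -(flagLine W k).starProjection + (flagLine W k)ᗮ.starProjection

/-- The unstable manifold of `U_{k}`: the initial points of those trajectories of the gradient field
`U ↦ A - U A U` on the unitary group which converge to `U_{k}` as `t → -∞`. -/
def unstableManifold (W : ℕ → Submodule ℂ E) (k : ℕ) : Set (E →L[ℂ] E) :=
  {U | ∃ γ : ℝ → (E →L[ℂ] E), γ 0 = U ∧ (∀ t, γ t ∈ unitaryOps E) ∧
    (∀ t, HasDerivAt γ (flagOp W - γ t * flagOp W * γ t) t) ∧
    Tendsto γ atBot (𝓝 (critPoint W k))}

/-- The set of `U` in `U(W_k^⊥)` with `dim Ker (1 - U) = k - 1`, where `U(W_k^⊥)` sits in `U(E)` as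
the unitary maps which are the identity on `W_k`. -/
def incidenceSet (W : ℕ → Submodule ℂ E) (k : ℕ) : Set (E →L[ℂ] E) :=
  {U | U ∈ unitaryOps E ∧ (∀ w ∈ W k, U w = w) ∧
    finrank ℂ ↥((W k)ᗮ ⊓ LinearMap.ker ((1 - U : E →L[ℂ] E) : E →ₗ[ℂ] E)) = k - 1}

/-! ### The orientation -/

/-- `φ(l, L) = l id_L ⊕ id_{L^⊥}`. -/
def phi (l : ℂ) (L : Submodule ℂ E) : E →L[ℂ] E := l • L.starProjection + Lᗮ.starProjection

/-- The map `φ` in a standard local coordinate system of `S¹ × ℙ(W_k^⊥)`: the coordinates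
`(θ, x₁, y₁, …, x_{k-1}, y_{k-1})` stand for the point
`(exp(iθ), [b₀ + (x₁ + i y₁) b₁ + ⋯ + (x_{k-1} + i y_{k-1}) b_{k-1}])`, where `b` is a basis of
`W_k^⊥`. These coordinate systems are positively oriented for the product of the counterclockwise
orientation of `S¹` and the complex orientation of `ℙ(W_k^⊥)`. -/
def phiChart {W : ℕ → Submodule ℂ E} {k : ℕ} (b : Basis (Fin k) ℂ ↥(W k)ᗮ)
    (y : Fin (2 * k - 1) → ℝ) : E →L[ℂ] E :=
  phi (if h : 0 < 2 * k - 1 then Complex.exp (y ⟨0, h⟩ * Complex.I) else 1)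
    (Submodule.span ℂ {∑ j : Fin k, (if h : (j : ℕ) = 0 then (1 : ℂ) else
      (y ⟨2 * j - 1, by omega⟩ : ℂ) + (y ⟨2 * j, by omega⟩ : ℂ) * Complex.I) • (b j : E)})

/-- The parametrization `ψ : Ω → U(E)` is positively oriented for the orientation that makes `φ`
orientation reversing (away from `l = 1`, that is, away from the value `id`): at each point, the
derivatives of `ψ` and of `φ`, in positively oriented coordinates, differ by a linear map of
negative determinant. -/
def PhiReversing (W : ℕ → Submodule ℂ E) (k : ℕ) (ψ : (Fin (2 * k - 1) → ℝ) → (E →L[ℂ] E))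
    (Ω : Set (Fin (2 * k - 1) → ℝ)) : Prop :=
  ∀ b : Basis (Fin k) ℂ ↥(W k)ᗮ, ∀ x ∈ Ω, ∀ y, phiChart b y = ψ x → ψ x ≠ 1 →
    ∃ T : (Fin (2 * k - 1) → ℝ) →L[ℝ] (Fin (2 * k - 1) → ℝ),
      fderiv ℝ ψ x = (fderiv ℝ (phiChart b) y).comp T ∧ T.det < 0

end OddChern

end

/-!
The unstable manifold of `U_{k}` and the incidence set are, up to null sets, one and the same
`(2k - 1)`-dimensional cell, and on this cell the odd Chern form is a product of a form on the
circle and of a multiple of the Fubini-Study volume form.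

**The sets.** Both sets lie in the compact set `complexReflections` of the maps
`lineMul (l - 1) v = l id ⊕ id`, where `l` is the eigenvalue on the line of `v ∈ W_k^⊥`,
and both contain the reflections with `l ≠ 1` in the lines not orthogonal to `E_k`. For the
incidence set this is linear algebra: `1 - U` is a normal map of rank one. For the unstable
manifold, the Riccati equation `γ' = A - γ A γ` is linearized by exponentials of `tA`
(`trajectory_mul_eq`); as `t → -∞` the vectors `exp(-tA) x` turn to the eigenvector of the largest
eigenvalue that occurs in `x`, so that every nonzero vector in the range of `1 - γ 0` has its last
nonzero component along `E_k` (`range_one_sub_of_tendsto`), and this range is a line. Conversely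
the trajectory through such a reflection is explicit (`lineTrajectory`). Together this is
`mem_unstableManifold_iff`.

**Reduction to one chart.** The reflections with `l ≠ 1` in the lines not orthogonal to `E_k` are
the image of one affine chart of `S¹ × ℙ(W_k^⊥)`, traversed with the angle reversed (`oppChart`).
The rest of `complexReflections` is covered by the identity and by the images of hyperplanes under
the other affine charts, hence Hausdorff null (`hausdorffMeasure_complexReflections_sdiff`).
Transition maps between affine charts are holomorphic in the projective coordinates and preserve
the orientation (`exists_fderiv_chart_eq_comp`). By the change of variables formula
(`hasIntegral_of_param`) the integral over any oriented decomposition is the integral over this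
chart.

**The form in the chart.** In the frame consisting of `v` and of the projections of a basis to
`v^⊥`, the Maurer-Cartan form `ω = g⁻¹dg` takes values in the matrices of which only the first row
and the first column are different from zero (`toMatrix_mcForm`). For the curvature
`dt ∧ ω + (t² - t) ω ∧ ω` the polarization of `c_k`, which is a polarized determinant
(`polarization_elemSymm_of_factor`), therefore collapses to a single determinant of one-forms
(`sum_sign_polarization`). With `k = m + 1` and a beta integral over `t` this gives the density
`m!³ / (2 π^{m+1} (2m)!) · (2 - 2 cos θ)^m / (1 + |z|²)^{m+1}` (`Tc_chart`, `chartDensity`).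

**The integral.** The integral of `(2 - 2 cos θ)^m` over the circle is `2π (2m)! / m!²`, and that
of `(1 + |z|²)^{-(m+1)}` over `ℂ^m` is `π^m / m!`; the product with the constant is `1`
(`integrableOn_and_integral_chartDensity`).
-/

noncomputable section

namespace OddChern

/-! ### Change of variables for integrals over oriented sets -/

section ChangeOfVariables

variable {V : Type*} [NormedAddCommGroup V] [NormedSpace ℝ V]

/-- An immersion is bi-Lipschitz from below near each point. -/
lemma exists_nhds_antilipschitzWith_restrict {d : ℕ} {ψ : (Fin d → ℝ) → V} {x : Fin d → ℝ}
    (hψ : ContDiffAt ℝ ∞ ψ x) (hinj : Function.Injective (fderiv ℝ ψ x)) :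
    ∃ u ∈ 𝓝 x, ∃ K, AntilipschitzWith K (u.domRestrict ψ) := by
  obtain ⟨K, hK, hA⟩ := (fderiv ℝ ψ x : (Fin d → ℝ) →ₗ[ℝ] V).exists_antilipschitzWith
    (LinearMap.ker_eq_bot.2 hinj)
  have hs : HasStrictFDerivAt ψ (fderiv ℝ ψ x) x := hψ.hasStrictFDerivAt (by simp)
  have hc : (0 : NNReal) < K⁻¹ / 2 := by positivity
  have hev := hs.isLittleO.def (c := ((K⁻¹ / 2 : NNReal) : ℝ)) (by exact_mod_cast hc)
  rw [nhds_prod_eq] at hev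
  obtain ⟨u, hu, hu'⟩ := (eventually_prod_self_iff (r := fun a b => ‖ψ a - ψ b -
    (fderiv ℝ ψ x) (a - b)‖ ≤ ((K⁻¹ / 2 : NNReal) : ℝ) * ‖a - b‖)).1 hev
  refine ⟨u, hu, 2 * K, AntilipschitzWith.of_le_mul_dist ?_⟩
  rintro ⟨a, ha⟩ ⟨b, hb⟩
  have h1 := hu' a ha b hb
  have h2 := hA.le_mul_dist a b
  have hKr : (0 : ℝ) < K := by exact_mod_cast hK
  simp only [Subtype.dist_eq, dist_eq_norm, ContinuousLinearMap.coe_coe, ← map_sub] at h1 h2 ⊢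
  change ‖a - b‖ ≤ ((2 * K : NNReal) : ℝ) * ‖ψ a - ψ b‖
  push_cast at h1 ⊢
  have h3 : ‖(fderiv ℝ ψ x) (a - b)‖ ≤ ‖ψ a - ψ b‖ + (K : ℝ)⁻¹ / 2 * ‖a - b‖ := by
    have := norm_sub_norm_le ((fderiv ℝ ψ x) (a - b)) (ψ a - ψ b)
    rw [norm_sub_rev _ (ψ a - ψ b)] at this
    linarith
  have h4 : (K : ℝ) * ‖(fderiv ℝ ψ x) (a - b)‖ ≤ K * ‖ψ a - ψ b‖ + ‖a - b‖ / 2 := by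
    calc _ ≤ (K : ℝ) * (‖ψ a - ψ b‖ + (K : ℝ)⁻¹ / 2 * ‖a - b‖) := by gcongr
      _ = _ := by field_simp
  linarith

lemma IsLocalParam.image_subset {d : ℕ} {S : Set V} {ψ : (Fin d → ℝ) → V}
    {Ω : Set (Fin d → ℝ)} (h : IsLocalParam S ψ Ω) : ψ '' Ω ⊆ S := by
  obtain ⟨O, -, hO⟩ := h.isOpen_image Ω subset_rfl h.isOpen
  exact hO ▸ Set.inter_subset_left

variable [MeasurableSpace V] [BorelSpace V]

/-- Preimages of Hausdorff null sets under local parametrizations are Lebesgue null. -/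
lemma IsLocalParam.volume_preimage_eq_zero {d : ℕ} {S : Set V} {ψ : (Fin d → ℝ) → V}
    {Ω : Set (Fin d → ℝ)} (h : IsLocalParam S ψ Ω) {N : Set V}
    (hN : Measure.hausdorffMeasure (d : ℝ) N = 0) : volume (Ω ∩ ψ ⁻¹' N) = 0 := by
  refine measure_null_of_locally_null _ fun x hx => ?_
  obtain ⟨u, hu, K, hK⟩ := exists_nhds_antilipschitzWith_restrict
    ((h.smooth x hx.1).contDiffAt (h.isOpen.mem_nhds hx.1)) (h.immersion x hx.1)
  refine ⟨(Ω ∩ ψ ⁻¹' N) ∩ u, inter_mem_nhdsWithin _ hu, ?_⟩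
  have h1 := hK.hausdorffMeasure_preimage_le (d := d) (by positivity) N
  rw [hN, mul_zero, nonpos_iff_eq_zero] at h1
  have h2 : Measure.hausdorffMeasure (d : ℝ)
      ((Subtype.val : u → _) '' (u.domRestrict ψ ⁻¹' N)) = 0 := by
    rw [isometry_subtype_coe.hausdorffMeasure_image (Or.inl (by positivity)), h1]
  have h3 : volume ((Subtype.val : u → _) '' (u.domRestrict ψ ⁻¹' N)) = 0 := by
    rw [← hausdorffMeasure_pi_real, Fintype.card_fin]; exact h2
  refine measure_mono_null ?_ h3
  rintro y ⟨hy, hyu⟩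
  exact ⟨⟨y, hyu⟩, hy.2, rfl⟩

/-- A `C¹` map on `ℝ^d` sends Lebesgue null sets to null sets of the `d`-dimensional Hausdorff
measure, being locally Lipschitz. -/
lemma hausdorffMeasure_image_eq_zero {d : ℕ} {f : (Fin d → ℝ) → V} (hf : ContDiff ℝ 1 f)
    {s : Set (Fin d → ℝ)} (hs : volume s = 0) :
    Measure.hausdorffMeasure (d : ℝ) (f '' s) = 0 := by
  choose K t ht hKt using fun x => hf.contDiffAt (x := x).exists_lipschitzOnWith
  obtain ⟨c, hc, hcu⟩ := TopologicalSpace.countable_cover_nhds ht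
  have : f '' s ⊆ ⋃ x ∈ c, f '' (s ∩ t x) := by
    rintro _ ⟨y, hy, rfl⟩
    have : y ∈ ⋃ x ∈ c, t x := hcu ▸ Set.mem_univ y
    simp only [Set.mem_iUnion] at this ⊢
    obtain ⟨x, hx, hyx⟩ := this
    exact ⟨x, hx, y, ⟨hy, hyx⟩, rfl⟩
  refine measure_mono_null this ((measure_biUnion_null_iff hc).2 fun x _ => ?_)
  have h1 := ((hKt x).mono Set.inter_subset_right :
    LipschitzOnWith (K x) f (s ∩ t x)).hausdorffMeasure_image_le (d := d) (by positivity)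
  have h2 : Measure.hausdorffMeasure (d : ℝ) (s ∩ t x) = 0 := by
    have : volume (s ∩ t x) = 0 := measure_mono_null Set.inter_subset_left hs
    rwa [← hausdorffMeasure_pi_real, Fintype.card_fin] at this
  rw [h2, mul_zero] at h1
  exact nonpos_iff_eq_zero.1 h1

/-- If one positively oriented parametrization with a differentiable left inverse covers `S`
up to a null set, and the derivatives of the positively oriented parametrizations differ from its
derivatives by maps of positive determinant, then the integral over `S` exists and is computed in
that one parametrization. -/
theorem hasIntegral_of_param {d : ℕ} {S : Set V}
    {pos : ((Fin d → ℝ) → V) → Set (Fin d → ℝ) → Prop} {α : V → (Fin d → V) → ℂ} {c : ℂ}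
    {ψ₀ : (Fin d → ℝ) → V} {Ω₀ : Set (Fin d → ℝ)} {G : V → Fin d → ℝ}
    (hψ₀ : IsLocalParam S ψ₀ Ω₀) (hpos₀ : pos ψ₀ Ω₀)
    (hnull : Measure.hausdorffMeasure (d : ℝ) (S \ ψ₀ '' Ω₀) = 0)
    (hG : ∀ y ∈ Ω₀, G (ψ₀ y) = y) (hGd : ∀ y ∈ Ω₀, DifferentiableAt ℝ G (ψ₀ y))
    (hpos : ∀ ψ Ω, pos ψ Ω → ∀ x ∈ Ω, ∀ y ∈ Ω₀, ψ₀ y = ψ x →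
      ∃ T : (Fin d → ℝ) →L[ℝ] (Fin d → ℝ), fderiv ℝ ψ x = (fderiv ℝ ψ₀ y).comp T ∧ 0 < T.det)
    (hα : ∀ y ∈ Ω₀, ∀ T : (Fin d → ℝ) →L[ℝ] (Fin d → ℝ),
      α (ψ₀ y) (fun i => fderiv ℝ ψ₀ y (T (Pi.single i 1))) =
        (T.det : ℂ) * pullbackCoeff α ψ₀ y)
    (hint : IntegrableOn (pullbackCoeff α ψ₀) Ω₀)
    (hc : ∫ y in Ω₀, pullbackCoeff α ψ₀ y = c) :
    HasIntegral S pos α c := by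
  refine ⟨⟨{
    ψ := fun _ => ψ₀
    Ω := fun _ => Ω₀
    K := fun i => if i = 0 then Ω₀ else ∅
    isLocalParam := fun _ => hψ₀
    positive := fun _ => hpos₀
    subset := fun i => by split_ifs <;> simp
    measurable := fun i => by
      split_ifs
      exacts [hψ₀.isOpen.measurableSet, MeasurableSet.empty]
    disjoint := fun i j hij => by
      rcases eq_or_ne i 0 with rfl | hi
      · simp [hij.symm]
      · simp [hi]
    null := measure_mono_null (Set.sdiff_subset_sdiff_right fun x hx =>
      Set.mem_iUnion.2 ⟨0, by simpa using hx⟩) hnull }⟩, fun D => ?_⟩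
  obtain ⟨O, hO, hSO⟩ := hψ₀.isOpen_image Ω₀ subset_rfl hψ₀.isOpen
  -- `K' i` consists of the points of `K i` which `ψ i` sends into the image of `ψ₀`, and `χ i` is
  -- the transition map to the coordinates of `ψ₀`
  set K' : ℕ → Set (Fin d → ℝ) := fun i => D.K i ∩ D.ψ i ⁻¹' O with hK'
  set χ : ℕ → (Fin d → ℝ) → (Fin d → ℝ) := fun i x => G (D.ψ i x) with hχ
  -- every point of `K' i` is hit by the reference parametrization
  have hex : ∀ i, ∀ x ∈ K' i, ∃ y ∈ Ω₀, ψ₀ y = D.ψ i x := by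
    rintro i x ⟨hx, hxO⟩
    have : D.ψ i x ∈ ψ₀ '' Ω₀ := by
      rw [hSO]
      exact ⟨(D.isLocalParam i).image_subset ⟨x, D.subset i hx, rfl⟩, hxO⟩
    simpa using this
  have hχ₀ : ∀ i, ∀ x ∈ K' i, χ i x ∈ Ω₀ ∧ ψ₀ (χ i x) = D.ψ i x := by
    intro i x hx
    obtain ⟨y, hy, hyx⟩ := hex i x hx
    have : χ i x = y := by simp only [hχ, ← hyx, hG y hy]
    rw [this]; exact ⟨hy, hyx⟩
  have hT : ∀ i, ∀ x ∈ K' i, 0 < (fderiv ℝ (χ i) x).det ∧ DifferentiableAt ℝ (χ i) x ∧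
      pullbackCoeff α (D.ψ i) x =
        ((fderiv ℝ (χ i) x).det : ℂ) * pullbackCoeff α ψ₀ (χ i x) := by
    intro i x hx
    obtain ⟨hy, hyx⟩ := hχ₀ i x hx
    obtain ⟨T, hTd, hTpos⟩ := hpos _ _ (D.positive i) x (D.subset i hx.1) _ hy hyx
    have hxΩ := D.subset i hx.1
    have hd : DifferentiableAt ℝ (D.ψ i) x :=
      (((D.isLocalParam i).smooth x hxΩ).contDiffAt
        ((D.isLocalParam i).isOpen.mem_nhds hxΩ)).differentiableAt (by simp)
    have hd₀ : DifferentiableAt ℝ ψ₀ (χ i x) :=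
      ((hψ₀.smooth _ hy).contDiffAt (hψ₀.isOpen.mem_nhds hy)).differentiableAt (by simp)
    have hGx : DifferentiableAt ℝ G (D.ψ i x) := hyx ▸ hGd _ hy
    have hid : (fderiv ℝ G (ψ₀ (χ i x))).comp (fderiv ℝ ψ₀ (χ i x)) = .id ℝ _ := by
      rw [← fderiv_comp _ (hGd _ hy) hd₀]
      have : G ∘ ψ₀ =ᶠ[𝓝 (χ i x)] id :=
        Filter.eventuallyEq_of_mem (hψ₀.isOpen.mem_nhds hy) fun z hz => hG z hz
      rw [this.fderiv_eq, fderiv_id]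
    have hfd : fderiv ℝ (χ i) x = T := by
      have : fderiv ℝ (χ i) x = (fderiv ℝ G (D.ψ i x)).comp (fderiv ℝ (D.ψ i) x) :=
        fderiv_comp _ hGx hd
      rw [this, hTd, ← hyx, ← ContinuousLinearMap.comp_assoc, hid,
        ContinuousLinearMap.id_comp]
    refine ⟨hfd ▸ hTpos, hGx.comp x hd, ?_⟩
    rw [hfd, ← hα _ hy T]
    simp only [pullbackCoeff, hTd, hyx, ContinuousLinearMap.comp_apply]
  have hKm : ∀ i, MeasurableSet (K' i) := by
    intro i
    have h1 : IsOpen (D.Ω i ∩ D.ψ i ⁻¹' O) :=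
      (D.isLocalParam i).smooth.continuousOn.isOpen_inter_preimage (D.isLocalParam i).isOpen hO
    have : K' i = D.K i ∩ (D.Ω i ∩ D.ψ i ⁻¹' O) := by
      rw [← Set.inter_assoc, Set.inter_eq_left.2 (D.subset i)]
    rw [this]
    exact (D.measurable i).inter h1.measurableSet
  have hder : ∀ i, ∀ x ∈ K' i, HasFDerivWithinAt (χ i) (fderiv ℝ (χ i) x) (K' i) x :=
    fun i x hx => (hT i x hx).2.1.hasFDerivAt.hasFDerivWithinAt
  have hinjχ : ∀ i, Set.InjOn (χ i) (K' i) := by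
    intro i x hx x' hx' h
    refine (D.isLocalParam i).injOn (D.subset i hx.1) (D.subset i hx'.1) ?_
    rw [← (hχ₀ i x hx).2, ← (hχ₀ i x' hx').2, h]
  set A : ℕ → Set (Fin d → ℝ) := fun i => χ i '' K' i with hA
  have hAm : ∀ i, MeasurableSet (A i) := fun i =>
    measurable_image_of_fderivWithin (hKm i) (hder i) (hinjχ i)
  have hAΩ : ∀ i, A i ⊆ Ω₀ := by
    rintro i _ ⟨x, hx, rfl⟩
    exact (hχ₀ i x hx).1
  have hAdisj : Pairwise (Function.onFun Disjoint A) := by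
    intro i j hij
    refine Set.disjoint_left.2 ?_
    rintro _ ⟨x, hx, rfl⟩ ⟨x', hx', h⟩
    refine Set.disjoint_left.1 (D.disjoint i j hij) ⟨x, hx.1, rfl⟩ ⟨x', hx'.1, ?_⟩
    rw [← (hχ₀ i x hx).2, ← (hχ₀ j x' hx').2, h]
  -- the pieces `A i` exhaust `Ω₀`, because the decomposition covers `S` up to a null set
  have hAcover : volume (Ω₀ \ ⋃ i, A i) = 0 := by
    refine measure_mono_null ?_ (hψ₀.volume_preimage_eq_zero D.null)
    rintro y ⟨hy, hyA⟩
    refine ⟨hy, hψ₀.image_subset ⟨y, hy, rfl⟩, fun hyD => hyA ?_⟩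
    obtain ⟨i, x, hx, hxy⟩ := Set.mem_iUnion.1 hyD
    have hO' : ψ₀ y ∈ O := by
      have : ψ₀ y ∈ ψ₀ '' Ω₀ := ⟨y, hy, rfl⟩
      rw [hSO] at this; exact this.2
    refine Set.mem_iUnion.2 ⟨i, x, ⟨hx, ?_⟩, ?_⟩
    · change D.ψ i x ∈ O
      rw [hxy]; exact hO'
    · simp only [hχ, hxy, hG y hy]
  -- `K i` differs from `K' i` by points over `S \ ψ₀ '' Ω₀`, which is a null set
  have hKae : ∀ i, (K' i : Set _) =ᵐ[volume] D.K i := by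
    intro i
    refine (ae_eq_set).2 ⟨?_, ?_⟩
    · rw [Set.sdiff_eq_empty.2 Set.inter_subset_left]; exact measure_empty
    · refine measure_mono_null ?_ ((D.isLocalParam i).volume_preimage_eq_zero hnull)
      rintro x ⟨hx, hx'⟩
      refine ⟨D.subset i hx, (D.isLocalParam i).image_subset ⟨x, D.subset i hx, rfl⟩, fun h => ?_⟩
      rw [hSO] at h
      exact hx' ⟨hx, h.2⟩
  have hAae : (⋃ i, A i : Set _) =ᵐ[volume] Ω₀ := by
    refine (ae_eq_set).2 ⟨?_, hAcover⟩
    rw [Set.sdiff_eq_empty.2 (Set.iUnion_subset hAΩ)]; exact measure_empty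
  have hcong : ∀ i, ∀ x ∈ K' i, pullbackCoeff α (D.ψ i) x =
      |(fderiv ℝ (χ i) x).det| • pullbackCoeff α ψ₀ (χ i x) := by
    intro i x hx
    rw [abs_of_pos (hT i x hx).1, (hT i x hx).2.2, Complex.real_smul]
  have hintA : ∀ i, IntegrableOn (pullbackCoeff α ψ₀) (A i) := fun i => hint.mono_set (hAΩ i)
  have hintK : ∀ i, IntegrableOn (pullbackCoeff α (D.ψ i)) (D.K i) := by
    intro i
    refine IntegrableOn.congr_set_ae ?_ (hKae i).symm
    refine IntegrableOn.congr_fun ?_ (fun x hx => (hcong i x hx).symm) (hKm i)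
    exact (integrableOn_image_iff_integrableOn_abs_det_fderiv_smul volume (hKm i) (hder i)
      (hinjχ i) _).1 (hintA i)
  have hval : ∀ i, ∫ x in D.K i, pullbackCoeff α (D.ψ i) x =
      ∫ y in A i, pullbackCoeff α ψ₀ y := by
    intro i
    rw [← setIntegral_congr_set (hKae i), integral_image_eq_integral_abs_det_fderiv_smul volume
      (hKm i) (hder i) (hinjχ i)]
    exact setIntegral_congr_fun (hKm i) fun x hx => hcong i x hx
  have hvaln : ∀ i, ∫ x in D.K i, ‖pullbackCoeff α (D.ψ i) x‖ =
      ∫ y in A i, ‖pullbackCoeff α ψ₀ y‖ := by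
    intro i
    rw [← setIntegral_congr_set (hKae i), integral_image_eq_integral_abs_det_fderiv_smul volume
      (hKm i) (hder i) (hinjχ i)]
    refine setIntegral_congr_fun (hKm i) fun x hx => ?_
    simp only [hcong i x hx, norm_smul, norm_abs_eq_norm, Real.norm_eq_abs, smul_eq_mul]
  have hintU : IntegrableOn (pullbackCoeff α ψ₀) (⋃ i, A i) :=
    hint.mono_set (Set.iUnion_subset hAΩ)
  refine ⟨hintK, ?_, ?_⟩
  · simp only [hvaln]
    exact (hasSum_integral_iUnion hAm hAdisj hintU.norm).summable
  · simp only [hval]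
    rw [← hc, ← setIntegral_congr_set hAae]
    exact hasSum_integral_iUnion hAm hAdisj hintU

end ChangeOfVariables

/-! ### Polarization of the determinant -/

/-- Ryser's formula for the permanent: inclusion and exclusion over the set of values of a map
`Fin k → Fin k` leaves the permutations. -/
lemma sum_neg_one_pow_mul_prod_sum {k : ℕ} (a : Fin k → Fin k → ℂ) :
    ∑ s : Finset (Fin k), (-1 : ℂ) ^ (k - s.card) * ∏ j, ∑ i ∈ s, a i j =
      ∑ τ : Equiv.Perm (Fin k), ∏ j, a (τ j) j := by
  classical
  have h1 : ∀ s : Finset (Fin k), ∏ j, ∑ i ∈ s, a i j =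
      ∑ p : Fin k → Fin k, if Finset.univ.image p ⊆ s then ∏ j, a (p j) j else 0 := by
    intro s
    rw [Finset.prod_univ_sum, ← Finset.sum_filter]
    refine Finset.sum_congr ?_ fun _ _ => rfl
    ext p
    simp [Fintype.mem_piFinset, Finset.image_subset_iff]
  have h2 : ∀ I : Finset (Fin k),
      ∑ s : Finset (Fin k), (-1 : ℂ) ^ (k - s.card) * (if I ⊆ s then 1 else 0) =
        if I = Finset.univ then 1 else 0 := by
    intro I
    -- passing to complements turns this into the alternating sum over the subsets of `Iᶜ`
    rw [← Equiv.sum_comp (compl_involutive (α := Finset (Fin k))).toPerm]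
    have : ∀ c : Finset (Fin k), (-1 : ℂ) ^ (k - (compl_involutive.toPerm _ c).card) *
        (if I ⊆ compl_involutive.toPerm _ c then 1 else 0) =
        if c ∈ Iᶜ.powerset then (-1 : ℂ) ^ c.card else 0 := by
      intro c
      have hc : k - cᶜ.card = c.card := by
        rw [Finset.card_compl, Fintype.card_fin]
        have := card_finset_fin_le c
        omega
      simp only [Function.Involutive.coe_toPerm, hc, Finset.mem_powerset, mul_ite, mul_one,
        mul_zero, Finset.subset_compl_comm (s := I)]
    simp only [this]
    rw [Finset.sum_ite_mem, Finset.univ_inter]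
    have h := Finset.sum_powerset_neg_one_pow_card (x := Iᶜ)
    have h' : (∑ m ∈ Iᶜ.powerset, (-1 : ℂ) ^ m.card) = ((if Iᶜ = ∅ then 1 else 0 : ℤ) : ℂ) := by
      rw [← h]; push_cast; rfl
    rw [h']
    simp only [Finset.compl_eq_empty_iff]
    split_ifs <;> simp
  simp only [h1, Finset.mul_sum]
  rw [Finset.sum_comm]
  have h3 : ∀ p : Fin k → Fin k, ∑ s : Finset (Fin k), (-1 : ℂ) ^ (k - s.card) *
      (if Finset.univ.image p ⊆ s then ∏ j, a (p j) j else 0) =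
      if Function.Bijective p then ∏ j, a (p j) j else 0 := by
    intro p
    have : ∀ s : Finset (Fin k), (-1 : ℂ) ^ (k - s.card) *
        (if Finset.univ.image p ⊆ s then ∏ j, a (p j) j else 0) =
        ((-1 : ℂ) ^ (k - s.card) * (if Finset.univ.image p ⊆ s then 1 else 0)) *
          ∏ j, a (p j) j := by
      intro s; split_ifs <;> simp
    simp only [this]
    have himg : Finset.univ.image p = Finset.univ ↔ Function.Bijective p := by
      rw [← Finite.surjective_iff_bijective, Finset.eq_univ_iff_forall]
      simp [Function.Surjective]
    rw [← Finset.sum_mul, h2]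
    simp only [himg]
    split_ifs <;> simp
  simp only [h3]
  rw [← Finset.sum_filter]
  refine Finset.sum_bij' (fun p hp => Equiv.ofBijective p (Finset.mem_filter.1 hp).2)
    (fun τ _ => ⇑τ) ?_ ?_ ?_ ?_ ?_
  · simp
  · intro τ _; exact Finset.mem_filter.2 ⟨Finset.mem_univ _, τ.bijective⟩
  · intros; rfl
  · intros; ext; simp
  · intros; rfl

/-- The polarization of the determinant: the column `j` is taken from the matrix `N (τ j)`, and all
assignments `τ` are summed. -/
lemma sum_neg_one_pow_mul_det_sum {k : ℕ} (N : Fin k → Matrix (Fin k) (Fin k) ℂ) :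
    ∑ s : Finset (Fin k), (-1 : ℂ) ^ (k - s.card) * (∑ i ∈ s, N i).det =
      ∑ τ : Equiv.Perm (Fin k), ∑ π : Equiv.Perm (Fin k),
        ((Equiv.Perm.sign π : ℤ) : ℂ) * ∏ j, N (τ j) (π j) j := by
  simp only [Matrix.det_apply', Finset.mul_sum, Matrix.sum_apply]
  rw [Finset.sum_comm]
  conv_rhs => rw [Finset.sum_comm]
  refine Finset.sum_congr rfl fun π _ => ?_
  rw [← Finset.mul_sum, ← sum_neg_one_pow_mul_prod_sum (fun i j => N i (π j) j), Finset.mul_sum]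
  refine Finset.sum_congr rfl fun s _ => ?_
  ring

section ElemSymm

variable {E : Type*} [NormedAddCommGroup E] [InnerProductSpace ℂ E] [FiniteDimensional ℂ E]

/-- For an endomorphism factoring through `ℂ^k`, the polynomial `c_k` is the determinant of the
composition in the other order: `Φ f` and `f Φ` have the same characteristic polynomial up to a
power of `X`. -/
lemma elemSymm_of_factor {k : ℕ} (hk : k ≤ finrank ℂ E) (Φ : (Fin k → ℂ) →ₗ[ℂ] E)
    (f : E →ₗ[ℂ] (Fin k → ℂ)) (M : E →L[ℂ] E) (hM : (M : E →ₗ[ℂ] E) = Φ ∘ₗ f) :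
    elemSymm k M = (LinearMap.toMatrix' (f ∘ₗ Φ)).det := by
  set n := finrank ℂ E with hn
  let b := finBasis ℂ E
  have hch : (M : E →ₗ[ℂ] E).charpoly =
      Polynomial.X ^ (n - k) * (LinearMap.toMatrix' (f ∘ₗ Φ)).charpoly := by
    rw [← LinearMap.charpoly_toMatrix (M : E →ₗ[ℂ] E) b, hM,
      LinearMap.toMatrix_comp b (Pi.basisFun ℂ (Fin k)) b]
    rw [Matrix.charpoly_mul_comm_of_le _ _ (by simpa using hk)]
    rw [← LinearMap.toMatrix_comp (Pi.basisFun ℂ (Fin k)) b (Pi.basisFun ℂ (Fin k)),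
      Fintype.card_fin, Fintype.card_fin]
    rfl
  unfold elemSymm
  set p := (M : E →ₗ[ℂ] E).charpoly with hp
  have hpm : p.Monic := LinearMap.charpoly_monic _
  have hdeg : p.natDegree = n := LinearMap.charpoly_natDegree _
  have h1 := Polynomial.coeff_eq_esymm_roots_of_splits (IsAlgClosed.splits p)
    (k := n - k) (by omega)
  rw [hpm.leadingCoeff, hdeg, Nat.sub_sub_self hk, one_mul] at h1
  have h2 : p.coeff (n - k) = (-1) ^ k * (LinearMap.toMatrix' (f ∘ₗ Φ)).det := by
    rw [hch, Polynomial.coeff_X_pow_mul', if_pos le_rfl, Nat.sub_self,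
      Matrix.charpoly, Polynomial.coeff_zero_eq_eval_zero, ← Polynomial.coe_evalRingHom]
    rw [Polynomial.coe_evalRingHom, ← Matrix.charpoly, ← Polynomial.coeff_zero_eq_eval_zero,
      Matrix.det_eq_sign_charpoly_coeff, Fintype.card_fin, ← mul_assoc, ← pow_add,
      Even.neg_one_pow ⟨k, rfl⟩, one_mul]
  have h3 : ((-1 : ℂ) ^ k) * p.roots.esymm k = (-1) ^ k * (LinearMap.toMatrix' (f ∘ₗ Φ)).det :=
    h1.symm.trans h2
  exact mul_left_cancel₀ (pow_ne_zero _ (by norm_num)) h3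

/-- The polarization of `c_k` on endomorphisms which factor through a fixed `ℂ^k → E`. -/
lemma polarization_elemSymm_of_factor {k : ℕ} (hk : k ≤ finrank ℂ E)
    (Φ : (Fin k → ℂ) →ₗ[ℂ] E) (f : Fin k → E →ₗ[ℂ] (Fin k → ℂ)) (M : Fin k → (E →L[ℂ] E))
    (hM : ∀ i, (M i : E →ₗ[ℂ] E) = Φ ∘ₗ f i) :
    polarization (elemSymm k) M = (k.factorial : ℂ)⁻¹ *
      ∑ τ : Equiv.Perm (Fin k), ∑ π : Equiv.Perm (Fin k),
        ((Equiv.Perm.sign π : ℤ) : ℂ) *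
          ∏ j, LinearMap.toMatrix' (f (τ j) ∘ₗ Φ) (π j) j := by
  rw [polarization, ← sum_neg_one_pow_mul_det_sum fun i => LinearMap.toMatrix' (f i ∘ₗ Φ)]
  congr 1
  refine Finset.sum_congr rfl fun s _ => ?_
  rw [elemSymm_of_factor hk Φ (∑ i ∈ s, f i)]
  · congr 2
    rw [← map_sum]
    congr 1
    refine LinearMap.ext fun x => ?_
    simp only [LinearMap.comp_apply, LinearMap.coe_sum, Finset.sum_apply]
  · refine LinearMap.ext fun x => ?_
    have hx : ∀ i, M i x = Φ (f i x) := fun i => LinearMap.congr_fun (hM i) x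
    simp only [ContinuousLinearMap.coe_coe, LinearMap.comp_apply, LinearMap.coe_sum,
      Finset.sum_apply, map_sum, ← hx]
    exact sum_apply _ _ _

end ElemSymm

/-! ### Determinants of matrices of two-forms -/

section TwoForms

variable {k : ℕ}

/-- Antisymmetrizing within the pairs `(i, 0), (i, 1)` is absorbed by the sum over all
permutations. -/
lemma sum_sign_prod_antisymm (B : Fin k → Fin k × Fin 2 → Fin k × Fin 2 → ℂ) :
    ∑ σ : Equiv.Perm (Fin k × Fin 2), ((Equiv.Perm.sign σ : ℤ) : ℂ) *
        ∏ i, (B i (σ (i, 0)) (σ (i, 1)) - B i (σ (i, 1)) (σ (i, 0))) =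
      2 ^ k * ∑ σ : Equiv.Perm (Fin k × Fin 2), ((Equiv.Perm.sign σ : ℤ) : ℂ) *
        ∏ i, B i (σ (i, 0)) (σ (i, 1)) := by
  -- `w t` exchanges the members of the pairs with index in `t`
  let w : Finset (Fin k) → Equiv.Perm (Fin k × Fin 2) := fun t =>
    Equiv.prodCongrRight fun i => if i ∈ t then Equiv.swap 0 1 else 1
  have hsw : Equiv.Perm.sign (Equiv.swap (0 : Fin 2) 1) = -1 :=
    Equiv.Perm.sign_swap (by decide)
  have hw : ∀ t, ((Equiv.Perm.sign (w t) : ℤ) : ℂ) = (-1) ^ t.card := by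
    intro t
    have : Equiv.Perm.sign (w t) = (-1) ^ t.card := by
      rw [Equiv.Perm.sign_prodCongrRight]
      simp only [apply_ite, hsw, Equiv.Perm.sign_one]
      rw [Finset.prod_ite_mem, Finset.univ_inter, Finset.prod_const]
    rw [this]; push_cast; rfl
  have hexp : ∀ σ : Equiv.Perm (Fin k × Fin 2),
      ∏ i, (B i (σ (i, 0)) (σ (i, 1)) - B i (σ (i, 1)) (σ (i, 0))) =
      ∑ t : Finset (Fin k), (-1) ^ t.card *
        ∏ i, B i ((σ * w t) (i, 0)) ((σ * w t) (i, 1)) := by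
    intro σ
    rw [Finset.prod_sub, Finset.powerset_univ]
    refine Finset.sum_congr rfl fun t _ => ?_
    rw [mul_assoc, ← Finset.compl_eq_univ_sdiff, mul_comm (∏ i ∈ tᶜ, _),
      ← Finset.prod_mul_prod_compl t fun i => B i ((σ * w t) (i, 0)) ((σ * w t) (i, 1))]
    congr 2
    · refine Finset.prod_congr rfl fun i hi => ?_
      simp [w, hi]
    · refine Finset.prod_congr rfl fun i hi => ?_
      simp [w, Finset.mem_compl.1 hi]
  simp only [hexp, Finset.mul_sum]
  rw [Finset.sum_comm]
  have hinner : ∀ t : Finset (Fin k),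
      ∑ σ : Equiv.Perm (Fin k × Fin 2), ((Equiv.Perm.sign σ : ℤ) : ℂ) *
        ((-1) ^ t.card * ∏ i, B i ((σ * w t) (i, 0)) ((σ * w t) (i, 1))) =
      ∑ σ : Equiv.Perm (Fin k × Fin 2), ((Equiv.Perm.sign σ : ℤ) : ℂ) *
        ∏ i, B i (σ (i, 0)) (σ (i, 1)) := by
    intro t
    conv_rhs => rw [← Equiv.sum_comp (Equiv.mulRight (w t))]
    refine Finset.sum_congr rfl fun σ _ => ?_
    rw [Equiv.coe_mulRight, Equiv.Perm.sign_mul]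
    push_cast
    rw [hw, mul_assoc]
  simp only [hinner]
  rw [Finset.sum_const, Finset.card_univ, Fintype.card_finset, Fintype.card_fin, nsmul_eq_mul,
    Finset.mul_sum]
  push_cast
  rfl

/-- Permuting the pairs does not change the signed sum, two-forms being of even degree. -/
lemma sum_sign_prod_perm_pairs (τ : Equiv.Perm (Fin k))
    (N : Fin k → Fin k × Fin 2 → Fin k × Fin 2 → ℂ) :
    ∑ σ : Equiv.Perm (Fin k × Fin 2), ((Equiv.Perm.sign σ : ℤ) : ℂ) *
        ∏ i, N i (σ (τ i, 0)) (σ (τ i, 1)) =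
      ∑ σ : Equiv.Perm (Fin k × Fin 2), ((Equiv.Perm.sign σ : ℤ) : ℂ) *
        ∏ i, N i (σ (i, 0)) (σ (i, 1)) := by
  let w : Equiv.Perm (Fin k × Fin 2) := Equiv.prodCongrLeft fun _ => τ
  have hw : Equiv.Perm.sign w = 1 := by
    rw [Equiv.Perm.sign_prodCongrLeft, Fin.prod_univ_two, ← sq, Int.units_sq]
  conv_rhs => rw [← Equiv.sum_comp (Equiv.mulRight w)]
  refine Finset.sum_congr rfl fun σ _ => ?_
  rw [Equiv.coe_mulRight, Equiv.Perm.sign_mul, hw, mul_one]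
  rfl

/-- The matrix whose rows are, alternately, the forms `α₀, β₀, α₁, β₁, …`, each given by its values
on vectors indexed by `Fin k × Fin 2`; the row of `α_i` has the index `(i, 0)`, that of `β_i` the
index `(i, 1)`. -/
def pairRows (α β : Fin k → Fin k × Fin 2 → ℂ) :
    Matrix (Fin k × Fin 2) (Fin k × Fin 2) ℂ :=
  Matrix.of fun p q => if p.2 = 0 then α p.1 q else β p.1 q

/-- The value of `α₀ ∧ β₀ ∧ α₁ ∧ β₁ ∧ ⋯` is a determinant. -/
lemma sum_sign_prod_eq_det (α β : Fin k → Fin k × Fin 2 → ℂ) :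
    ∑ σ : Equiv.Perm (Fin k × Fin 2), ((Equiv.Perm.sign σ : ℤ) : ℂ) *
        ∏ i, (α i (σ (i, 0)) * β i (σ (i, 1))) = (pairRows α β).det := by
  rw [← Matrix.det_transpose, Matrix.det_apply']
  refine Finset.sum_congr rfl fun σ _ => ?_
  rw [Fintype.prod_prod_type]
  simp [pairRows, Fin.prod_univ_two]

lemma det_pairRows_perm (π : Equiv.Perm (Fin k)) (α β : Fin k → Fin k × Fin 2 → ℂ) :
    (pairRows (fun i => α (π i)) β).det =
      ((Equiv.Perm.sign π : ℤ) : ℂ) * (pairRows α β).det := by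
  let w : Equiv.Perm (Fin k × Fin 2) := Equiv.prodCongrLeft fun b => if b = 0 then π else 1
  have hw : Equiv.Perm.sign w = Equiv.Perm.sign π := by
    rw [Equiv.Perm.sign_prodCongrLeft, Fin.prod_univ_two]
    simp
  have : pairRows (fun i => α (π i)) β = (pairRows α β).submatrix w id := by
    ext ⟨i, b⟩ q
    fin_cases b <;> simp [pairRows, w]
  rw [this, Matrix.det_permute, hw]

/-- Summing a function of `π 0` over all permutations `π`. -/
lemma sum_perm_apply_zero {m : ℕ} (f : Fin (m + 1) → ℂ) :
    ∑ π : Equiv.Perm (Fin (m + 1)), f (π 0) = m.factorial * ∑ p, f p := by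
  rw [← Equiv.sum_comp Equiv.Perm.decomposeFin.symm, Fintype.sum_prod_type]
  simp [Finset.mul_sum, Fintype.card_perm]

/-- The signed sum defining the Chern form, for a matrix `N` of two-forms `N_ab = α_a ∧ β_b`, except
that `N_00` is half of `α₀ ∧ β₀` plus a form `κ` (antisymmetrized) without `dt`. Here `(0, 0)` is
the index of the vector `∂/∂t`, and only `α₀`, `β₀` involve `dt`. All products
`∏ N_{π j, j}` are multiples of `α₀ ∧ β₀ ∧ α₁ ∧ β₁ ∧ ⋯` with the sign of `π`, which cancels the
sign in the determinant; those with `π 0 = 0` count one half. -/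
lemma sum_sign_polarization {m : ℕ} (α β : Fin (m + 1) → Fin (m + 1) × Fin 2 → ℂ)
    (κ : Fin (m + 1) × Fin 2 → Fin (m + 1) × Fin 2 → ℂ)
    (N : Fin (m + 1) × Fin 2 → Fin (m + 1) × Fin 2 → Matrix (Fin (m + 1)) (Fin (m + 1)) ℂ)
    (hα : ∀ j, j ≠ 0 → α j (0, 0) = 0) (hβ : ∀ j, j ≠ 0 → β j (0, 0) = 0)
    (hκ : ∀ q, κ (0, 0) q = 0 ∧ κ q (0, 0) = 0)
    (hN₀ : ∀ q q', N q q' 0 0 = (α 0 q * β 0 q' / 2 + κ q q') - (α 0 q' * β 0 q / 2 + κ q' q))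
    (hN : ∀ a b, ¬(a = 0 ∧ b = 0) → ∀ q q', N q q' a b = α a q * β b q' - α a q' * β b q) :
    ∑ σ : Equiv.Perm (Fin (m + 1) × Fin 2), ((Equiv.Perm.sign σ : ℤ) : ℂ) *
      (((m + 1).factorial : ℂ)⁻¹ * ∑ τ : Equiv.Perm (Fin (m + 1)),
        ∑ π : Equiv.Perm (Fin (m + 1)), ((Equiv.Perm.sign π : ℤ) : ℂ) *
          ∏ j, N (σ (τ j, 0)) (σ (τ j, 1)) (π j) j) =
      2 ^ (m + 1) * (m.factorial * (2 * m + 1) / 2) * (pairRows α β).det := by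
  set B : Fin (m + 1) → Fin (m + 1) → Fin (m + 1) × Fin 2 → Fin (m + 1) × Fin 2 → ℂ :=
    fun a b q q' => if a = 0 ∧ b = 0 then α 0 q * β 0 q' / 2 + κ q q' else α a q * β b q' with hB
  have hNB : ∀ a b q q', N q q' a b = B a b q q' - B a b q' q := by
    intro a b q q'
    by_cases h : a = 0 ∧ b = 0
    · rw [h.1, h.2, hN₀]; simp only [hB, and_self, if_true]
    · simp only [hB, if_neg h]; exact hN a b h q q'
  -- the contribution of one permutation `π`
  have hπ : ∀ π : Equiv.Perm (Fin (m + 1)),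
      ∑ σ : Equiv.Perm (Fin (m + 1) × Fin 2), ((Equiv.Perm.sign σ : ℤ) : ℂ) *
        ∏ i, B (π i) i (σ (i, 0)) (σ (i, 1)) =
      (if π 0 = 0 then 1 / 2 else 1) *
        (((Equiv.Perm.sign π : ℤ) : ℂ) * (pairRows α β).det) := by
    intro π
    rw [← det_pairRows_perm, ← sum_sign_prod_eq_det, Finset.mul_sum]
    refine Finset.sum_congr rfl fun σ _ => ?_
    rw [mul_left_comm]
    congr 1
    by_cases h0 : π 0 = 0
    · rw [if_pos h0, Fin.prod_univ_succ, Fin.prod_univ_succ]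
      have hs : ∀ i : Fin m, B (π i.succ) i.succ (σ (i.succ, 0)) (σ (i.succ, 1)) =
          α (π i.succ) (σ (i.succ, 0)) * β i.succ (σ (i.succ, 1)) := by
        intro i
        simp only [hB]
        rw [if_neg]
        exact fun h => Fin.succ_ne_zero i h.2
      simp only [hs]
      have hB0 : B (π 0) 0 (σ (0, 0)) (σ (0, 1)) =
          α 0 (σ (0, 0)) * β 0 (σ (0, 1)) / 2 + κ (σ (0, 0)) (σ (0, 1)) := by
        simp only [hB, h0, and_self, if_true]
      rw [hB0, h0, add_mul]
      -- the vector `∂/∂t` is fed to a form which does not involve `dt`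
      have hz : κ (σ (0, 0)) (σ (0, 1)) *
          ∏ i : Fin m, α (π i.succ) (σ (i.succ, 0)) * β i.succ (σ (i.succ, 1)) = 0 := by
        obtain ⟨⟨i, b⟩, hib⟩ := σ.surjective (0, 0)
        induction i using Fin.cases with
        | zero =>
          fin_cases b
          · have : σ (0, 0) = (0, 0) := hib
            rw [this, (hκ _).1, zero_mul]
          · have : σ (0, 1) = (0, 0) := hib
            rw [this, (hκ _).2, zero_mul]
        | succ i =>
          refine mul_eq_zero_of_right _ (Finset.prod_eq_zero (Finset.mem_univ i) ?_)
          fin_cases b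
          · have : σ (i.succ, 0) = (0, 0) := hib
            rw [this, hα, zero_mul]
            intro h
            exact Fin.succ_ne_zero i (π.injective (h.trans h0.symm))
          · have : σ (i.succ, 1) = (0, 0) := hib
            rw [this, hβ _ (Fin.succ_ne_zero i), mul_zero]
      rw [hz]
      ring
    · rw [if_neg h0, one_mul]
      refine Finset.prod_congr rfl fun i _ => ?_
      simp only [hB]
      rw [if_neg]
      rintro ⟨h, rfl⟩
      exact h0 h
  -- neither `τ` nor the antisymmetrization matters
  have hπ' : ∀ π : Equiv.Perm (Fin (m + 1)), ∀ τ : Equiv.Perm (Fin (m + 1)),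
      ∑ σ : Equiv.Perm (Fin (m + 1) × Fin 2), ((Equiv.Perm.sign σ : ℤ) : ℂ) *
        ∏ j, N (σ (τ j, 0)) (σ (τ j, 1)) (π j) j =
      2 ^ (m + 1) * ((if π 0 = 0 then 1 / 2 else 1) *
        (((Equiv.Perm.sign π : ℤ) : ℂ) * (pairRows α β).det)) := by
    intro π τ
    rw [← hπ, sum_sign_prod_perm_pairs τ fun j q q' => N q q' (π j) j]
    simp only [hNB]
    exact sum_sign_prod_antisymm fun i => B (π i) i
  have hswap : ∑ σ : Equiv.Perm (Fin (m + 1) × Fin 2), ((Equiv.Perm.sign σ : ℤ) : ℂ) *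
      (((m + 1).factorial : ℂ)⁻¹ * ∑ τ : Equiv.Perm (Fin (m + 1)),
        ∑ π : Equiv.Perm (Fin (m + 1)), ((Equiv.Perm.sign π : ℤ) : ℂ) *
          ∏ j, N (σ (τ j, 0)) (σ (τ j, 1)) (π j) j) =
      ((m + 1).factorial : ℂ)⁻¹ * ∑ τ : Equiv.Perm (Fin (m + 1)), ∑ π : Equiv.Perm (Fin (m + 1)),
        ((Equiv.Perm.sign π : ℤ) : ℂ) *
        ∑ σ : Equiv.Perm (Fin (m + 1) × Fin 2), ((Equiv.Perm.sign σ : ℤ) : ℂ) *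
          ∏ j, N (σ (τ j, 0)) (σ (τ j, 1)) (π j) j := by
    simp only [Finset.mul_sum]
    rw [Finset.sum_comm]
    refine Finset.sum_congr rfl fun τ _ => ?_
    rw [Finset.sum_comm]
    refine Finset.sum_congr rfl fun π _ => Finset.sum_congr rfl fun σ _ => ?_
    ring
  rw [hswap]
  simp only [hπ']
  have hsq : ∀ π : Equiv.Perm (Fin (m + 1)), ((Equiv.Perm.sign π : ℤ) : ℂ) *
      (2 ^ (m + 1) * ((if π 0 = 0 then 1 / 2 else 1) *
        (((Equiv.Perm.sign π : ℤ) : ℂ) * (pairRows α β).det))) =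
      (if π 0 = 0 then 1 / 2 else 1) * (2 ^ (m + 1) * (pairRows α β).det) := by
    intro π
    have : ((Equiv.Perm.sign π : ℤ) : ℂ) * ((Equiv.Perm.sign π : ℤ) : ℂ) = 1 := by
      rw [← Int.cast_mul, ← Units.val_mul, Int.units_mul_self]; simp
    linear_combination
      ((2 : ℂ) ^ (m + 1) * (if π 0 = 0 then 1 / 2 else 1) * (pairRows α β).det) * this
  simp only [hsq]
  rw [← Finset.sum_mul, sum_perm_apply_zero fun p => if p = 0 then (1 / 2 : ℂ) else 1,
    Finset.sum_const, Finset.card_univ, Fintype.card_perm, Fintype.card_fin, nsmul_eq_mul,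
    inv_mul_cancel_left₀ (by exact_mod_cast (Nat.factorial_pos (m + 1)).ne'), Fin.sum_univ_succ]
  simp [Fin.succ_ne_zero]
  ring

end TwoForms

/-! ### The curvature of the path of connections -/

section Curvature

variable {E : Type*} [NormedAddCommGroup E] [InnerProductSpace ℂ E] [FiniteDimensional ℂ E]

/-- `F = dt ∧ ω + (t² - t) ω ∧ ω` for the connection form `t ω`, `ω = g⁻¹dg`. -/
lemma curvature_pathConnection (t : ℝ) (g : (E →L[ℂ] E)ˣ) (v w : ℝ × (E →L[ℂ] E)) :
    curvature (pathConnection (E := E)) (t, (g : E →L[ℂ] E)) v w =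
      v.1 • (Ring.inverse (g : E →L[ℂ] E) * w.2) - w.1 • (Ring.inverse (g : E →L[ℂ] E) * v.2) +
      (t ^ 2 - t) • ((Ring.inverse (g : E →L[ℂ] E) * v.2) * (Ring.inverse (g : E →L[ℂ] E) * w.2) -
        (Ring.inverse (g : E →L[ℂ] E) * w.2) * (Ring.inverse (g : E →L[ℂ] E) * v.2)) := by
  have := FiniteDimensional.complete ℂ E
  let Λ : (E →L[ℂ] E) →L[ℝ] ((ℝ × (E →L[ℂ] E)) →L[ℝ] (E →L[ℂ] E)) :=
    ((ContinuousLinearMap.compL ℝ (ℝ × (E →L[ℂ] E)) (E →L[ℂ] E) (E →L[ℂ] E)).flip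
      (ContinuousLinearMap.snd ℝ ℝ (E →L[ℂ] E))).comp (ContinuousLinearMap.mul ℝ (E →L[ℂ] E))
  have hΛ : ∀ a (w : ℝ × (E →L[ℂ] E)), Λ a w = a * w.2 := fun a w => rfl
  have hinv : HasFDerivAt (fun p : ℝ × (E →L[ℂ] E) => Λ (Ring.inverse p.2))
      (Λ.comp ((-((ContinuousLinearMap.mulLeftRight ℝ (E →L[ℂ] E)) ↑g⁻¹) ↑g⁻¹).comp
        (ContinuousLinearMap.snd ℝ ℝ (E →L[ℂ] E)))) (t, (g : E →L[ℂ] E)) := by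
    have h1 : HasFDerivAt (Prod.snd : ℝ × (E →L[ℂ] E) → (E →L[ℂ] E))
      (ContinuousLinearMap.snd ℝ ℝ (E →L[ℂ] E)) (t, (g : E →L[ℂ] E)) := hasFDerivAt_snd
    have h2 : HasFDerivAt (Ring.inverse : (E →L[ℂ] E) → (E →L[ℂ] E))
      (-((ContinuousLinearMap.mulLeftRight ℝ (E →L[ℂ] E)) ↑g⁻¹) ↑g⁻¹)
      ((t, (g : E →L[ℂ] E)) : ℝ × (E →L[ℂ] E)).2 := hasFDerivAt_ringInverse (𝕜 := ℝ) g
    have h3 := HasFDerivAt.comp _ h2 h1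
    have h4 : HasFDerivAt (fun a => Λ a) Λ
      ((Ring.inverse ∘ Prod.snd) ((t, (g : E →L[ℂ] E)) : ℝ × (E →L[ℂ] E))) := Λ.hasFDerivAt
    exact HasFDerivAt.comp _ h4 h3
  have hθ : HasFDerivAt (pathConnection (E := E)) _ (t, (g : E →L[ℂ] E)) :=
    (hasFDerivAt_fst (𝕜 := ℝ) (p := ((t, (g : E →L[ℂ] E)) : ℝ × (E →L[ℂ] E)))).smul hinv
  have hval : ∀ v w : ℝ × (E →L[ℂ] E),
      fderiv ℝ (pathConnection (E := E)) (t, (g : E →L[ℂ] E)) v w =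
      v.1 • (Ring.inverse (g : E →L[ℂ] E) * w.2) -
        t • ((Ring.inverse (g : E →L[ℂ] E) * v.2) * (Ring.inverse (g : E →L[ℂ] E) * w.2)) := by
    intro v w
    rw [hθ.fderiv]
    simp [hΛ, mul_assoc]
    abel
  have hpt : ∀ v : ℝ × (E →L[ℂ] E), pathConnection (E := E) (t, (g : E →L[ℂ] E)) v =
      t • (Ring.inverse (g : E →L[ℂ] E) * v.2) := fun v => rfl
  rw [curvature, hval, hval, hpt, hpt]
  simp only [smul_mul_smul_comm, sub_smul, smul_sub, sq]
  abel

end Curvature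

/-! ### Affine charts on the complex reflections -/

section AffineChart

variable {E : Type*} [NormedAddCommGroup E] [InnerProductSpace ℂ E]

/-- The operator `x ⊗ y^*`, that is, `z ↦ ⟪y, z⟫ x`. -/
def outer (x y : E) : E →L[ℂ] E := InnerProductSpace.rankOne ℂ x y

lemma outer_apply (x y z : E) : outer x y z = inner ℂ y z • x := rfl

lemma isBoundedBilinearMap_outer :
    IsBoundedBilinearMap ℝ fun p : E × E => outer p.1 p.2 where
  add_left x x' y := by simp [outer]
  smul_left c x y := by ext z; simp [outer]
  add_right x y y' := by simp [outer]
  smul_right c x y := by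
    ext z
    simp only [outer, InnerProductSpace.rankOne_apply, smul_apply, inner_smul_left_eq_star_smul,
      starRingEnd_apply, star_trivial]
    rw [smul_assoc]
  bound := ⟨1, one_pos, fun x y => by simp [outer]⟩

/-- The map `1 + (a / ‖v‖²) v ⊗ v^*`, which multiplies `v` by `1 + a` and is the identity on its
orthogonal complement. For `v = 0` it is the identity. -/
def lineMul (a : ℂ) (v : E) : E →L[ℂ] E :=
  1 + (a / inner ℂ v v) • outer v v

lemma lineMul_apply (a : ℂ) (v x : E) :
    lineMul a v x = x + (a / inner ℂ v v * inner ℂ v x) • v := by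
  simp [lineMul, outer_apply, smul_smul]

lemma phi_span_singleton [FiniteDimensional ℂ E] (l : ℂ) (v : E) :
    phi l (Submodule.span ℂ {v}) = lineMul (l - 1) v := by
  ext x
  rw [phi, Submodule.starProjection_orthogonal', lineMul_apply]
  simp only [add_apply, smul_apply,
    sub_apply, one_apply_eq_self,
    Submodule.starProjection_singleton, smul_smul, inner_self_eq_norm_sq_to_K]
  rw [show ((RCLike.ofReal (‖v‖ ^ 2) : ℂ)) = (RCLike.ofReal ‖v‖ : ℂ) ^ 2 by push_cast; rfl]
  module

/-- The complex coordinates `z_j = x_j + i y_j`, `1 ≤ j < k`, of `(θ, x₁, y₁, …)`; the entry of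
index `0` is set to `0`. -/
def coordZ {k : ℕ} (y : Fin (2 * k - 1) → ℝ) (j : Fin k) : ℂ :=
  if h : (j : ℕ) = 0 then 0 else
    (y ⟨2 * j - 1, by omega⟩ : ℂ) + (y ⟨2 * j, by omega⟩ : ℂ) * Complex.I

/-- `∑ z_j e_j`, `1 ≤ j < k`, the linear part of the homogeneous vector `e₀ + ∑ z_j e_j`. -/
def chartDir {k : ℕ} (e : Fin k → E) : (Fin (2 * k - 1) → ℝ) →L[ℝ] E :=
  LinearMap.toContinuousLinearMap
    { toFun := fun y => ∑ j, coordZ y j • e j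
      map_add' := fun y y' => by
        rw [← Finset.sum_add_distrib]
        refine Finset.sum_congr rfl fun j _ => ?_
        rw [← add_smul]
        congr 1
        unfold coordZ
        split_ifs
        · simp
        · simp only [Pi.add_apply]; push_cast; ring
      map_smul' := fun c y => by
        rw [Finset.smul_sum]
        refine Finset.sum_congr rfl fun j _ => ?_
        rw [RingHom.id_apply, ← smul_assoc]
        congr 1
        unfold coordZ
        split_ifs
        · simp
        · simp only [Pi.smul_apply, smul_eq_mul, Complex.real_smul]; push_cast; ring }

lemma chartDir_apply {k : ℕ} (e : Fin k → E) (y : Fin (2 * k - 1) → ℝ) :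
    chartDir e y = ∑ j, coordZ y j • e j := rfl

variable {m : ℕ}

/-- The homogeneous vector `e₀ + ∑ z_j e_j`. -/
def chartVec (e : Fin (m + 1) → E) (y : Fin (2 * (m + 1) - 1) → ℝ) : E := e 0 + chartDir e y

/-- The angular coordinate. -/
def coordθ (y : Fin (2 * (m + 1) - 1) → ℝ) : ℝ := y ⟨0, by omega⟩

/-- The coordinate system `phiChart` for a family of vectors in place of a basis. -/
def chart (e : Fin (m + 1) → E) (y : Fin (2 * (m + 1) - 1) → ℝ) : E →L[ℂ] E :=
  lineMul (Complex.exp (coordθ y * Complex.I) - 1) (chartVec e y)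

lemma phiChart_eq_chart [FiniteDimensional ℂ E] {W : ℕ → Submodule ℂ E}
    (b : Basis (Fin (m + 1)) ℂ ↥(W (m + 1))ᗮ) :
    phiChart b = chart fun j => (b j : E) := by
  funext y
  rw [phiChart, chart, phi_span_singleton]
  have h : 0 < 2 * (m + 1) - 1 := by omega
  rw [dif_pos h]
  congr 1
  rw [chartVec, chartDir_apply, Fin.sum_univ_succ, Fin.sum_univ_succ]
  simp [coordZ]

lemma chartVec_ne_zero {e : Fin (m + 1) → E} (he : LinearIndependent ℂ e)
    (y : Fin (2 * (m + 1) - 1) → ℝ) : chartVec e y ≠ 0 := by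
  intro h
  have : ∑ j, (if j = 0 then 1 else coordZ y j) • e j = 0 := by
    rw [← h, chartVec, chartDir_apply, Fin.sum_univ_succ, Fin.sum_univ_succ]
    simp [coordZ]
  have := Fintype.linearIndependent_iff.1 he _ this 0
  simp at this

lemma contDiff_chart {e : Fin (m + 1) → E} (he : LinearIndependent ℂ e) :
    ContDiff ℝ ∞ (chart e) := by
  have hv : ContDiff ℝ ∞ (chartVec e) := contDiff_const.add (chartDir e).contDiff
  have hθ : ContDiff ℝ ∞ (coordθ (m := m)) := contDiff_apply ℝ ℝ _
  have hexp : ContDiff ℝ ∞ fun y : Fin (2 * (m + 1) - 1) → ℝ =>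
      Complex.exp (coordθ y * Complex.I) :=
    (((Complex.ofRealCLM.contDiff.comp hθ).mul contDiff_const)).cexp
  have hin : ContDiff ℝ ∞ fun y => inner ℂ (chartVec e y) (chartVec e y) := hv.inner ℂ hv
  have hR : ContDiff ℝ ∞ fun y => outer (chartVec e y) (chartVec e y) :=
    ContDiff.comp (g := fun p : E × E => outer p.1 p.2) isBoundedBilinearMap_outer.contDiff
      (hv.prodMk hv)
  have hq : ContDiff ℝ ∞ fun y : Fin (2 * (m + 1) - 1) → ℝ =>
      (Complex.exp (coordθ y * Complex.I) - 1) / inner ℂ (chartVec e y) (chartVec e y) := by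
    simp only [div_eq_mul_inv]
    exact (hexp.sub contDiff_const).mul
      (hin.inv fun y => inner_self_ne_zero.2 (chartVec_ne_zero he y))
  exact contDiff_const.add (hq.smul hR)

/-- The derivative of `l ↦ 1 + (l - 1) ⟨v, v⟩⁻¹ ⟨v, ·⟩ v` along a curve with `l' = i θ' l` and
`v' = d`. -/
lemma fderiv_chart {e : Fin (m + 1) → E} (he : LinearIndependent ℂ e)
    (y η : Fin (2 * (m + 1) - 1) → ℝ) {v d : E} (hv : chartVec e y = v) (hd : chartDir e η = d)
    {l : ℂ} (hl : Complex.exp (coordθ y * Complex.I) = l) :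
    fderiv ℝ (chart e) y η =
      ((Complex.I * l * coordθ η * inner ℂ v v - (l - 1) * (inner ℂ v d + inner ℂ d v)) /
        inner ℂ v v ^ 2) • outer v v +
      ((l - 1) / inner ℂ v v) • (outer v d + outer d v) := by
  have h1 : HasDerivAt (fun s : ℝ => y + s • η) η 0 := by
    simpa using ((hasDerivAt_id (0 : ℝ)).smul_const η).const_add y
  have hy0 : y + (0 : ℝ) • η = y := by simp
  have h2 : HasDerivAt (fun s : ℝ => chart e (y + s • η)) (fderiv ℝ (chart e) y η) 0 := by
    have h3 : HasFDerivAt (chart e) (fderiv ℝ (chart e) y) (y + (0 : ℝ) • η) := by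
      rw [hy0]
      exact ((contDiff_chart he).differentiable (by simp) y).hasFDerivAt
    exact h3.comp_hasDerivAt (0 : ℝ) h1
  have hvd : HasDerivAt (fun s : ℝ => chartVec e (y + s • η)) d 0 := by
    have : (fun s : ℝ => chartVec e (y + s • η)) = fun s : ℝ => v + s • d := by
      funext s
      rw [← hv, ← hd, chartVec, chartVec, map_add, map_smul, add_assoc]
    rw [this]
    simpa using ((hasDerivAt_id (0 : ℝ)).smul_const d).const_add v
  have hin := hvd.inner ℂ hvd
  have hθ : HasDerivAt (fun s : ℝ => Complex.exp (coordθ (y + s • η) * Complex.I) - 1)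
      (l * (coordθ η * Complex.I)) 0 := by
    have : HasDerivAt (fun s : ℝ => (coordθ (y + s • η) : ℂ) * Complex.I)
        (coordθ η * Complex.I) 0 := by
      have h4 : HasDerivAt (fun s : ℝ => coordθ (y + s • η)) (coordθ η) 0 := by
        have := ((hasDerivAt_id (0 : ℝ)).mul_const (coordθ η)).const_add (coordθ y)
        simp only [id, one_mul] at this
        exact this
      exact h4.ofReal_comp.mul_const _
    have h5 := this.cexp.sub_const 1
    simpa [hl] using h5
  have hR : HasDerivAt (fun s : ℝ => outer (chartVec e (y + s • η))
      (chartVec e (y + s • η))) (outer v d + outer d v) 0 := by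
    have h5 := (isBoundedBilinearMap_outer (E := E)).hasFDerivAt
      (chartVec e (y + (0 : ℝ) • η), chartVec e (y + (0 : ℝ) • η))
    have h6 := h5.comp_hasDerivAt (0 : ℝ) (hvd.prodMk hvd)
    simp only [Function.comp_def, hy0, hv] at h6
    exact h6
  have hne : inner ℂ (chartVec e (y + (0 : ℝ) • η)) (chartVec e (y + (0 : ℝ) • η)) ≠ 0 :=
    inner_self_ne_zero.2 (chartVec_ne_zero he _)
  have h7 := ((hθ.div hin hne).smul hR).const_add (1 : E →L[ℂ] E)
  have h8 : HasDerivAt (fun s : ℝ => chart e (y + s • η)) _ 0 := h7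
  rw [h2.unique h8]
  simp only [hy0, hv, hl]
  rw [add_comm]
  congr 1
  · congr 1
    simp
    ring
  · simp [hl, hv]

end AffineChart

/-! ### Row operations and the determinant of the coordinate forms -/

section PairRows

variable {k : ℕ}

/-- Replacing each pair of rows `α_i, β_i` by linear combinations of them. -/
lemma det_pairRows_of_blocks (c : Fin k → Matrix (Fin 2) (Fin 2) ℂ)
    {α β α' β' : Fin k → Fin k × Fin 2 → ℂ}
    (hα : ∀ i q, α' i q = c i 0 0 * α i q + c i 0 1 * β i q)
    (hβ : ∀ i q, β' i q = c i 1 0 * α i q + c i 1 1 * β i q) :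
    (pairRows α' β').det = (∏ i, (c i).det) * (pairRows α β).det := by
  have : pairRows α' β' = ((Matrix.blockDiagonal c).submatrix (Equiv.prodComm (Fin k) (Fin 2))
      (Equiv.prodComm (Fin k) (Fin 2))) * pairRows α β := by
    ext ⟨i, b⟩ q
    rw [Matrix.mul_apply, Fintype.sum_prod_type, Finset.sum_eq_single i]
    · fin_cases b
      · simp [pairRows, Fin.sum_univ_two, hα, Matrix.blockDiagonal_apply]
      · simp [pairRows, Fin.sum_univ_two, hβ, Matrix.blockDiagonal_apply]
    · intro j _ hj
      simp [Matrix.blockDiagonal_apply, hj.symm]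
    · simp
  rw [this, Matrix.det_mul, Matrix.det_submatrix_equiv_self, Matrix.det_blockDiagonal]

/-- Replacing the rows `β_i` by linear combinations of them. -/
lemma det_pairRows_of_right (G : Matrix (Fin k) (Fin k) ℂ)
    {α β β' : Fin k → Fin k × Fin 2 → ℂ} (hβ : ∀ l q, β' l q = ∑ n, G l n * β n q) :
    (pairRows α β').det = G.det * (pairRows α β).det := by
  have : pairRows α β' = Matrix.blockDiagonal (fun b : Fin 2 => if b = 0 then 1 else G) *
      pairRows α β := by
    ext ⟨i, b⟩ q
    rw [Matrix.mul_apply, Fintype.sum_prod_type_right, Finset.sum_eq_single b]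
    · fin_cases b
      · simp [pairRows, Matrix.blockDiagonal_apply, Matrix.one_apply]
      · simp [pairRows, hβ, Matrix.blockDiagonal_apply]
    · intro j _ hj
      simp [Matrix.blockDiagonal_apply, hj.symm]
    · simp
  rw [this, Matrix.det_mul, Matrix.det_blockDiagonal, Fin.prod_univ_two]
  simp

/-- The bijection `(i, b) ↦ 2 i + b`: the position in the list `0, …, 2k - 1` of the member `b` of
the pair `i`. -/
def pairIndex (k : ℕ) : Fin k × Fin 2 ≃ Fin (2 * k) :=
  (finProdFinEquiv (m := k) (n := 2)).trans (finCongr (mul_comm k 2))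

lemma pairIndex_val (p : Fin k × Fin 2) : (pairIndex k p : ℕ) = 2 * p.1 + p.2 := by
  simp [pairIndex, finProdFinEquiv]
  omega

end PairRows

section CoordinateForms

variable {m : ℕ}

/-- The component along `∂/∂t` of the `q`-th vector of the list `∂/∂t, X₀, X₁, …`, arranged in
pairs by `pairIndex`. -/
def colT (m : ℕ) (q : Fin (m + 1) × Fin 2) : ℝ := if q = (0, 0) then 1 else 0

/-- The component in the coordinate space of the `q`-th vector of the list `∂/∂t, X₀, X₁, …`,
arranged in pairs by `pairIndex`; it vanishes for `∂/∂t`. -/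
def colX (X : Fin (2 * (m + 1) - 1) → Fin (2 * (m + 1) - 1) → ℝ) (q : Fin (m + 1) × Fin 2) :
    Fin (2 * (m + 1) - 1) → ℝ :=
  if h : (pairIndex (m + 1) q : ℕ) = 0 then 0 else X ⟨(pairIndex (m + 1) q : ℕ) - 1, by omega⟩

lemma pairIndex_eq_zero_iff (q : Fin (m + 1) × Fin 2) :
    (pairIndex (m + 1) q : ℕ) = 0 ↔ q = (0, 0) := by
  obtain ⟨i, b⟩ := q
  rw [pairIndex_val, Prod.mk.injEq, ← Fin.val_eq_zero_iff, ← Fin.val_eq_zero_iff]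
  simp

lemma colX_zero (X : Fin (2 * (m + 1) - 1) → Fin (2 * (m + 1) - 1) → ℝ) :
    colX X (0, 0) = 0 := by
  rw [colX, dif_pos ((pairIndex_eq_zero_iff _).2 rfl)]

/-- The determinant of the coordinate forms `dt, dθ, dx₁, dy₁, …` on `∂/∂t, X₀, X₁, …`. -/
lemma det_pairRows_coord (X : Fin (2 * (m + 1) - 1) → Fin (2 * (m + 1) - 1) → ℝ)
    (α β : Fin (m + 1) → Fin (m + 1) × Fin 2 → ℂ)
    (hα₀ : ∀ q, α 0 q = colT m q)
    (hα : ∀ j, (hj : j ≠ 0) → ∀ q, α j q = colX X q ⟨2 * j - 1, by omega⟩)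
    (hβ : ∀ j q, β j q = colX X q ⟨2 * j, by omega⟩) :
    (pairRows α β).det = ((Matrix.of X).det : ℂ) := by
  -- the same matrix in block form, with rows and columns numbered `0, …, 2m + 1`
  let Y : Matrix (Fin (2 * m + 1 + 1)) (Fin (2 * m + 1 + 1)) ℝ :=
    Matrix.of (Fin.cons (Fin.cons 1 0) fun p => Fin.cons 0 fun c => X c p)
  have hY : Y.det = (Matrix.of X).det := by
    rw [Matrix.det_succ_row_zero, Fin.sum_univ_succ]
    have h1 : (Y.submatrix Fin.succ (Fin.succAbove 0)) = (Matrix.of X).transpose := by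
      ext a b
      simp [Y]
    rw [h1, Matrix.det_transpose]
    have : ∀ i : Fin (2 * m + 1), Y 0 i.succ = 0 := fun i => by simp [Y]
    simp only [this]
    simp [Y]
  have hpr : pairRows α β =
      (Y.map ((↑) : ℝ → ℂ)).submatrix (pairIndex (m + 1)) (pairIndex (m + 1)) := by
    ext p q
    rw [Matrix.submatrix_apply, Matrix.map_apply]
    have hcol : ∀ (c : Fin (2 * m + 1 + 1)) (p : Fin (2 * m + 1 + 1)) (q : Fin (m + 1) × Fin 2),
        (pairIndex (m + 1) q : Fin (2 * m + 1 + 1)) = c → Y p c =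
          if h : (p : ℕ) = 0 then colT m q else colX X q ⟨p - 1, by omega⟩ := by
      intro c p q hq
      have hq' : (pairIndex (m + 1) q : ℕ) = (c : ℕ) := congrArg Fin.val hq
      induction p using Fin.cases with
      | zero =>
        induction c using Fin.cases with
        | zero => simp [Y, colT, (pairIndex_eq_zero_iff q).1 hq']
        | succ c =>
          have : q ≠ (0, 0) := by
            intro h
            have := (pairIndex_eq_zero_iff q).2 h
            simp at hq'
            omega
          simp [Y, colT, this]
      | succ p =>
        have hp : ((p.succ : Fin (2 * m + 1 + 1)) : ℕ) ≠ 0 := by simp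
        rw [dif_neg hp]
        induction c using Fin.cases with
        | zero => simp [Y, (pairIndex_eq_zero_iff q).1 hq', colX_zero]
        | succ c =>
          have h0 : (pairIndex (m + 1) q : ℕ) ≠ 0 := by rw [hq']; simp
          rw [colX, dif_neg h0]
          simp only [Y, Matrix.of_apply, Fin.cons_succ]
          congr 1
          exact Fin.ext (by simp [hq'])
    rw [hcol _ (pairIndex (m + 1) p) q rfl]
    obtain ⟨i, b⟩ := p
    have hv := pairIndex_val (i, b)
    by_cases hi : i = 0
    · subst hi
      fin_cases b
      · simp only [pairRows, Matrix.of_apply]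
        rw [dif_pos (by rw [hv]; rfl)]
        simp [hα₀]
      · simp only [pairRows, Matrix.of_apply]
        rw [dif_neg (by rw [hv]; simp)]
        simp only [Fin.mk_one, Fin.isValue, one_ne_zero, if_false, hβ]
        congr 2
    · have hi' : (i : ℕ) ≠ 0 := fun h => hi (Fin.ext h)
      fin_cases b
      · simp only [pairRows, Matrix.of_apply]
        rw [dif_neg (by rw [hv]; simp [hi])]
        simp only [Fin.zero_eta, if_true, hα i hi]
        congr 2
        exact Fin.ext (congrArg (fun n => n - 1) hv).symm
      · simp only [pairRows, Matrix.of_apply]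
        rw [dif_neg (by rw [hv]; simp)]
        simp only [Fin.mk_one, Fin.isValue, one_ne_zero, if_false, hβ]
        congr 2
        exact Fin.ext (congrArg (fun n => n - 1) hv).symm
  rw [hpr]
  have h2 := Matrix.det_submatrix_equiv_self (pairIndex (m + 1)) (Y.map ((↑) : ℝ → ℂ))
  refine h2.trans ?_
  rw [← hY]
  exact (RingHom.map_det Complex.ofRealHom Y).symm

/-- The determinant of the Gram matrix of the projections of `e₁, …, e_m` to the orthogonal
complement of `v = e₀ + ∑ ζ_j e_j`, scaled by `1 / r` with `r = ‖v‖²`, and, for `ζ₀ = 0`,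
bordered by the row and the column of index `0` of the unit matrix. -/
lemma det_gram (ζ : Fin (m + 1) → ℂ) {r : ℂ} (hr : r ≠ 0)
    (hrζ : r = 1 + ∑ j, star (ζ j) * ζ j) (G : Matrix (Fin (m + 1)) (Fin (m + 1)) ℂ)
    (hG : ∀ l n, G l n = (if l = 0 then 1 else r⁻¹) *
      ((if l = n then 1 else 0) - star (ζ l) * ζ n / r)) :
    G.det = (r ^ (m + 1))⁻¹ := by
  -- a diagonal matrix times a perturbation of the identity by a matrix of rank one
  have h1 : G = Matrix.diagonal (fun l : Fin (m + 1) => if l = 0 then 1 else r⁻¹) *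
      (1 + Matrix.replicateCol Unit (fun l => -(star (ζ l) / r)) * Matrix.replicateRow Unit ζ) := by
    ext l n
    rw [Matrix.diagonal_mul, hG, Matrix.add_apply, Matrix.one_apply, Matrix.mul_apply]
    simp
    ring_nf
  rw [h1, Matrix.det_mul, Matrix.det_diagonal, Matrix.det_one_add_replicateCol_mul_replicateRow,
    Fin.prod_univ_succ]
  have h2 : (fun l => -(star (ζ l) / r)) = fun l => -(r⁻¹) * star (ζ l) := by
    funext l; ring
  have h3 : ζ ⬝ᵥ (fun l => -(star (ζ l) / r)) = -(r⁻¹) * (r - 1) := by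
    rw [h2, dotProduct, hrζ, add_sub_cancel_left, Finset.mul_sum]
    refine Finset.sum_congr rfl fun i _ => ?_
    ring
  rw [h3]
  simp [Fin.succ_ne_zero]
  field_simp
  ring

end CoordinateForms

/-! ### The Maurer-Cartan form in an adapted frame -/

section MaurerCartan

variable {E : Type*} [NormedAddCommGroup E] [InnerProductSpace ℂ E]

lemma lineMul_mul_lineMul {v : E} (hv : v ≠ 0) (a b : ℂ) :
    lineMul a v * lineMul b v = lineMul (a + b + a * b) v := by
  have hr : inner ℂ v v ≠ 0 := inner_self_ne_zero.2 hv
  refine ContinuousLinearMap.ext fun x => ?_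
  change lineMul a v (lineMul b v x) = _
  rw [lineMul_apply, lineMul_apply, lineMul_apply, inner_add_right, inner_smul_right, add_assoc,
    ← add_smul]
  congr 2
  field_simp
  ring

lemma lineMul_zero (v : E) : lineMul 0 v = 1 := by simp [lineMul]

/-- The hypothesis says that `1 + a` has modulus one. -/
lemma lineMul_mul_star {v : E} (hv : v ≠ 0) {a : ℂ} (ha : a + star a + a * star a = 0) :
    lineMul a v * lineMul (star a) v = 1 := by
  rw [lineMul_mul_lineMul hv, ha, lineMul_zero]

lemma lineMul_star_mul {v : E} (hv : v ≠ 0) {a : ℂ} (ha : a + star a + a * star a = 0) :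
    lineMul (star a) v * lineMul a v = 1 := by
  rw [lineMul_mul_lineMul hv, ← lineMul_zero v, ← ha]
  congr 1
  ring

/-- The component of `d` orthogonal to `v`. -/
def perp (v d : E) : E := d - (inner ℂ v d / inner ℂ v v) • v

lemma inner_perp {v : E} (hv : v ≠ 0) (d : E) : inner ℂ v (perp v d) = 0 := by
  have hr : inner ℂ v v ≠ 0 := inner_self_ne_zero.2 hv
  rw [perp, inner_sub_right, inner_smul_right, div_mul_cancel₀ _ hr, sub_self]

lemma perp_inner {v : E} (hv : v ≠ 0) (d : E) : inner ℂ (perp v d) v = 0 := by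
  rw [← inner_conj_symm, inner_perp hv, map_zero]

lemma inner_perp_perp {v : E} (hv : v ≠ 0) (d e : E) :
    inner ℂ (perp v d) (perp v e) = inner ℂ (perp v d) e := by
  conv_lhs => rw [perp.eq_1 v e, inner_sub_right, inner_smul_right, perp_inner hv, mul_zero,
    sub_zero]

variable {m : ℕ}

/-- The linear map `ℂ^{m+1} → E` given by the frame `v, e₁ - proj_v e₁, …, e_m - proj_v e_m`, whose
vectors after the first are orthogonal to `v`. -/
def frame (e : Fin (m + 1) → E) (v : E) : (Fin (m + 1) → ℂ) →ₗ[ℂ] E :=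
  Fintype.linearCombination ℂ (Fin.cons v fun j => perp v (e j.succ))

lemma frame_apply (e : Fin (m + 1) → E) (v : E) (c : Fin (m + 1) → ℂ) :
    frame e v c = c 0 • v + ∑ j : Fin m, c j.succ • perp v (e j.succ) := by
  rw [frame, Fintype.linearCombination_apply, Fin.sum_univ_succ]
  simp

/-- The components in the frame `frame e v` of the Maurer-Cartan form `g⁻¹dg` at
`g = lineMul a v`, on a tangent vector with angular component `θ'` and horizontal component
`d = ∑ z_j e_j`. -/
def mcForm (v : E) (a : ℂ) (θ' : ℂ) (z : Fin (m + 1) → ℂ) (d : E) :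
    E →ₗ[ℂ] (Fin (m + 1) → ℂ) :=
  LinearMap.pi fun j => if j = 0 then
      (Complex.I * θ' / inner ℂ v v) • (innerSL ℂ v : E →ₗ[ℂ] ℂ) -
        (star a / inner ℂ v v) • (innerSL ℂ (perp v d) : E →ₗ[ℂ] ℂ)
    else (a * z j / inner ℂ v v) • (innerSL ℂ v : E →ₗ[ℂ] ℂ)

lemma mcForm_zero (v : E) (a θ' : ℂ) (z : Fin (m + 1) → ℂ) (d x : E) :
    mcForm v a θ' z d x 0 = Complex.I * θ' / inner ℂ v v * inner ℂ v x -
      star a / inner ℂ v v * inner ℂ (perp v d) x := by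
  simp [mcForm]

lemma mcForm_of_ne (v : E) (a θ' : ℂ) (z : Fin (m + 1) → ℂ) (d x : E) {j : Fin (m + 1)}
    (hj : j ≠ 0) : mcForm v a θ' z d x j = a * z j / inner ℂ v v * inner ℂ v x := by
  simp [mcForm, hj]

lemma coordZ_zero (y : Fin (2 * (m + 1) - 1) → ℝ) : coordZ y 0 = 0 := by simp [coordZ]

/-- The Maurer-Cartan form in the coordinates `chart e`. It factors through the frame, and its
components outside the first are multiples of `⟨v, ·⟩`. -/
lemma lineMul_star_mul_fderiv_chart {e : Fin (m + 1) → E} (he : LinearIndependent ℂ e)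
    (y η : Fin (2 * (m + 1) - 1) → ℝ) {v d : E} (hv : chartVec e y = v) (hd : chartDir e η = d)
    {l : ℂ} (hl : Complex.exp (coordθ y * Complex.I) = l)
    (ha : (l - 1) + star (l - 1) + (l - 1) * star (l - 1) = 0) :
    ((lineMul (star (l - 1)) v * fderiv ℝ (chart e) y η : E →L[ℂ] E) : E →ₗ[ℂ] E) =
      frame e v ∘ₗ mcForm v (l - 1) (coordθ η) (coordZ η) d := by
  have hv0 : v ≠ 0 := hv ▸ chartVec_ne_zero he y
  have hr : inner ℂ v v ≠ 0 := inner_self_ne_zero.2 hv0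
  refine LinearMap.ext fun x => ?_
  change lineMul (star (l - 1)) v (fderiv ℝ (chart e) y η x) = frame e v (mcForm v _ _ _ d x)
  have hperp : ∑ j : Fin m, (coordZ η j.succ) • perp v (e j.succ) = perp v d := by
    have h1 : d = ∑ j : Fin m, coordZ η j.succ • e j.succ := by
      rw [← hd, chartDir_apply, Fin.sum_univ_succ, coordZ_zero, zero_smul, zero_add]
    have h2 : inner ℂ v d = ∑ j : Fin m, coordZ η j.succ * inner ℂ v (e j.succ) := by
      rw [h1, inner_sum]
      simp [inner_smul_right]
    simp only [perp, smul_sub, Finset.sum_sub_distrib, ← h1, smul_smul]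
    rw [← Finset.sum_smul, h2, Finset.sum_div]
    simp only [mul_div_assoc]
  have hsum : frame e v (mcForm v (l - 1) (coordθ η) (coordZ η) d x) =
      (Complex.I * coordθ η / inner ℂ v v * inner ℂ v x -
        star (l - 1) / inner ℂ v v * inner ℂ (perp v d) x) • v +
      ((l - 1) / inner ℂ v v * inner ℂ v x) • perp v d := by
    rw [frame_apply, mcForm_zero, ← hperp, Finset.smul_sum]
    congr 1
    refine Finset.sum_congr rfl fun j _ => ?_
    rw [mcForm_of_ne _ _ _ _ _ _ (Fin.succ_ne_zero j), smul_smul]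
    congr 1
    ring
  rw [hsum, fderiv_chart he y η hv hd hl]
  simp only [add_apply, smul_apply, outer_apply, lineMul_apply]
  have hpx : inner ℂ (perp v d) x = inner ℂ d x - inner ℂ d v / inner ℂ v v * inner ℂ v x := by
    rw [perp, inner_sub_left, inner_smul_left, map_div₀, inner_conj_symm, inner_conj_symm]
  rw [hpx, perp]
  simp only [inner_add_right, inner_smul_right, smul_add, smul_sub, smul_smul]
  set A := l - 1 with hA
  have hl' : l = A + 1 := by rw [hA]; ring
  rw [hl']
  set B := star A with hB
  set R := inner ℂ v v
  set vd := inner ℂ v d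
  set dv := inner ℂ d v
  set vx := inner ℂ v x
  set dx := inner ℂ d x
  have key : (Complex.I * (A + 1) * coordθ η * R - A * (vd + dv)) / R ^ 2 * vx + A / R * dx +
      B / R * ((Complex.I * (A + 1) * coordθ η * R - A * (vd + dv)) / R ^ 2 * (vx * R) +
        A / R * (dx * R + vx * vd)) =
      Complex.I * coordθ η / R * vx - B / R * (dx - dv / R * vx) - A / R * vx * (vd / R) := by
    field_simp
    linear_combination (Complex.I * coordθ η * R * vx - dv * vx + dx * R) * ha
  linear_combination (norm := module) key • v

lemma inner_chartDir {e : Fin (m + 1) → E} (he : Orthonormal ℂ e)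
    (η : Fin (2 * (m + 1) - 1) → ℝ) (j : Fin (m + 1)) :
    inner ℂ (e j) (chartDir e η) = coordZ η j := by
  rw [chartDir_apply]
  exact he.inner_right_fintype _ j

lemma inner_chartVec {e : Fin (m + 1) → E} (he : Orthonormal ℂ e)
    (y : Fin (2 * (m + 1) - 1) → ℝ) (j : Fin (m + 1)) :
    inner ℂ (e j) (chartVec e y) = if j = 0 then 1 else coordZ y j := by
  rw [chartVec, inner_add_right, inner_chartDir he,
    orthonormal_iff_ite.1 he]
  split_ifs with h
  · rw [h, coordZ_zero, add_zero]
  · rw [zero_add]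

lemma chartDir_inner_chartVec {e : Fin (m + 1) → E} (he : Orthonormal ℂ e)
    (y η : Fin (2 * (m + 1) - 1) → ℝ) :
    inner ℂ (chartDir e η) (chartVec e y) = ∑ n, star (coordZ η n) * coordZ y n := by
  rw [chartDir_apply, sum_inner]
  refine Finset.sum_congr rfl fun n _ => ?_
  rw [inner_smul_left, inner_chartVec he]
  split_ifs with h
  · rw [h, coordZ_zero, coordZ_zero]; simp
  · rfl

lemma inner_chartVec_self {e : Fin (m + 1) → E} (he : Orthonormal ℂ e)
    (y : Fin (2 * (m + 1) - 1) → ℝ) :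
    inner ℂ (chartVec e y) (chartVec e y) = 1 + ∑ n, star (coordZ y n) * coordZ y n := by
  rw [← chartDir_inner_chartVec he]
  conv_lhs => rw [chartVec, inner_add_left]
  change inner ℂ (e 0) (chartVec e y) + inner ℂ (chartDir e y) (chartVec e y) = _
  rw [inner_chartVec he, if_pos rfl]


/-- The entry in position `(0, l)` of the matrix of the Maurer-Cartan form, up to the factor
`-star a`. -/
def mcRow (e : Fin (m + 1) → E) (v d : E) (l : Fin (m + 1)) : ℂ :=
  inner ℂ (perp v d) (e l) / inner ℂ v v

/-- The matrix of the Maurer-Cartan form in the adapted frame: only its first row and its first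
column are different from zero. -/
lemma toMatrix_mcForm (e : Fin (m + 1) → E) {v : E} (hv : v ≠ 0) (a θ' : ℂ)
    (z : Fin (m + 1) → ℂ) (d : E) (i j : Fin (m + 1)) :
    LinearMap.toMatrix' (mcForm v a θ' z d ∘ₗ frame e v) i j =
      if i = 0 then (if j = 0 then Complex.I * θ' else -(star a) * mcRow e v d j)
      else (if j = 0 then a * z i else 0) := by
  have hr : inner ℂ v v ≠ 0 := inner_self_ne_zero.2 hv
  rw [LinearMap.toMatrix'_apply, LinearMap.comp_apply]
  have hf : frame e v (Pi.single j 1) = if j = 0 then v else perp v (e j) := by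
    rw [frame, Fintype.linearCombination_apply_single, one_smul]
    induction j using Fin.cases with
    | zero => simp
    | succ j => simp
  rw [show frame e v (Pi.single j 1) = _ from hf]
  by_cases hi : i = 0
  · rw [if_pos hi, hi, mcForm_zero]
    by_cases hj : j = 0
    · rw [if_pos hj, if_pos hj, perp_inner hv]
      field_simp
      simp
    · rw [if_neg hj, if_neg hj, inner_perp hv, inner_perp_perp hv, mcRow]
      ring
  · rw [if_neg hi, mcForm_of_ne _ _ _ _ _ _ hi]
    by_cases hj : j = 0
    · rw [if_pos hj, if_pos hj]
      field_simp
    · rw [if_neg hj, if_neg hj, inner_perp hv, mul_zero]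

end MaurerCartan

/-! ### The odd Chern form in coordinates -/

section CoordinateExpression

variable {E : Type*} [NormedAddCommGroup E] [InnerProductSpace ℂ E]
variable {m : ℕ}

/-- The signed sum defining the Chern form, for the curvature `dt ∧ ω + s ω ∧ ω` of a matrix of
one-forms `ω` of the shape found in `toMatrix_mcForm`. In the notation of `sum_sign_polarization`
the curvature has `α₀ = dt + i s θ` and `β₀ = (i s θ - dt) / s`, so that `α₀ ∧ β₀ / 2 = i dt ∧ θ`,
while `α_j` and `β_j` are multiples of `z_j` and `g_j`. -/
lemma sum_sign_polarization_curvature {s : ℂ} (hs : s ≠ 0) (a : ℂ)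
    (τ θ : Fin (m + 1) × Fin 2 → ℂ) (z g : Fin (m + 1) → Fin (m + 1) × Fin 2 → ℂ)
    (hz : ∀ j, z j (0, 0) = 0) (hg : ∀ j, g j (0, 0) = 0)
    (M : Fin (m + 1) × Fin 2 → Matrix (Fin (m + 1)) (Fin (m + 1)) ℂ)
    (hM : ∀ q i j, M q i j =
      if i = 0 then (if j = 0 then Complex.I * θ q else -(star a) * g j q)
      else (if j = 0 then a * z i q else 0))
    (N : Fin (m + 1) × Fin 2 → Fin (m + 1) × Fin 2 → Matrix (Fin (m + 1)) (Fin (m + 1)) ℂ)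
    (hN : ∀ q q', N q q' = τ q • M q' - τ q' • M q + s • (M q * M q' - M q' * M q)) :
    ∑ σ : Equiv.Perm (Fin (m + 1) × Fin 2), ((Equiv.Perm.sign σ : ℤ) : ℂ) *
      (((m + 1).factorial : ℂ)⁻¹ * ∑ τ : Equiv.Perm (Fin (m + 1)),
        ∑ π : Equiv.Perm (Fin (m + 1)), ((Equiv.Perm.sign π : ℤ) : ℂ) *
          ∏ j, N (σ (τ j, 0)) (σ (τ j, 1)) (π j) j) =
      2 ^ (m + 1) * (m.factorial * (2 * m + 1)) * Complex.I * (-(s * (a * star a))) ^ m *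
        (pairRows (fun j => if j = 0 then τ else z j) (fun j => if j = 0 then θ else g j)).det := by
  set α : Fin (m + 1) → Fin (m + 1) × Fin 2 → ℂ := fun j q =>
    if j = 0 then τ q + Complex.I * s * θ q else s * a * z j q with hα
  set β : Fin (m + 1) → Fin (m + 1) × Fin 2 → ℂ := fun j q =>
    if j = 0 then (Complex.I * s * θ q - τ q) / s else -(star a) * g j q with hβ
  have hMM : ∀ q q' i j, (M q * M q') i j =
      M q i 0 * M q' 0 j + ∑ c : Fin m, M q i c.succ * M q' c.succ j := by
    intro q q' i j
    rw [Matrix.mul_apply, Fin.sum_univ_succ]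
  rw [sum_sign_polarization α β
    (fun q q' => s * ∑ c : Fin m, (-(star a) * g c.succ q) * (a * z c.succ q')) N]
  · rw [det_pairRows_of_blocks (fun j => if j = 0 then !![1, Complex.I * s; -s⁻¹, Complex.I]
      else !![s * a, 0; 0, -(star a)])
      (α := fun j => if j = 0 then τ else z j) (β := fun j => if j = 0 then θ else g j)]
    · rw [Fin.prod_univ_succ]
      simp only [Fin.succ_ne_zero, if_true, if_false, Matrix.det_fin_two_of, Finset.prod_const,
        Finset.card_univ, Fintype.card_fin]
      have h1 : (1 : ℂ) * Complex.I - Complex.I * s * -s⁻¹ = 2 * Complex.I := by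
        field_simp
        ring
      have h2 : s * a * -(star a) - 0 * 0 = -(s * (a * star a)) := by ring
      rw [h1, h2]
      ring
    · intro i q
      by_cases hi : i = 0
      · simp [hα, hi]
      · simp [hα, hi]
    · intro i q
      by_cases hi : i = 0
      · simp only [hβ, hi, if_true]
        simp
        field_simp
        ring
      · simp [hβ, hi]
  · intro j hj
    simp [hα, hj, hz]
  · intro j hj
    simp [hβ, hj, hg]
  · intro q
    simp [hz, hg]
  · intro q q'
    rw [hN]
    simp only [Matrix.add_apply, Matrix.sub_apply, Matrix.smul_apply, hMM, smul_eq_mul, hM,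
      Fin.succ_ne_zero, if_true, if_false, hα, hβ]
    generalize ∑ c : Fin m, -(star a) * g c.succ q * (a * z c.succ q') = S₁
    generalize ∑ c : Fin m, -(star a) * g c.succ q' * (a * z c.succ q) = S₂
    field_simp
    ring
  · intro i j hij q q'
    rw [hN]
    simp only [Matrix.add_apply, Matrix.sub_apply, Matrix.smul_apply, hMM, smul_eq_mul, hM,
      Fin.succ_ne_zero, if_true, if_false, hα, hβ]
    by_cases hi : i = 0
    · have hj : j ≠ 0 := fun hj => hij ⟨hi, hj⟩
      simp only [hi, hj, if_true, if_false, mul_zero, Finset.sum_const_zero]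
      ring
    · by_cases hj : j = 0
      · simp only [hi, hj, if_true, if_false, zero_mul, Finset.sum_const_zero]
        field_simp
        ring
      · simp only [hi, hj, if_false, mul_zero, Finset.sum_const_zero]
        ring

/-- The determinant of the forms `dt, dθ, dz_j, g_j` on `∂/∂t, X₀, X₁, …`, where `g_j` is the entry
`mcRow` of the Maurer-Cartan form. The `g_j` are linear combinations of the `dz̄_j`, whose
coefficients form the Gram matrix of `det_gram`, and `dz_j ∧ dz̄_j = -2i dx_j ∧ dy_j`. -/
lemma det_pairRows_chart {e : Fin (m + 1) → E} (he : Orthonormal ℂ e)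
    (y : Fin (2 * (m + 1) - 1) → ℝ) (X : Fin (2 * (m + 1) - 1) → Fin (2 * (m + 1) - 1) → ℝ) :
    (pairRows (fun j => if j = 0 then fun q => (colT m q : ℂ) else fun q => coordZ (colX X q) j)
      (fun j => if j = 0 then fun q => (coordθ (colX X q) : ℂ) else
        fun q => mcRow e (chartVec e y) (chartDir e (colX X q)) j)).det =
    (inner ℂ (chartVec e y) (chartVec e y) ^ (m + 1))⁻¹ * (-2 * Complex.I) ^ m *
      ((Matrix.of X).det : ℂ) := by
  set v := chartVec e y with hv
  set r := inner ℂ v v with hr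
  set ζ := coordZ y with hζ
  have hv0 : v ≠ 0 := chartVec_ne_zero he.linearIndependent y
  have hr0 : r ≠ 0 := inner_self_ne_zero.2 hv0
  have hrζ : r = 1 + ∑ j, star (ζ j) * ζ j := inner_chartVec_self he y
  have hζ0 : ζ 0 = 0 := coordZ_zero y
  let G : Matrix (Fin (m + 1)) (Fin (m + 1)) ℂ := Matrix.of fun l n =>
    (if l = 0 then 1 else r⁻¹) * ((if l = n then 1 else 0) - star (ζ l) * ζ n / r)
  rw [det_pairRows_of_right G (β := fun j => if j = 0 then fun q => (coordθ (colX X q) : ℂ) else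
    fun q => star (coordZ (colX X q) j)), det_gram ζ hr0 hrζ G fun _ _ => rfl,
    det_pairRows_of_blocks (fun j => if j = 0 then 1 else !![1, Complex.I; 1, -Complex.I])
      (α := fun j => if j = 0 then fun q => (colT m q : ℂ) else
        fun q => (colX X q ⟨2 * j - 1, by omega⟩ : ℂ))
      (β := fun j q => (colX X q ⟨2 * j, by omega⟩ : ℂ)), det_pairRows_coord X]
  · rw [Fin.prod_univ_succ]
    simp only [Fin.succ_ne_zero, if_true, if_false, Matrix.det_fin_two_of, Finset.prod_const,
        Finset.card_univ, Fintype.card_fin, Matrix.det_one]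
    rw [show (1 : ℂ) * -Complex.I - Complex.I * 1 = -2 * Complex.I by ring]
    ring
  · intro q; simp
  · intro j hj q
    simp [hj]
  · intro j q; rfl
  · intro i q
    by_cases hi : i = 0
    · simp [hi]
    · have hi' : (i : ℕ) ≠ 0 := fun h => hi (Fin.ext h)
      simp [hi, coordZ]
      ring
  · intro i q
    by_cases hi : i = 0
    · subst hi
      simp [coordθ]
    · have hi' : (i : ℕ) ≠ 0 := fun h => hi (Fin.ext h)
      simp [hi, coordZ]
      ring
  · intro l q
    set d := chartDir e (colX X q) with hd
    rw [Fin.sum_univ_succ]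
    simp only [G, Matrix.of_apply, Fin.succ_ne_zero, if_true, if_false, hζ0]
    by_cases hl : l = 0
    · simp only [hl, if_true, hζ0, star_zero, zero_mul, zero_div, sub_zero]
      simp [(Fin.succ_ne_zero _).symm]
    · simp only [hl, if_false]
      have h1 : inner ℂ (perp v d) (e l) =
          star (coordZ (colX X q) l) - (inner ℂ d v / r) * star (ζ l) := by
        rw [perp, inner_sub_left, inner_smul_left, map_div₀, inner_conj_symm, inner_conj_symm,
          ← inner_conj_symm d (e l), ← inner_conj_symm v (e l), inner_chartDir he,
          inner_chartVec he, if_neg hl]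
        rfl
      have h2 : inner ℂ d v = ∑ n : Fin m, star (coordZ (colX X q) n.succ) * ζ n.succ := by
        rw [hd, hv, chartDir_inner_chartVec he, Fin.sum_univ_succ, coordZ_zero]
        simp [hζ]
      rw [mcRow, h1, h2]
      have h3 : ∑ n : Fin m, r⁻¹ * ((if l = n.succ then 1 else 0) - star (ζ l) * ζ n.succ / r) *
          star (coordZ (colX X q) n.succ) =
          r⁻¹ * (star (coordZ (colX X q) l) -
            (∑ n : Fin m, star (coordZ (colX X q) n.succ) * ζ n.succ) / r * star (ζ l)) := by
        obtain ⟨l', rfl⟩ := Fin.exists_succ_eq.2 hl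
        rw [Finset.sum_div, Finset.sum_mul, mul_sub, Finset.mul_sum]
        have : r⁻¹ * star (coordZ (colX X q) l'.succ) = ∑ n : Fin m,
            r⁻¹ * (if l'.succ = n.succ then 1 else 0) * star (coordZ (colX X q) n.succ) := by
          simp
        rw [this, ← Finset.sum_sub_distrib]
        refine Finset.sum_congr rfl fun n _ => ?_
        ring
      rw [h3]
      ring

variable [FiniteDimensional ℂ E]

lemma exp_sub_one_relation (θ : ℝ) :
    (Complex.exp (θ * Complex.I) - 1) + star (Complex.exp (θ * Complex.I) - 1) +
      (Complex.exp (θ * Complex.I) - 1) * star (Complex.exp (θ * Complex.I) - 1) = 0 := by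
  have h : Complex.exp (θ * Complex.I) * star (Complex.exp (θ * Complex.I)) = 1 := by
    have := Complex.mul_conj (Complex.exp (θ * Complex.I))
    rw [Complex.normSq_eq_norm_sq, Complex.norm_exp_ofReal_mul_I] at this
    simpa using this
  rw [star_sub, star_one]
  linear_combination h

/-- The Chern form of the path of connections in the coordinates `chart e`, contracted with
`∂/∂t`. -/
lemma chernForm_chart {e : Fin (m + 1) → E} (he : Orthonormal ℂ e)
    (y : Fin (2 * (m + 1) - 1) → ℝ) (X : Fin (2 * (m + 1) - 1) → Fin (2 * (m + 1) - 1) → ℝ)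
    {t : ℝ} (ht : t ^ 2 - t ≠ 0) {a : ℂ} (ha : Complex.exp (coordθ y * Complex.I) - 1 = a) :
    chernForm (m + 1) (pathConnection (E := E)) (t, chart e y)
      (fun j => if _h : (j : ℕ) = 0 then (1, 0) else
        (0, fderiv ℝ (chart e) y (X ⟨j - 1, by omega⟩))) =
    (Complex.I / (2 * Real.pi)) ^ (m + 1) * (m.factorial * (2 * m + 1)) * Complex.I *
      (2 * Complex.I * (a * star a)) ^ m * (inner ℂ (chartVec e y) (chartVec e y) ^ (m + 1))⁻¹ *
      ((Matrix.of X).det : ℂ) * ((t : ℂ) ^ 2 - t) ^ m := by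
  set v := chartVec e y with hv
  have hv0 : v ≠ 0 := chartVec_ne_zero he.linearIndependent y
  have har : a + star a + a * star a = 0 := ha ▸ exp_sub_one_relation _
  have hk : m + 1 ≤ finrank ℂ E := by
    simpa using he.linearIndependent.fintype_card_le_finrank
  let g : (E →L[ℂ] E)ˣ := ⟨lineMul a v, lineMul (star a) v, lineMul_mul_star hv0 har,
    lineMul_star_mul hv0 har⟩
  have hg : chart e y = (g : E →L[ℂ] E) := by rw [chart, ha]
  have hginv : Ring.inverse (g : E →L[ℂ] E) = lineMul (star a) v := Ring.inverse_unit g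
  have ha' : Complex.exp (coordθ y * Complex.I) = a + 1 := by rw [← ha]; ring
  -- the components of the Maurer-Cartan form on the `q`-th vector
  let f : Fin (m + 1) × Fin 2 → E →ₗ[ℂ] (Fin (m + 1) → ℂ) := fun q =>
    mcForm v a (coordθ (colX X q)) (coordZ (colX X q)) (chartDir e (colX X q))
  have hf : ∀ q, ((Ring.inverse (g : E →L[ℂ] E) * fderiv ℝ (chart e) y (colX X q) :
      E →L[ℂ] E) : E →ₗ[ℂ] E) = frame e v ∘ₗ f q := by
    intro q
    have := lineMul_star_mul_fderiv_chart he.linearIndependent y (colX X q) hv.symm rfl ha'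
      (by rw [add_sub_cancel_right]; exact har)
    rw [add_sub_cancel_right] at this
    rw [hginv]
    exact this
  have hvec : ∀ q : Fin (m + 1) × Fin 2,
      (if h : (pairIndex (m + 1) q : ℕ) = 0 then ((1 : ℝ), (0 : E →L[ℂ] E)) else
        (0, fderiv ℝ (chart e) y (X ⟨(pairIndex (m + 1) q : ℕ) - 1, by omega⟩))) =
      (colT m q, fderiv ℝ (chart e) y (colX X q)) := by
    intro q
    by_cases h : (pairIndex (m + 1) q : ℕ) = 0
    · rw [dif_pos h, colX, dif_pos h, map_zero, colT, if_pos ((pairIndex_eq_zero_iff q).1 h)]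
    · rw [dif_neg h, colX, dif_neg h, colT, if_neg fun h' => h ((pairIndex_eq_zero_iff q).2 h')]
  let F : Fin (m + 1) × Fin 2 → Fin (m + 1) × Fin 2 → E →ₗ[ℂ] (Fin (m + 1) → ℂ) := fun q q' =>
    (colT m q : ℂ) • f q' - (colT m q' : ℂ) • f q +
      ((t : ℂ) ^ 2 - t) • (f q ∘ₗ frame e v ∘ₗ f q' - f q' ∘ₗ frame e v ∘ₗ f q)
  have hcurv : ∀ q q', ((curvature (pathConnection (E := E)) (t, (g : E →L[ℂ] E))
      (colT m q, fderiv ℝ (chart e) y (colX X q))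
      (colT m q', fderiv ℝ (chart e) y (colX X q')) : E →L[ℂ] E) : E →ₗ[ℂ] E) =
      frame e v ∘ₗ F q q' := by
    intro q q'
    rw [curvature_pathConnection]
    refine LinearMap.ext fun x => ?_
    have h1 : ∀ q x, (Ring.inverse (g : E →L[ℂ] E) * fderiv ℝ (chart e) y (colX X q) :
        E →L[ℂ] E) x = frame e v (f q x) := fun q x => LinearMap.congr_fun (hf q) x
    simp only [ContinuousLinearMap.coe_coe, add_apply, sub_apply, smul_apply,
      LinearMap.comp_apply, F, LinearMap.add_apply, LinearMap.sub_apply, LinearMap.smul_apply,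
      map_add, map_sub, map_smul, h1]
    have hmul : ∀ q q', ((Ring.inverse (g : E →L[ℂ] E) * fderiv ℝ (chart e) y (colX X q)) *
        (Ring.inverse (g : E →L[ℂ] E) * fderiv ℝ (chart e) y (colX X q')) : E →L[ℂ] E) x =
        frame e v (f q (frame e v (f q' x))) := by
      intro q q'
      rw [← h1 q' x, ← h1 q]
      rfl
    rw [hmul, hmul]
    simp only [← Complex.coe_smul]
    push_cast
    rfl
  have hM := sum_sign_polarization_curvature (m := m) (s := (t : ℂ) ^ 2 - t)
    (by exact_mod_cast ht) a (fun q => (colT m q : ℂ)) (fun q => (coordθ (colX X q) : ℂ))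
    (fun j q => coordZ (colX X q) j) (fun j q => mcRow e v (chartDir e (colX X q)) j)
    (fun j => by rw [colX_zero]; simp [coordZ])
    (fun j => by rw [colX_zero]; simp [mcRow, perp])
    (fun q => LinearMap.toMatrix' (f q ∘ₗ frame e v))
    (fun q i j => toMatrix_mcForm e hv0 a _ _ _ i j)
    (fun q q' => LinearMap.toMatrix' (F q q' ∘ₗ frame e v))
    (fun q q' => by
      simp only [F, LinearMap.add_comp, LinearMap.sub_comp, LinearMap.smul_comp, map_add, map_sub,
        map_smul, ← LinearMap.toMatrix'_mul]
      rfl)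
  rw [det_pairRows_chart he y X] at hM
  rw [chernForm, hg, ← Equiv.sum_comp (pairIndex (m + 1)).permCongr]
  have hterm : ∀ σ : Equiv.Perm (Fin (m + 1) × Fin 2),
      ((Equiv.Perm.sign ((pairIndex (m + 1)).permCongr σ) : ℤ) : ℂ) *
      polarization (elemSymm (m + 1)) (fun i : Fin (m + 1) =>
        curvature (pathConnection (E := E)) (t, (g : E →L[ℂ] E))
        ((fun j : Fin (2 * (m + 1)) => if h : (j : ℕ) = 0 then ((1 : ℝ), (0 : E →L[ℂ] E)) else
          (0, fderiv ℝ (chart e) y (X ⟨j - 1, by omega⟩)))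
          ((pairIndex (m + 1)).permCongr σ ⟨2 * i, by omega⟩))
        ((fun j : Fin (2 * (m + 1)) => if h : (j : ℕ) = 0 then ((1 : ℝ), (0 : E →L[ℂ] E)) else
          (0, fderiv ℝ (chart e) y (X ⟨j - 1, by omega⟩)))
          ((pairIndex (m + 1)).permCongr σ ⟨2 * i + 1, by omega⟩))) =
      ((Equiv.Perm.sign σ : ℤ) : ℂ) * (((m + 1).factorial : ℂ)⁻¹ *
        ∑ τ : Equiv.Perm (Fin (m + 1)), ∑ π : Equiv.Perm (Fin (m + 1)),
          ((Equiv.Perm.sign π : ℤ) : ℂ) *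
          ∏ j, LinearMap.toMatrix' (F (σ (τ j, 0)) (σ (τ j, 1)) ∘ₗ frame e v) (π j) j) := by
    intro σ
    rw [Equiv.Perm.sign_permCongr]
    congr 1
    refine polarization_elemSymm_of_factor hk (frame e v)
      (fun i => F (σ (i, 0)) (σ (i, 1))) _ fun i => ?_
    have h0 : (⟨2 * i, by omega⟩ : Fin (2 * (m + 1))) = pairIndex (m + 1) (i, 0) :=
      Fin.ext (by rw [pairIndex_val]; simp)
    have h1 : (⟨2 * i + 1, by omega⟩ : Fin (2 * (m + 1))) = pairIndex (m + 1) (i, 1) :=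
      Fin.ext (by rw [pairIndex_val]; simp)
    rw [h0, h1, Equiv.permCongr_apply, Equiv.permCongr_apply, Equiv.symm_apply_apply,
      Equiv.symm_apply_apply]
    rw [← hcurv, ← hvec, ← hvec]
  rw [Finset.sum_congr rfl fun σ _ => hterm σ, hM]
  have h2 : (2 : ℂ) ^ (m + 1) ≠ 0 := pow_ne_zero _ two_ne_zero
  have h3 : (-(((t : ℂ) ^ 2 - t) * (a * star a))) ^ m * (-2 * Complex.I) ^ m =
      (2 * Complex.I * (a * star a)) ^ m * ((t : ℂ) ^ 2 - t) ^ m := by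
    rw [← mul_pow, ← mul_pow]
    congr 1
    ring
  rw [← hv]
  generalize (inner ℂ v v ^ (m + 1))⁻¹ = ρ
  generalize ((Matrix.of X).det : ℂ) = Δ
  generalize (-2 * Complex.I) ^ m = A at *
  generalize (-(((t : ℂ) ^ 2 - t) * (a * star a))) ^ m = B at *
  generalize (2 * Complex.I * (a * star a)) ^ m = C at *
  generalize ((t : ℂ) ^ 2 - t) ^ m = D at *
  generalize (2 : ℂ) ^ (m + 1) = P at *
  field_simp
  linear_combination ((m.factorial : ℂ) * (2 * m + 1) * Δ * ρ) * h3

/-- Up to sign, the beta integral `B(m + 1, m + 1)`. -/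
lemma integral_sub_sq_pow (m : ℕ) :
    ∫ t in (0 : ℝ)..1, ((t : ℂ) ^ 2 - t) ^ m =
      (-1) ^ m * ((m.factorial : ℂ) ^ 2 / ((2 * m + 1).factorial : ℂ)) := by
  have h1 : ∫ t in (0 : ℝ)..1, ((t : ℂ) ^ 2 - t) ^ m =
      (-1) ^ m * Complex.betaIntegral (m + 1) (m + 1) := by
    rw [Complex.betaIntegral, ← intervalIntegral.integral_const_mul]
    refine intervalIntegral.integral_congr fun t _ => ?_
    simp only [add_sub_cancel_right, Complex.cpow_natCast]
    rw [← mul_pow, ← mul_pow]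
    congr 1
    ring
  have h2 := Complex.Gamma_mul_Gamma_eq_betaIntegral (s := (m : ℂ) + 1) (t := (m : ℂ) + 1)
    (by simp; positivity) (by simp; positivity)
  rw [Complex.Gamma_nat_eq_factorial, show (m : ℂ) + 1 + (m + 1) = ((2 * m + 1 : ℕ) : ℂ) + 1 by
    push_cast; ring, Complex.Gamma_nat_eq_factorial] at h2
  have h3 : ((2 * m + 1).factorial : ℂ) ≠ 0 := by exact_mod_cast (Nat.factorial_pos _).ne'
  rw [h1]
  congr 1
  rw [eq_div_iff h3, sq, h2]
  ring

/-- The odd Chern form in the coordinates `chart e`. It is the product of a form in the angle and of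
a multiple of the Fubini-Study volume form. -/
lemma Tc_chart {e : Fin (m + 1) → E} (he : Orthonormal ℂ e)
    (y : Fin (2 * (m + 1) - 1) → ℝ) (X : Fin (2 * (m + 1) - 1) → Fin (2 * (m + 1) - 1) → ℝ) :
    Tc (m + 1) (chart e y) (fun j => fderiv ℝ (chart e) y (X j)) =
      -(((m.factorial : ℝ) ^ 3 / (2 * Real.pi ^ (m + 1) * (2 * m).factorial) *
        ((2 - 2 * Real.cos (coordθ y)) ^ m / (1 + ∑ j, ‖coordZ y j‖ ^ 2) ^ (m + 1)) *
        (Matrix.of X).det : ℝ) : ℂ) := by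
  have h0 : ∀ᵐ t : ℝ, t ∈ Set.uIoc (0 : ℝ) 1 →
      chernForm (m + 1) (pathConnection (E := E)) (t, chart e y)
      (fun j => if h : (j : ℕ) = 0 then (1, 0) else
        (0, fderiv ℝ (chart e) y (X ⟨j - 1, by omega⟩))) =
      (Complex.I / (2 * Real.pi)) ^ (m + 1) * (m.factorial * (2 * m + 1)) * Complex.I *
      (2 * Complex.I * ((Complex.exp (coordθ y * Complex.I) - 1) *
        star (Complex.exp (coordθ y * Complex.I) - 1))) ^ m *
      (inner ℂ (chartVec e y) (chartVec e y) ^ (m + 1))⁻¹ *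
      ((Matrix.of X).det : ℂ) * ((t : ℂ) ^ 2 - t) ^ m := by
    have : ∀ᵐ t : ℝ, t ≠ 1 := by simp [ae_iff, measure_singleton]
    filter_upwards [this] with t ht1 ht
    rw [Set.uIoc_of_le zero_le_one] at ht
    refine chernForm_chart he y X (t := t) ?_ rfl
    have h1 : t ≠ 0 := ht.1.ne'
    rw [show t ^ 2 - t = t * (t - 1) by ring]
    exact mul_ne_zero h1 (sub_ne_zero.2 ht1)
  rw [Tc, intervalIntegral.integral_congr_ae h0, intervalIntegral.integral_const_mul,
    integral_sub_sq_pow, inner_chartVec_self he]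
  have h1 : ∀ j, star (coordZ y j) * coordZ y j = ((‖coordZ y j‖ ^ 2 : ℝ) : ℂ) := by
    intro j
    rw [mul_comm]
    have := Complex.mul_conj (coordZ y j)
    rw [Complex.normSq_eq_norm_sq] at this
    exact this
  have h2 : (Complex.exp (coordθ y * Complex.I) - 1) *
      star (Complex.exp (coordθ y * Complex.I) - 1) =
      ((2 - 2 * Real.cos (coordθ y) : ℝ) : ℂ) := by
    have h3 := exp_sub_one_relation (coordθ y)
    have h4 : (Complex.exp (coordθ y * Complex.I) - 1) +
        star (Complex.exp (coordθ y * Complex.I) - 1) =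
          ((2 * Real.cos (coordθ y) - 2 : ℝ) : ℂ) := by
      have := Complex.add_conj (Complex.exp (coordθ y * Complex.I) - 1)
      rw [Complex.sub_re, Complex.exp_ofReal_mul_I_re, Complex.one_re] at this
      refine this.trans ?_
      push_cast
      ring
    rw [h4] at h3
    push_cast at h3 ⊢
    linear_combination h3
  simp only [h1]
  rw [h2]
  have hpos : (0 : ℝ) < 1 + ∑ j, ‖coordZ y j‖ ^ 2 := by positivity
  generalize hR : 1 + ∑ j, ‖coordZ y j‖ ^ 2 = R at *
  rw [show (1 : ℂ) + ∑ j, ((‖coordZ y j‖ ^ 2 : ℝ) : ℂ) = (R : ℂ) by rw [← hR]; push_cast; rfl]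
  generalize (2 - 2 * Real.cos (coordθ y) : ℝ) = A
  generalize (Matrix.of X).det = Δ
  have hRC : (R : ℂ) ≠ 0 := by exact_mod_cast hpos.ne'
  have hπ : (Real.pi : ℂ) ≠ 0 := by exact_mod_cast Real.pi_ne_zero
  have hfac : ((2 * m + 1).factorial : ℂ) = (2 * m + 1) * ((2 * m).factorial : ℂ) := by
    rw [Nat.factorial_succ]; push_cast; ring
  have hf0 : ((2 * m).factorial : ℂ) ≠ 0 := by exact_mod_cast (Nat.factorial_pos _).ne'
  have hm0 : (2 * (m : ℂ) + 1) ≠ 0 := by exact_mod_cast (Nat.succ_ne_zero (2 * m))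
  rw [hfac]
  have hI : Complex.I ^ (m + 1) * Complex.I * (2 * Complex.I * A) ^ m * (-1) ^ m =
      -(2 ^ m * (A : ℂ) ^ m) := by
    have : Complex.I ^ (m + 1) * Complex.I * (2 * Complex.I * A) ^ m * (-1) ^ m =
      (Complex.I * Complex.I) * ((Complex.I * (2 * Complex.I * A) * (-1)) ^ m) := by
      rw [mul_pow (Complex.I * (2 * Complex.I * A)), mul_pow Complex.I]
      ring
    rw [this, Complex.I_mul_I, show Complex.I * (2 * Complex.I * A) * (-1) = 2 * (A : ℂ) by
      linear_combination (-2 * (A : ℂ)) * Complex.I_sq, mul_pow]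
    ring
  push_cast
  rw [div_pow]
  have h2π : (2 * (Real.pi : ℂ)) ^ (m + 1) = 2 * 2 ^ m * Real.pi ^ (m + 1) := by
    rw [mul_pow, pow_succ]; ring
  rw [h2π]
  have hRm : (R : ℂ) ^ (m + 1) ≠ 0 := pow_ne_zero _ hRC
  have hπm : (Real.pi : ℂ) ^ (m + 1) ≠ 0 := pow_ne_zero _ hπ
  generalize (R : ℂ) ^ (m + 1) = R' at *
  generalize (Real.pi : ℂ) ^ (m + 1) = π' at *
  generalize Complex.I ^ (m + 1) = I' at *
  generalize (2 * Complex.I * (A : ℂ)) ^ m = A' at *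
  have h2m : (2 : ℂ) ^ m ≠ 0 := pow_ne_zero _ two_ne_zero
  generalize (2 : ℂ) ^ m = P at *
  generalize (-1 : ℂ) ^ m = S at *
  generalize (A : ℂ) ^ m = A'' at *
  field_simp
  linear_combination ((m.factorial : ℂ) ^ 3 * (Δ : ℂ)) * hI

end CoordinateExpression

/-! ### The integral of the form over the affine chart -/

section FubiniStudy

/-- An antiderivative of the radial density of `(1 + ‖x‖²)^{-(m + 2)}` on `ℝ^{2m + 2}`. -/
lemma hasDerivAt_sq_div_one_add_sq_pow (m : ℕ) (r : ℝ) :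
    HasDerivAt (fun r : ℝ => (r ^ 2 / (1 + r ^ 2)) ^ (m + 1) / (2 * (m + 1)))
      (r ^ (2 * m + 1) * ((1 + r ^ 2) ^ (m + 2))⁻¹) r := by
  have hp : (1 + r ^ 2) ≠ 0 := by positivity
  have h := (((hasDerivAt_pow 2 r).div ((hasDerivAt_pow 2 r).const_add 1) hp).pow (m + 1)).div_const
    (2 * ((m : ℝ) + 1))
  refine h.congr_deriv ?_
  have hm : (m : ℝ) + 1 ≠ 0 := by positivity
  simp only [Nat.add_sub_cancel, Pi.div_apply]
  push_cast
  rw [div_pow]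
  field_simp
  ring

lemma tendsto_sq_div_one_add_sq_pow (m : ℕ) :
    Tendsto (fun r : ℝ => (r ^ 2 / (1 + r ^ 2)) ^ (m + 1) / (2 * (m + 1))) atTop
      (𝓝 (1 / (2 * ((m : ℝ) + 1)))) := by
  have h1 : Tendsto (fun r : ℝ => r ^ 2 / (1 + r ^ 2)) atTop (𝓝 1) := by
    have h2 : Tendsto (fun r : ℝ => 1 - (1 + r ^ 2)⁻¹) atTop (𝓝 (1 - 0)) := by
      refine tendsto_const_nhds.sub (tendsto_inv_atTop_zero.comp ?_)
      exact tendsto_atTop_add_const_left _ _ (tendsto_pow_atTop two_ne_zero)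
    rw [sub_zero] at h2
    refine h2.congr fun r => ?_
    have : (1 + r ^ 2) ≠ 0 := by positivity
    field_simp
    ring
  have h3 := (h1.pow (m + 1)).div_const (2 * ((m : ℝ) + 1))
  rwa [one_pow] at h3

/-- The Fubini-Study volume of an affine chart of the projective space of dimension `m`. -/
lemma integrable_and_integral_inv_one_add_norm_sq_pow (m : ℕ) :
    Integrable (fun x : EuclideanSpace ℝ (Fin (2 * m)) => ((1 + ‖x‖ ^ 2) ^ (m + 1))⁻¹) ∧
    ∫ x : EuclideanSpace ℝ (Fin (2 * m)), ((1 + ‖x‖ ^ 2) ^ (m + 1))⁻¹ =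
      Real.pi ^ m / m.factorial := by
  rcases m with _ | m
  -- for `m = 0` the integral is over a point
  · have : IsEmpty (Fin (2 * 0)) := by simpa using Fin.isEmpty
    have hv : (volume : Measure (EuclideanSpace ℝ (Fin (2 * 0)))) = Measure.dirac 0 := by
      rw [← (PiLp.volume_preserving_toLp (Fin (2 * 0))).map_eq, Measure.volume_pi_eq_dirac 0,
        Measure.map_dirac' (PiLp.volume_preserving_toLp (Fin (2 * 0))).measurable]
      rfl
    rw [hv]
    exact ⟨integrable_dirac (by simp), by simp⟩
  · have hdim : finrank ℝ (EuclideanSpace ℝ (Fin (2 * (m + 1)))) = 2 * (m + 1) := by simp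
    have : Nontrivial (EuclideanSpace ℝ (Fin (2 * (m + 1)))) :=
      Module.nontrivial_of_finrank_pos (R := ℝ) (by rw [hdim]; omega)
    have hd : ∀ x ∈ Set.Ici (0 : ℝ), HasDerivAt _ (x ^ (2 * m + 1) * ((1 + x ^ 2) ^ (m + 2))⁻¹) x :=
      fun x _ => hasDerivAt_sq_div_one_add_sq_pow m x
    have hn : ∀ x ∈ Set.Ioi (0 : ℝ), 0 ≤ x ^ (2 * m + 1) * ((1 + x ^ 2) ^ (m + 2))⁻¹ := by
      intro x hx
      have : (0 : ℝ) < x := hx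
      positivity
    have hexp : finrank ℝ (EuclideanSpace ℝ (Fin (2 * (m + 1)))) - 1 = 2 * m + 1 := by
      rw [hdim]; omega
    constructor
    · refine (integrable_fun_norm_addHaar volume
        (f := fun r : ℝ => ((1 + r ^ 2) ^ (m + 1 + 1))⁻¹)).2 ?_
      rw [hexp]
      exact integrableOn_Ioi_deriv_of_nonneg' hd hn (tendsto_sq_div_one_add_sq_pow m)
    · rw [integral_fun_norm_addHaar volume (fun r : ℝ => ((1 + r ^ 2) ^ (m + 1 + 1))⁻¹), hexp]
      simp only [smul_eq_mul]
      rw [integral_Ioi_of_hasDerivAt_of_nonneg' hd hn (tendsto_sq_div_one_add_sq_pow m),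
        Measure.real, InnerProductSpace.volume_ball_of_dim_even hdim, hdim]
      have hfac : (0 : ℝ) < (m + 1).factorial := by exact_mod_cast Nat.factorial_pos _
      have hpi := Real.pi_pos
      rw [ENNReal.ofReal_one, one_pow, one_mul, ENNReal.toReal_ofReal (by positivity)]
      have hm : (m : ℝ) + 1 ≠ 0 := by positivity
      simp only [nsmul_eq_mul]
      push_cast
      field_simp
      simp

end FubiniStudy

section Angle

lemma prod_odd_div_even (n : ℕ) : ∏ i ∈ Finset.range n, ((2 * (i : ℝ) + 1) / (2 * i + 2)) =
    (2 * n).factorial / (4 ^ n * (n.factorial : ℝ) ^ 2) := by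
  induction n with
  | zero => simp
  | succ n ih =>
    rw [Finset.prod_range_succ, ih, show 2 * (n + 1) = 2 * n + 1 + 1 by ring, Nat.factorial_succ,
      Nat.factorial_succ, Nat.factorial_succ]
    have h1 : ((n.factorial : ℕ) : ℝ) ≠ 0 := by exact_mod_cast (Nat.factorial_pos _).ne'
    push_cast
    field_simp
    ring

/-- With `2 - 2 cos θ = 4 sin² (θ / 2)` this is Wallis' integral. -/
lemma integral_two_sub_two_cos_pow (m : ℕ) :
    ∫ θ in Set.Ioo (-(2 * Real.pi)) 0, (2 - 2 * Real.cos θ) ^ m =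
      2 * Real.pi * (2 * m).factorial / (m.factorial : ℝ) ^ 2 := by
  have hpi := Real.pi_pos
  rw [← integral_Ioc_eq_integral_Ioo, ← intervalIntegral.integral_of_le (by linarith)]
  have h1 : ∀ θ : ℝ, (2 - 2 * Real.cos θ) ^ m = 4 ^ m * Real.sin (-θ / 2) ^ (2 * m) := by
    intro θ
    rw [pow_mul, ← mul_pow, neg_div, Real.sin_neg, neg_sq, Real.sin_sq_eq_half_sub,
      show 2 * (θ / 2) = θ by ring]
    congr 1
    ring
  simp only [h1]
  rw [intervalIntegral.integral_const_mul]
  have h2 : ∫ θ in -(2 * Real.pi)..0, Real.sin (-θ / 2) ^ (2 * m) =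
      2 * ∫ x in (0 : ℝ)..Real.pi, Real.sin x ^ (2 * m) := by
    have h3 := intervalIntegral.integral_comp_mul_left (a := -(2 * Real.pi)) (b := 0)
      (fun x => Real.sin x ^ (2 * m)) (c := -(1 / 2)) (by norm_num)
    have h4 : ∀ θ : ℝ, -θ / 2 = -(1 / 2) * θ := fun θ => by ring
    simp only [h4]
    rw [h3, show -(1 / 2) * -(2 * Real.pi) = Real.pi by ring, mul_zero,
      intervalIntegral.integral_symm]
    norm_num
  rw [h2, integral_sin_pow_even, prod_odd_div_even]
  field_simp

end Angle

section Chart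

variable {m : ℕ}

/-- `∑ |z_j|² = ∑ (x_j² + y_j²)`, with the coordinates `x₁, y₁, …` numbered from `1` to `2m`. -/
lemma sum_norm_coordZ_sq (y : Fin (2 * (m + 1) - 1) → ℝ) :
    ∑ j, ‖coordZ y j‖ ^ 2 = ∑ i : Fin (2 * m), y ⟨i + 1, by omega⟩ ^ 2 := by
  rw [Fin.sum_univ_succ, coordZ_zero]
  rw [← (pairIndex m).sum_comp, Fintype.sum_prod_type]
  simp only [norm_zero, ne_eq, OfNat.ofNat_ne_zero, not_false_eq_true, zero_pow, zero_add]
  refine Finset.sum_congr rfl fun j _ => ?_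
  rw [Fin.sum_univ_two, coordZ, dif_neg (by simp), ← Complex.normSq_eq_norm_sq,
    Complex.normSq_add_mul_I]
  congr 3
  · congr 1; simp [pairIndex_val]; omega
  · congr 1; simp [pairIndex_val]; omega

/-- The part of the coordinate space on which the angle runs through `(-2π, 0)`. -/
def chartDomain (m : ℕ) : Set (Fin (2 * (m + 1) - 1) → ℝ) :=
  {y | coordθ y ∈ Set.Ioo (-(2 * Real.pi)) 0}

/-- The density of `Tc (m + 1)` in the coordinates of `oppChart`; in those of `chart` it has the
opposite sign. -/
def chartDensity (y : Fin (2 * (m + 1) - 1) → ℝ) : ℝ :=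
  (m.factorial : ℝ) ^ 3 / (2 * Real.pi ^ (m + 1) * (2 * m).factorial) *
    ((2 - 2 * Real.cos (coordθ y)) ^ m / (1 + ∑ j, ‖coordZ y j‖ ^ 2) ^ (m + 1))

/-- The density is a product of functions of the angle and of the remaining coordinates. -/
lemma integrableOn_and_integral_chartDensity (m : ℕ) :
    IntegrableOn (chartDensity (m := m)) (chartDomain m) ∧
    ∫ y in chartDomain m, chartDensity y = 1 := by
  set K : ℝ := (m.factorial : ℝ) ^ 3 / (2 * Real.pi ^ (m + 1) * (2 * m).factorial) with hK
  have hmp := volume_preserving_piFinSuccAbove (fun _ : Fin (2 * m + 1) => ℝ) 0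
  have hme := (MeasurableEquiv.piFinSuccAbove (fun _ : Fin (2 * m + 1) => ℝ) 0).measurableEmbedding
  have hmp' := PiLp.volume_preserving_toLp (Fin (2 * m))
  have hme' := (MeasurableEquiv.toLp 2 (Fin (2 * m) → ℝ)).measurableEmbedding
  obtain ⟨hi, hv⟩ := integrable_and_integral_inv_one_add_norm_sq_pow m
  let g : (Fin (2 * m) → ℝ) → ℝ := fun x => ((1 + ∑ i, x i ^ 2) ^ (m + 1))⁻¹
  have hg : g = (fun x : EuclideanSpace ℝ (Fin (2 * m)) => ((1 + ‖x‖ ^ 2) ^ (m + 1))⁻¹) ∘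
      WithLp.toLp 2 := by
    funext x
    simp only [g, Function.comp_apply, EuclideanSpace.norm_sq_eq, Real.norm_eq_abs, sq_abs]
  have hgi : Integrable g := by
    rw [hg]; exact (hmp'.integrable_comp_emb hme').2 hi
  have hgv : ∫ x, g x = Real.pi ^ m / m.factorial := by
    rw [hg, ← hv]; exact hmp'.integral_comp hme'
      (fun x : EuclideanSpace ℝ (Fin (2 * m)) => ((1 + ‖x‖ ^ 2) ^ (m + 1))⁻¹)
  let f : ℝ → ℝ := fun θ => K * (2 - 2 * Real.cos θ) ^ m
  have hfi : IntegrableOn f (Set.Ioo (-(2 * Real.pi)) 0) := by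
    have : Continuous f := by fun_prop
    exact (this.integrableOn_Icc).mono_set Set.Ioo_subset_Icc_self
  have hfun : (chartDensity (m := m)) = (fun p : ℝ × (Fin (2 * m) → ℝ) => f p.1 * g p.2) ∘
      (MeasurableEquiv.piFinSuccAbove (fun _ : Fin (2 * m + 1) => ℝ) 0) := by
    funext y
    rw [chartDensity, sum_norm_coordZ_sq, ← hK, div_eq_mul_inv ((2 - 2 * Real.cos (coordθ y)) ^ m),
      ← mul_assoc]
    rfl
  have hset : chartDomain m = (MeasurableEquiv.piFinSuccAbove (fun _ : Fin (2 * m + 1) => ℝ) 0) ⁻¹'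
      (Set.Ioo (-(2 * Real.pi)) 0 ×ˢ Set.univ) := by
    ext y
    simp [chartDomain, coordθ]
  have hint : IntegrableOn (fun p : ℝ × (Fin (2 * m) → ℝ) => f p.1 * g p.2)
      (Set.Ioo (-(2 * Real.pi)) 0 ×ˢ Set.univ) (volume.prod volume) := by
    rw [IntegrableOn, ← Measure.prod_restrict, Measure.restrict_univ]
    exact Integrable.mul_prod hfi hgi
  constructor
  · rw [hfun, hset]
    exact (hmp.integrableOn_comp_preimage hme).2 hint
  · rw [hfun, hset]
    refine (hmp.setIntegral_preimage_emb hme (fun p : ℝ × (Fin (2 * m) → ℝ) => f p.1 * g p.2)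
      (Set.Ioo (-(2 * Real.pi)) 0 ×ˢ Set.univ)).trans ?_
    refine (setIntegral_prod_mul f g _ _).trans ?_
    rw [Measure.restrict_univ, hgv, integral_const_mul, integral_two_sub_two_cos_pow, hK]
    have h1 : ((m.factorial : ℕ) : ℝ) ≠ 0 := by exact_mod_cast (Nat.factorial_pos _).ne'
    have h2 : (((2 * m).factorial : ℕ) : ℝ) ≠ 0 := by exact_mod_cast (Nat.factorial_pos _).ne'
    have hpi := Real.pi_pos
    field_simp
    ring

end Chart

/-! ### The parametrization by the affine chart and its inverse -/

section Coordinates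

variable {m : ℕ}

/-- The isomorphism `(θ, z) ↦ (θ, x₁, y₁, …, x_m, y_m)`, where `z_j = x_j + i y_j`. -/
def coordEquiv (m : ℕ) : (ℝ × (Fin m → ℂ)) ≃ₗ[ℝ] (Fin (2 * (m + 1) - 1) → ℝ) where
  toFun p i := if h : (i : ℕ) = 0 then p.1 else
    if (i : ℕ) % 2 = 1 then (p.2 ⟨(i - 1) / 2, by omega⟩).re
    else (p.2 ⟨(i - 1) / 2, by omega⟩).im
  map_add' p q := by
    funext i
    simp only [Pi.add_apply]
    split_ifs <;> simp
  map_smul' c p := by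
    funext i
    simp only [Pi.smul_apply]
    split_ifs <;> simp
  invFun y := (coordθ y, fun j => coordZ y j.succ)
  left_inv p := by
    refine Prod.ext (by simp [coordθ]) (funext fun j => ?_)
    have h1 : (2 * ((j : ℕ) + 1) - 1 - 1) / 2 = j := by omega
    have h2 : (2 * ((j : ℕ) + 1) - 1) / 2 = j := by omega
    have h3 : (2 * ((j : ℕ) + 1) - 1) % 2 = 1 := by omega
    have h4 : ¬ (2 * ((j : ℕ) + 1) - 1 = 0) := by omega
    simp [coordZ, h1, h2, h3, h4, Complex.re_add_im]
  right_inv y := by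
    funext i
    beta_reduce
    split_ifs with h1 h2
    · simp only [coordθ]
      congr 1
      exact Fin.ext h1.symm
    · simp [coordZ]
      congr 1
      ext
      simp; omega
    · simp [coordZ]
      congr 1
      ext
      simp; omega

@[simp]
lemma coordθ_coordEquiv (p : ℝ × (Fin m → ℂ)) : coordθ (coordEquiv m p) = p.1 := by
  have h : (coordEquiv m).symm (coordEquiv m p) = p := (coordEquiv m).symm_apply_apply p
  have h' := congrArg Prod.fst h
  exact h'

@[simp]
lemma coordZ_coordEquiv_succ (p : ℝ × (Fin m → ℂ)) (j : Fin m) :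
    coordZ (coordEquiv m p) j.succ = p.2 j := by
  have h : (coordEquiv m).symm (coordEquiv m p) = p := (coordEquiv m).symm_apply_apply p
  exact congrFun (congrArg Prod.snd h) j

lemma coordEquiv_coord (y : Fin (2 * (m + 1) - 1) → ℝ) :
    coordEquiv m (coordθ y, fun j => coordZ y j.succ) = y :=
  (coordEquiv m).apply_symm_apply y

/-- The reflection that changes the sign of the angular coordinate. -/
def reflect (m : ℕ) : (Fin (2 * (m + 1) - 1) → ℝ) →L[ℝ] (Fin (2 * (m + 1) - 1) → ℝ) :=
  LinearMap.toContinuousLinearMap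
    (Matrix.toLin' (Matrix.diagonal fun i => if (i : ℕ) = 0 then -1 else 1))

lemma reflect_apply (y : Fin (2 * (m + 1) - 1) → ℝ) (i : Fin (2 * (m + 1) - 1)) :
    reflect m y i = (if (i : ℕ) = 0 then -1 else 1) * y i := by
  simp [reflect, Matrix.mulVec_diagonal]

@[simp]
lemma coordθ_reflect (y : Fin (2 * (m + 1) - 1) → ℝ) : coordθ (reflect m y) = -coordθ y := by
  simp [coordθ, reflect_apply]

@[simp]
lemma coordZ_reflect (y : Fin (2 * (m + 1) - 1) → ℝ) (j : Fin (m + 1)) :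
    coordZ (reflect m y) j = coordZ y j := by
  unfold coordZ
  split_ifs with h
  · rfl
  · simp only [reflect_apply]
    rw [if_neg (by omega), if_neg (by omega), one_mul, one_mul]

@[simp]
lemma reflect_reflect (y : Fin (2 * (m + 1) - 1) → ℝ) : reflect m (reflect m y) = y := by
  rw [← coordEquiv_coord (reflect m (reflect m y))]
  simp [coordEquiv_coord]

lemma reflect_comp_reflect : (reflect m).comp (reflect m) = ContinuousLinearMap.id ℝ _ :=
  ContinuousLinearMap.ext fun y => reflect_reflect y

lemma det_reflect : (reflect m).det = -1 := by
  have h0 : (0 : ℕ) < 2 * (m + 1) - 1 := by omega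
  rw [ContinuousLinearMap.det, reflect, LinearMap.coe_toContinuousLinearMap, LinearMap.det_toLin',
    Matrix.det_diagonal, Finset.prod_eq_single (⟨0, h0⟩ : Fin (2 * (m + 1) - 1))]
  · simp
  · intro i _ hi
    rw [if_neg fun h => hi (Fin.ext h)]
  · simp

lemma det_comp {d : ℕ} (S T : (Fin d → ℝ) →L[ℝ] (Fin d → ℝ)) :
    (S.comp T).det = S.det * T.det := by
  simp only [ContinuousLinearMap.det, ContinuousLinearMap.toLinearMap_comp]
  exact LinearMap.det_comp _ _

lemma det_of_apply_single {d : ℕ} (T : (Fin d → ℝ) →L[ℝ] (Fin d → ℝ)) :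
    (Matrix.of fun i => T (Pi.single i 1)).det = T.det := by
  rw [ContinuousLinearMap.det, ← LinearMap.det_toMatrix', ← Matrix.det_transpose]
  rfl

end Coordinates

section OppositeChart

variable {E : Type*} [NormedAddCommGroup E] [InnerProductSpace ℂ E] {m : ℕ}

/-- `chart e` with the orientation reversed: the angular coordinate runs clockwise. -/
def oppChart (e : Fin (m + 1) → E) (y : Fin (2 * (m + 1) - 1) → ℝ) : E →L[ℂ] E :=
  chart e (reflect m y)

lemma contDiff_oppChart {e : Fin (m + 1) → E} (he : LinearIndependent ℂ e) :
    ContDiff ℝ ∞ (oppChart e) :=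
  (contDiff_chart he).comp (reflect m).contDiff

lemma fderiv_oppChart {e : Fin (m + 1) → E} (he : LinearIndependent ℂ e)
    (y : Fin (2 * (m + 1) - 1) → ℝ) :
    fderiv ℝ (oppChart e) y = (fderiv ℝ (chart e) (reflect m y)).comp (reflect m) := by
  have h1 : DifferentiableAt ℝ (chart e) (reflect m y) :=
    (contDiff_chart he).differentiable (by simp) _
  exact (h1.hasFDerivAt.comp y (reflect m).hasFDerivAt).fderiv

section Form

variable [FiniteDimensional ℂ E]

/-- The odd Chern form on the images of the coordinate vectors under a linear map `T`. The sign of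
`Tc_chart` cancels with the determinant of the reflection. -/
lemma Tc_oppChart {e : Fin (m + 1) → E} (he : Orthonormal ℂ e)
    (y : Fin (2 * (m + 1) - 1) → ℝ)
    (T : (Fin (2 * (m + 1) - 1) → ℝ) →L[ℝ] (Fin (2 * (m + 1) - 1) → ℝ)) :
    Tc (m + 1) (oppChart e y) (fun i => fderiv ℝ (oppChart e) y (T (Pi.single i 1))) =
      (T.det : ℂ) * (chartDensity y : ℂ) := by
  have h1 : (fun i => fderiv ℝ (oppChart e) y (T (Pi.single i 1))) = fun i =>
      fderiv ℝ (chart e) (reflect m y) (((reflect m).comp T) (Pi.single i 1)) := by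
    rw [fderiv_oppChart he.linearIndependent]
    rfl
  rw [h1, oppChart, Tc_chart he, det_of_apply_single, det_comp, det_reflect]
  simp only [coordθ_reflect, coordZ_reflect, Real.cos_neg, chartDensity]
  push_cast
  ring

lemma pullbackCoeff_oppChart {e : Fin (m + 1) → E} (he : Orthonormal ℂ e)
    (y : Fin (2 * (m + 1) - 1) → ℝ) :
    pullbackCoeff (Tc (m + 1)) (oppChart e) y = (chartDensity y : ℂ) := by
  have h := Tc_oppChart he y (ContinuousLinearMap.id ℝ _)
  have hd : (ContinuousLinearMap.id ℝ (Fin (2 * (m + 1) - 1) → ℝ)).det = 1 := by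
    rw [ContinuousLinearMap.det]; exact LinearMap.det_id
  rw [hd, Complex.ofReal_one, one_mul] at h
  exact h

end Form

/-- The eigenvalue `l` of `lineMul (l - 1) v`, for `v` in the span of the orthonormal family `e`:
one minus the trace of `1 - U` on that span. -/
def chartEigenvalue (e : Fin (m + 1) → E) (U : E →L[ℂ] E) : ℂ :=
  1 - ∑ j, inner ℂ (e j) ((1 - U) (e j))

/-- The inverse of `oppChart e`. The angle is read off from the logarithm of `-l`, which is smooth
away from `l = 1`, and the `z_j` are the ratios of the components of `(1 - U) e₀`, a vector on the
line. -/
def chartInv (e : Fin (m + 1) → E) (U : E →L[ℂ] E) : Fin (2 * (m + 1) - 1) → ℝ :=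
  coordEquiv m (-((Complex.log (-chartEigenvalue e U)).im + Real.pi),
    fun j => inner ℂ (e j.succ) ((1 - U) (e 0)) / inner ℂ (e 0) ((1 - U) (e 0)))

lemma one_sub_lineMul_apply (a : ℂ) (v x : E) :
    (1 - lineMul a v) x = (-(a / inner ℂ v v * inner ℂ v x)) • v := by
  rw [sub_apply, lineMul_apply, one_apply_eq_self]
  module

lemma lineMul_smul {c : ℂ} (hc : c ≠ 0) (a : ℂ) (v : E) : lineMul a (c • v) = lineMul a v := by
  by_cases hv : v = 0
  · simp [hv]
  have hv' : inner ℂ v v ≠ 0 := inner_self_ne_zero.2 hv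
  have hc' : starRingEnd ℂ c ≠ 0 := (map_ne_zero _).2 hc
  ext x
  rw [lineMul_apply, lineMul_apply, inner_smul_left, inner_smul_left, inner_smul_right, smul_smul]
  congr 2
  field_simp

lemma chartEigenvalue_chart {e : Fin (m + 1) → E} (he : Orthonormal ℂ e)
    (y : Fin (2 * (m + 1) - 1) → ℝ) :
    chartEigenvalue e (chart e y) = Complex.exp (coordθ y * Complex.I) := by
  have hv : inner ℂ (chartVec e y) (chartVec e y) ≠ 0 :=
    inner_self_ne_zero.2 (chartVec_ne_zero he.linearIndependent y)
  have h1 : ∑ j, inner ℂ (chartVec e y) (e j) * inner ℂ (e j) (chartVec e y) =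
      inner ℂ (chartVec e y) (chartVec e y) := by
    rw [inner_chartVec_self he, Fin.sum_univ_succ, Fin.sum_univ_succ, coordZ_zero]
    congr 1
    · rw [← inner_conj_symm, inner_chartVec he]; simp
    · rw [star_zero, zero_mul, zero_add]
      refine Finset.sum_congr rfl fun j _ => ?_
      rw [← inner_conj_symm, inner_chartVec he, if_neg (Fin.succ_ne_zero j)]
      rfl
  have h2 : ∑ j, inner ℂ (e j) ((1 - chart e y) (e j)) =
      -((Complex.exp (coordθ y * Complex.I) - 1) / inner ℂ (chartVec e y) (chartVec e y)) *
        ∑ j, inner ℂ (chartVec e y) (e j) * inner ℂ (e j) (chartVec e y) := by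
    rw [Finset.mul_sum]
    refine Finset.sum_congr rfl fun j _ => ?_
    rw [chart, one_sub_lineMul_apply, inner_smul_right]
    ring
  rw [chartEigenvalue, h2, h1, neg_mul, div_mul_cancel₀ _ hv]
  ring

lemma neg_exp_mul_I (θ : ℝ) :
    -Complex.exp (θ * Complex.I) = Complex.exp (((θ - Real.pi : ℝ) : ℂ) * Complex.I) := by
  push_cast
  rw [sub_mul, Complex.exp_sub, Complex.exp_pi_mul_I]
  ring

lemma log_neg_exp {θ : ℝ} (hθ : θ ∈ Set.Ioo 0 (2 * Real.pi)) :
    (Complex.log (-Complex.exp (θ * Complex.I))).im = θ - Real.pi := by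
  rw [neg_exp_mul_I, Complex.log_im, Complex.arg_exp_mul_I, toIocMod_eq_self]
  constructor
  · linarith [hθ.1]
  · linarith [hθ.2]

lemma neg_exp_mem_slitPlane {θ : ℝ} (hθ : θ ∈ Set.Ioo 0 (2 * Real.pi)) :
    -Complex.exp (θ * Complex.I) ∈ Complex.slitPlane := by
  rw [Complex.mem_slitPlane_iff_arg, ← Complex.log_im, log_neg_exp hθ]
  refine ⟨fun h => ?_, neg_ne_zero.2 (Complex.exp_ne_zero _)⟩
  linarith [hθ.2]

lemma exp_ne_one_of_mem {θ : ℝ} (hθ : θ ∈ Set.Ioo 0 (2 * Real.pi)) :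
    Complex.exp (θ * Complex.I) ≠ 1 := by
  intro h
  have := neg_exp_mem_slitPlane hθ
  rw [h] at this
  simp [Complex.mem_slitPlane_iff] at this
  linarith

lemma exists_angle {l : ℂ} (hl : ‖l‖ = 1) (hl1 : l ≠ 1) :
    ∃ θ ∈ Set.Ioo 0 (2 * Real.pi), Complex.exp (θ * Complex.I) = l := by
  refine ⟨Complex.arg (-l) + Real.pi, ⟨by linarith [Complex.neg_pi_lt_arg (-l)], ?_⟩, ?_⟩
  · have h1 : Complex.arg (-l) ≠ Real.pi := by
      intro h
      refine hl1 ?_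
      have := Complex.norm_mul_exp_arg_mul_I (-l)
      rw [h, norm_neg, hl, Complex.exp_pi_mul_I] at this
      simpa using this.symm
    have h2 := lt_of_le_of_ne (Complex.arg_le_pi (-l)) h1
    linarith
  · have := Complex.norm_mul_exp_arg_mul_I (-l)
    rw [norm_neg, hl, Complex.ofReal_one, one_mul] at this
    push_cast
    rw [add_mul, Complex.exp_add, this, Complex.exp_pi_mul_I]
    ring

lemma neg_coordθ_mem {y : Fin (2 * (m + 1) - 1) → ℝ} (hy : y ∈ chartDomain m) :
    -coordθ y ∈ Set.Ioo 0 (2 * Real.pi) :=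
  ⟨by linarith [hy.2], by linarith [hy.1]⟩

lemma inner_one_sub_chart {e : Fin (m + 1) → E} (he : Orthonormal ℂ e)
    (y : Fin (2 * (m + 1) - 1) → ℝ) (j : Fin (m + 1)) :
    inner ℂ (e j) ((1 - chart e y) (e 0)) =
      (1 - Complex.exp (coordθ y * Complex.I)) / inner ℂ (chartVec e y) (chartVec e y) *
        if j = 0 then 1 else coordZ y j := by
  rw [chart, one_sub_lineMul_apply, inner_smul_right, inner_chartVec he,
    ← inner_conj_symm (chartVec e y) (e 0), inner_chartVec he, if_pos rfl, map_one]
  ring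

lemma chartEigenvalue_oppChart {e : Fin (m + 1) → E} (he : Orthonormal ℂ e)
    (y : Fin (2 * (m + 1) - 1) → ℝ) :
    chartEigenvalue e (oppChart e y) = Complex.exp ((-coordθ y : ℝ) * Complex.I) := by
  rw [oppChart, chartEigenvalue_chart he, coordθ_reflect]

lemma inner_one_sub_oppChart_ne_zero {e : Fin (m + 1) → E} (he : Orthonormal ℂ e)
    {y : Fin (2 * (m + 1) - 1) → ℝ} (hy : y ∈ chartDomain m) :
    inner ℂ (e 0) ((1 - oppChart e y) (e 0)) ≠ 0 := by
  rw [oppChart, inner_one_sub_chart he, if_pos rfl, mul_one, coordθ_reflect]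
  exact div_ne_zero (sub_ne_zero.2 (exp_ne_one_of_mem (neg_coordθ_mem hy)).symm)
    (inner_self_ne_zero.2 (chartVec_ne_zero he.linearIndependent _))

lemma chartInv_oppChart {e : Fin (m + 1) → E} (he : Orthonormal ℂ e)
    {y : Fin (2 * (m + 1) - 1) → ℝ} (hy : y ∈ chartDomain m) :
    chartInv e (oppChart e y) = y := by
  have h0 := inner_one_sub_oppChart_ne_zero he hy
  rw [chartInv, chartEigenvalue_oppChart he, log_neg_exp (neg_coordθ_mem hy)]
  conv_rhs => rw [← coordEquiv_coord y]
  congr 2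
  · ring
  · funext j
    rw [div_eq_iff h0, oppChart, inner_one_sub_chart he, inner_one_sub_chart he,
      if_neg (Fin.succ_ne_zero j), if_pos rfl, coordZ_reflect]
    ring

/-- The open set on which `chartInv e` is smooth. -/
def chartTarget (e : Fin (m + 1) → E) : Set (E →L[ℂ] E) :=
  {U | inner ℂ (e 0) ((1 - U) (e 0)) ≠ 0 ∧ -chartEigenvalue e U ∈ Complex.slitPlane}

lemma oppChart_mem_chartTarget {e : Fin (m + 1) → E} (he : Orthonormal ℂ e)
    {y : Fin (2 * (m + 1) - 1) → ℝ} (hy : y ∈ chartDomain m) :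
    oppChart e y ∈ chartTarget e :=
  ⟨inner_one_sub_oppChart_ne_zero he hy, by
    rw [chartEigenvalue_oppChart he]; exact neg_exp_mem_slitPlane (neg_coordθ_mem hy)⟩

lemma differentiable_inner_one_sub (x y : E) :
    Differentiable ℝ fun U : E →L[ℂ] E => inner ℂ x ((1 - U) y) := by
  have h1 : Differentiable ℝ fun U : E →L[ℂ] E => (1 - U) y := by
    intro U
    have h2 : HasFDerivAt (fun U : E →L[ℂ] E => U y)
        ((ContinuousLinearMap.apply ℂ E y).restrictScalars ℝ) U :=
      ((ContinuousLinearMap.apply ℂ E y).restrictScalars ℝ).hasFDerivAt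
    simpa using (h2.const_sub y).differentiableAt
  exact (differentiable_const x).inner ℂ h1

lemma differentiable_chartEigenvalue (e : Fin (m + 1) → E) :
    Differentiable ℝ (chartEigenvalue e) :=
  (differentiable_const _).sub
    (Differentiable.fun_sum fun j _ => differentiable_inner_one_sub (e j) (e j))

lemma isOpen_chartTarget (e : Fin (m + 1) → E) : IsOpen (chartTarget e) :=
  (isOpen_ne.preimage (differentiable_inner_one_sub (e 0) (e 0)).continuous).inter
    (Complex.isOpen_slitPlane.preimage (differentiable_chartEigenvalue e).continuous.neg)

lemma differentiableAt_chartInv {e : Fin (m + 1) → E} {U : E →L[ℂ] E} (hU : U ∈ chartTarget e) :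
    DifferentiableAt ℝ (chartInv e) U := by
  have h1 : DifferentiableAt ℝ (fun U => Complex.log (-chartEigenvalue e U)) U := by
    have := ((Complex.differentiableAt_log hU.2).restrictScalars ℝ).comp U
      (differentiable_chartEigenvalue e U).neg
    exact this
  have h2 : DifferentiableAt ℝ (fun U => (Complex.log (-chartEigenvalue e U)).im) U :=
    Complex.imCLM.differentiableAt.comp U h1
  have h3 : DifferentiableAt ℝ (fun U : E →L[ℂ] E => fun j : Fin m =>
      inner ℂ (e j.succ) ((1 - U) (e 0)) / inner ℂ (e 0) ((1 - U) (e 0))) U :=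
    differentiableAt_pi.2 fun j =>
      (differentiable_inner_one_sub (e j.succ) (e 0) U).fun_mul
        ((differentiable_inner_one_sub (e 0) (e 0) U).fun_inv hU.1)
  have h4 := (h2.add_const Real.pi).neg.prodMk h3
  exact ((LinearMap.toContinuousLinearMap (coordEquiv m).toLinearMap).differentiableAt).comp U h4

end OppositeChart

/-! ### The closed set of complex reflections -/

section ComplexReflections

variable {E : Type*} [NormedAddCommGroup E] [InnerProductSpace ℂ E] {m : ℕ}

/-- The complex reflections `l id_ℓ ⊕ id_{ℓ^⊥}`, `|l| = 1`, for lines `ℓ` in `L`: the image of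
`φ`. -/
def complexReflections (L : Submodule ℂ E) : Set (E →L[ℂ] E) :=
  {U | ∃ l : ℂ, ∃ v : E, ‖l‖ = 1 ∧ v ∈ L ∧ ‖v‖ = 1 ∧ U = lineMul (l - 1) v}

lemma lineMul_mem_complexReflections {L : Submodule ℂ E} {l : ℂ} {v : E} (hl : ‖l‖ = 1)
    (hv : v ∈ L) (hv0 : v ≠ 0) : lineMul (l - 1) v ∈ complexReflections L := by
  have hn : ‖v‖ ≠ 0 := norm_ne_zero_iff.2 hv0
  have hc : ((‖v‖⁻¹ : ℝ) : ℂ) ≠ 0 := by exact_mod_cast inv_ne_zero hn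
  refine ⟨l, ((‖v‖⁻¹ : ℝ) : ℂ) • v, hl, L.smul_mem _ hv, ?_, (lineMul_smul hc _ _).symm⟩
  rw [norm_smul, Complex.norm_real, norm_inv, norm_norm, inv_mul_cancel₀ hn]

lemma isClosed_complexReflections [FiniteDimensional ℂ E] (L : Submodule ℂ E) :
    IsClosed (complexReflections L) := by
  have : ProperSpace E := FiniteDimensional.proper ℂ E
  have h1 : complexReflections L = (fun p : ℂ × E => 1 + (p.1 - 1) • outer p.2 p.2) ''
      (Metric.sphere 0 1 ×ˢ (Metric.sphere 0 1 ∩ (L : Set E))) := by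
    ext U
    constructor
    · rintro ⟨l, v, hl, hv, hv1, rfl⟩
      refine ⟨(l, v), ⟨by simpa using hl, by simpa using hv1, hv⟩, ?_⟩
      simp [lineMul, inner_self_eq_norm_sq_to_K, hv1]
    · rintro ⟨⟨l, v⟩, ⟨hl, hv1, hv⟩, rfl⟩
      have hv1' : ‖v‖ = 1 := by simpa using hv1
      refine ⟨l, v, by simpa using hl, hv, hv1', ?_⟩
      simp [lineMul, inner_self_eq_norm_sq_to_K, hv1']
  rw [h1]
  refine IsCompact.isClosed (IsCompact.image ?_ ?_)
  · exact (isCompact_sphere 0 1).prod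
      ((isCompact_sphere 0 1).inter_right L.closed_of_finiteDimensional)
  · have h2 : Continuous fun p : ℂ × E => outer p.2 p.2 :=
      isBoundedBilinearMap_outer.continuous.comp (continuous_snd.prodMk continuous_snd)
    fun_prop

section Chart

variable {e : Fin (m + 1) → E}

/-- Affine coordinates of the line through `v`, where `v` is in the span of `e` and has a component
along `e₀`. -/
lemma exists_chart_eq {v : E} (hv : ∑ j, inner ℂ (e j) v • e j = v)
    (h0 : inner ℂ (e 0) v ≠ 0) (θ : ℝ) :
    ∃ y, coordθ y = θ ∧ (∀ j, j ≠ 0 → coordZ y j = inner ℂ (e j) v / inner ℂ (e 0) v) ∧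
      chart e y = lineMul (Complex.exp (θ * Complex.I) - 1) v := by
  refine ⟨coordEquiv m (θ, fun j => inner ℂ (e j.succ) v / inner ℂ (e 0) v), by simp,
    fun j hj => ?_, ?_⟩
  · obtain ⟨i, rfl⟩ := Fin.exists_succ_eq.2 hj
    simp
  · have h1 : chartVec e (coordEquiv m (θ, fun j => inner ℂ (e j.succ) v / inner ℂ (e 0) v)) =
        (inner ℂ (e 0) v)⁻¹ • v := by
      have h2 : (inner ℂ (e 0) v)⁻¹ • v =
          ∑ j, ((inner ℂ (e 0) v)⁻¹ * inner ℂ (e j) v) • e j := by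
        conv_lhs => enter [2]; rw [← hv]
        rw [Finset.smul_sum]
        exact Finset.sum_congr rfl fun j _ => smul_smul _ _ _
      rw [h2, chartVec, chartDir_apply, Fin.sum_univ_succ, Fin.sum_univ_succ, coordZ_zero,
        zero_smul, zero_add, inv_mul_cancel₀ h0, one_smul]
      congr 1
      refine Finset.sum_congr rfl fun j _ => ?_
      rw [coordZ_coordEquiv_succ, ← div_eq_inv_mul]
    rw [chart, h1, lineMul_smul (inv_ne_zero h0), coordθ_coordEquiv]

/-- The image of `oppChart e` contains every reflection with `l ≠ 1` in a line which is not
orthogonal to `e₀`. -/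
lemma exists_oppChart_eq {v : E} (hv : ∑ j, inner ℂ (e j) v • e j = v)
    (h0 : inner ℂ (e 0) v ≠ 0) {l : ℂ} (hl : ‖l‖ = 1) (hl1 : l ≠ 1) :
    ∃ y ∈ chartDomain m, oppChart e y = lineMul (l - 1) v := by
  obtain ⟨θ, hθ, rfl⟩ := exists_angle hl hl1
  obtain ⟨y, hy, -, hyU⟩ := exists_chart_eq hv h0 θ
  refine ⟨reflect m y, ?_, ?_⟩
  · rw [chartDomain, Set.mem_ofPred_eq, coordθ_reflect, hy]
    exact ⟨by linarith [hθ.2], by linarith [hθ.1]⟩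
  · rw [oppChart, reflect_reflect, hyU]

lemma isOpen_chartDomain (m : ℕ) : IsOpen (chartDomain m) :=
  isOpen_Ioo.preimage (continuous_apply _)

lemma injective_fderiv_oppChart (he : Orthonormal ℂ e) {y : Fin (2 * (m + 1) - 1) → ℝ}
    (hy : y ∈ chartDomain m) : Function.Injective (fderiv ℝ (oppChart e) y) := by
  have h1 : DifferentiableAt ℝ (oppChart e) y :=
    (contDiff_oppChart he.linearIndependent).differentiable (by simp) _
  have h2 := (differentiableAt_chartInv (oppChart_mem_chartTarget he hy)).hasFDerivAt.comp y
    h1.hasFDerivAt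
  have h3 : HasFDerivAt (chartInv e ∘ oppChart e) (ContinuousLinearMap.id ℝ _) y := by
    refine (hasFDerivAt_id y).congr_of_eventuallyEq ?_
    filter_upwards [(isOpen_chartDomain m).mem_nhds hy] with y' hy'
    exact chartInv_oppChart he hy'
  have h4 := h2.unique h3
  refine Function.LeftInverse.injective (g := fderiv ℝ (chartInv e) (oppChart e y)) fun η => ?_
  exact DFunLike.congr_fun h4 η

/-- Every set between the image of the affine chart and the set of all complex reflections in `L` is
parametrized by the chart, which is a homeomorphism onto a relatively open subset. -/
lemma isLocalParam_oppChart (he : Orthonormal ℂ e) {L : Submodule ℂ E}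
    (heL : ∀ v ∈ L, ∑ j, inner ℂ (e j) v • e j = v) {S : Set (E →L[ℂ] E)}
    (hS : oppChart e '' chartDomain m ⊆ S) (hSL : S ⊆ complexReflections L) :
    IsLocalParam S (oppChart e) (chartDomain m) where
  isOpen := isOpen_chartDomain m
  smooth := (contDiff_oppChart he.linearIndependent).contDiffOn
  immersion y hy := injective_fderiv_oppChart he hy
  injOn y hy y' hy' h := by
    rw [← chartInv_oppChart he hy, h, chartInv_oppChart he hy']
  isOpen_image Ω' hΩ hΩo := by
    refine ⟨chartTarget e ∩ chartInv e ⁻¹' Ω', ContinuousOn.isOpen_inter_preimage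
      (fun U hU => (differentiableAt_chartInv hU).continuousAt.continuousWithinAt)
      (isOpen_chartTarget e) hΩo, ?_⟩
    ext U
    constructor
    · rintro ⟨y, hy, rfl⟩
      refine ⟨hS ⟨y, hΩ hy, rfl⟩, oppChart_mem_chartTarget he (hΩ hy), ?_⟩
      rw [Set.mem_preimage, chartInv_oppChart he (hΩ hy)]
      exact hy
    · rintro ⟨hUS, hU, hUΩ⟩
      obtain ⟨l, v, hl, hv, hv1, rfl⟩ := hSL hUS
      have h0 := hU.1
      rw [one_sub_lineMul_apply, inner_smul_right] at h0
      have hl1 : l ≠ 1 := by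
        rintro rfl
        simp at h0
      obtain ⟨y, hy, hyU⟩ := exists_oppChart_eq (heL v hv) (right_ne_zero_of_mul h0) hl hl1
      refine ⟨y, ?_, hyU⟩
      rw [Set.mem_preimage, ← hyU, chartInv_oppChart he hy] at hUΩ
      exact hUΩ

lemma volume_coordZ_eq_zero {j : Fin (m + 1)} (hj : j ≠ 0) :
    volume {y : Fin (2 * (m + 1) - 1) → ℝ | coordZ y j = 0} = 0 := by
  have hj' : (j : ℕ) ≠ 0 := fun h => hj (Fin.ext h)
  refine measure_mono_null (t := {y | y ⟨2 * j - 1, by omega⟩ = 0}) ?_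
    (Measure.pi_hyperplane (fun _ => volume) _ 0)
  intro y hy
  rw [Set.mem_ofPred_eq, coordZ, dif_neg hj'] at hy
  simpa using congrArg Complex.re hy

/-- The complement of the affine chart consists of the identity and of the reflections in the lines
of a hyperplane; it is covered by the images of coordinate hyperplanes under the other affine
charts. -/
lemma hausdorffMeasure_complexReflections_sdiff [FiniteDimensional ℂ E]
    (he : Orthonormal ℂ e) {L : Submodule ℂ E}
    (heL : ∀ v ∈ L, ∑ j, inner ℂ (e j) v • e j = v) :
    Measure.hausdorffMeasure ((2 * (m + 1) - 1 : ℕ) : ℝ)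
      (complexReflections L \ oppChart e '' chartDomain m) = 0 := by
  have hcover : complexReflections L \ oppChart e '' chartDomain m ⊆
      {1} ∪ ⋃ j : {j : Fin (m + 1) // j ≠ 0},
        chart (e ∘ Equiv.swap 0 j.1) '' {y | coordZ y j.1 = 0} := by
    rintro U ⟨⟨l, v, hl, hv, hv1, rfl⟩, hU⟩
    by_cases hl1 : l = 1
    · left
      simp [hl1, lineMul_zero]
    by_cases h0 : inner ℂ (e 0) v = 0
    · right
      have hex : ∃ j, inner ℂ (e j) v ≠ 0 := by
        by_contra! hall
        have := heL v hv
        simp only [hall, zero_smul, Finset.sum_const_zero] at this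
        simp [← this] at hv1
      obtain ⟨j, hj⟩ := hex
      have hj0 : j ≠ 0 := by rintro rfl; exact hj h0
      obtain ⟨θ, -, hθ⟩ := exists_angle hl hl1
      obtain ⟨y, -, hyz, hyU⟩ := exists_chart_eq (e := e ∘ Equiv.swap 0 j) (v := v)
        (by rw [← heL v hv, heL v hv]
            exact (Equiv.sum_comp (Equiv.swap 0 j) fun i => inner ℂ (e i) v • e i).trans
              (heL v hv))
        (by simpa using hj) θ
      refine Set.mem_iUnion.2 ⟨⟨j, hj0⟩, y, ?_, by rw [hyU, hθ]⟩
      rw [Set.mem_ofPred_eq, hyz j hj0]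
      simp [h0]
    · refine absurd ?_ hU
      obtain ⟨y, hy, hyU⟩ := exists_oppChart_eq (heL v hv) h0 hl hl1
      exact ⟨y, hy, hyU⟩
  refine measure_mono_null hcover (measure_union_null ?_ (measure_iUnion_null fun j => ?_))
  · have : NullSingletonClass (Measure.hausdorffMeasure ((2 * (m + 1) - 1 : ℕ) : ℝ) :
        Measure (E →L[ℂ] E)) :=
      Measure.nullSingletonClass_hausdorff _ (by exact_mod_cast (by omega : 0 < 2 * (m + 1) - 1))
    exact measure_singleton (1 : E →L[ℂ] E)
  · refine hausdorffMeasure_image_eq_zero ?_ (volume_coordZ_eq_zero j.2)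
    exact (contDiff_chart (he.linearIndependent.comp _ (Equiv.injective _))).of_le (by simp)

end Chart

end ComplexReflections

/-! ### Orientation -/

section Orientation

variable {E : Type*} [NormedAddCommGroup E] [InnerProductSpace ℂ E] {m : ℕ}

lemma lineMul_ne_one_imp {a : ℂ} {v : E} (h : lineMul a v ≠ 1) : a ≠ 0 := by
  rintro rfl
  exact h (lineMul_zero v)

lemma lineMul_apply_self {a : ℂ} {v : E} (hv : v ≠ 0) : lineMul a v v = (1 + a) • v := by
  rw [lineMul_apply, div_mul_cancel₀ _ (inner_self_ne_zero.2 hv), add_smul, one_smul]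

/-- A complex reflection different from the identity determines its eigenvalue and its line. -/
lemma eq_of_lineMul_eq {a a' : ℂ} {v v' : E} (hv : v ≠ 0) (hv' : v' ≠ 0)
    (h : lineMul a' v' = lineMul a v) (h1 : lineMul a v ≠ 1) :
    a' = a ∧ ∃ c : ℂ, c ≠ 0 ∧ v' = c • v := by
  have ha' : a' ≠ 0 := lineMul_ne_one_imp (v := v') (h ▸ h1)
  have h2 := DFunLike.congr_fun h v'
  rw [lineMul_apply_self hv', lineMul_apply, add_smul, one_smul, add_right_inj] at h2
  have h3 : v' = (a'⁻¹ * (a / inner ℂ v v * inner ℂ v v')) • v := by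
    rw [mul_smul, ← h2, smul_smul, inv_mul_cancel₀ ha', one_smul]
  have hc : a'⁻¹ * (a / inner ℂ v v * inner ℂ v v') ≠ 0 := by
    intro hc
    rw [hc, zero_smul] at h3
    exact hv' h3
  refine ⟨?_, _, hc, h3⟩
  rw [h3, lineMul_smul hc] at h
  have h4 := DFunLike.congr_fun h v
  rw [lineMul_apply_self hv, lineMul_apply_self hv] at h4
  have := smul_left_injective ℂ hv h4
  simpa using this

/-- The derivative of a chart does not change when the homogeneous vector is rescaled and the
tangent vector is rescaled and modified along the line. -/
lemma chart_deriv_rescale {v d : E} (hv : v ≠ 0) {c : ℂ} (hc : c ≠ 0) (r l s : ℂ) :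
    ((Complex.I * l * s * inner ℂ (c • v) (c • v) - (l - 1) *
        (inner ℂ (c • v) (c • d - (r * c) • v) + inner ℂ (c • d - (r * c) • v) (c • v))) /
        inner ℂ (c • v) (c • v) ^ 2) • outer (c • v) (c • v) +
      ((l - 1) / inner ℂ (c • v) (c • v)) •
        (outer (c • v) (c • d - (r * c) • v) + outer (c • d - (r * c) • v) (c • v)) =
    ((Complex.I * l * s * inner ℂ v v - (l - 1) * (inner ℂ v d + inner ℂ d v)) /
        inner ℂ v v ^ 2) • outer v v +
      ((l - 1) / inner ℂ v v) • (outer v d + outer d v) := by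
  have hv' : inner ℂ v v ≠ 0 := inner_self_ne_zero.2 hv
  have hc' : starRingEnd ℂ c ≠ 0 := (map_ne_zero _).2 hc
  have o1 : outer (c • v) (c • v) = (c * starRingEnd ℂ c) • outer v v := by
    ext x; simp only [outer_apply, smul_apply, inner_smul_left]; module
  have o2 : outer (c • v) (c • d - (r * c) • v) =
      (c * starRingEnd ℂ c) • (outer v d - starRingEnd ℂ r • outer v v) := by
    ext x
    simp only [outer_apply, smul_apply, sub_apply, inner_smul_left, inner_sub_left, map_mul]
    module
  have o3 : outer (c • d - (r * c) • v) (c • v) =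
      (c * starRingEnd ℂ c) • (outer d v - r • outer v v) := by
    ext x
    simp only [outer_apply, smul_apply, sub_apply, inner_smul_left]
    module
  rw [o1, o2, o3]
  simp only [inner_smul_left, inner_smul_right, inner_sub_left, inner_sub_right, map_mul]
  generalize outer v v = O1
  generalize outer v d = O2
  generalize outer d v = O3
  generalize (inner ℂ v v : ℂ) = N at *
  generalize (inner ℂ v d : ℂ) = p
  generalize (inner ℂ d v : ℂ) = q
  generalize starRingEnd ℂ c = c' at *
  generalize starRingEnd ℂ r = r'
  match_scalars
  · field_simp
    ring
  · field_simp
  · field_simp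

/-- The transition between the affine charts of two bases preserves the orientation, as it is the
identity in the angle and holomorphic in the remaining coordinates. -/
lemma exists_fderiv_chart_eq_comp {L : Submodule ℂ E} (b : Basis (Fin (m + 1)) ℂ L)
    {e : Fin (m + 1) → E} (he : LinearIndependent ℂ e) (heL : ∀ j, e j ∈ L)
    {y y' : Fin (2 * (m + 1) - 1) → ℝ} (h : chart (fun j => (b j : E)) y' = chart e y)
    (h1 : chart e y ≠ 1) (hinj : Function.Injective (fderiv ℝ (chart e) y)) :
    ∃ T : (Fin (2 * (m + 1) - 1) → ℝ) →L[ℝ] (Fin (2 * (m + 1) - 1) → ℝ),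
      fderiv ℝ (chart e) y = (fderiv ℝ (chart fun j => (b j : E)) y').comp T ∧ 0 < T.det := by
  have hb : LinearIndependent ℂ fun j => (b j : E) :=
    b.linearIndependent.map' L.subtype L.ker_subtype
  obtain ⟨hl, c, hc, hv'⟩ := eq_of_lineMul_eq (chartVec_ne_zero he y) (chartVec_ne_zero hb y') h h1
  have hl' : Complex.exp (coordθ y' * Complex.I) = Complex.exp (coordθ y * Complex.I) := by
    linear_combination hl
  -- `M` is the differential of the transition map of projective space, where `v' = c v`:
  -- `c (d_j - z'_j d_0)` are the affine components of the tangent vector `∑ d_j b_j`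
  let D : (Fin m → ℂ) →ₗ[ℂ] L := Fintype.linearCombination ℂ fun j => ⟨e j.succ, heL _⟩
  let M : (Fin m → ℂ) →ₗ[ℂ] (Fin m → ℂ) := LinearMap.pi fun j =>
    c • ((b.coord j.succ).comp D - coordZ y' j.succ • (b.coord 0).comp D)
  let T₀ : (Fin (2 * (m + 1) - 1) → ℝ) →ₗ[ℝ] (Fin (2 * (m + 1) - 1) → ℝ) :=
    (coordEquiv m).toLinearMap ∘ₗ
      (LinearMap.prodMap LinearMap.id (M.restrictScalars ℝ)) ∘ₗ (coordEquiv m).symm.toLinearMap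
  have hT : ∀ η, T₀ η = coordEquiv m (coordθ η, M fun j => coordZ η j.succ) := fun η => rfl
  have hdir : ∀ η, chartDir (fun j => (b j : E)) (T₀ η) = c • chartDir e η -
      ((c * b.coord 0 (D fun j => coordZ η j.succ)) * c) • chartVec e y := by
    intro η
    have hD : ((D fun j => coordZ η j.succ : L) : E) = chartDir e η := by
      rw [chartDir_apply, Fin.sum_univ_succ, coordZ_zero, zero_smul, zero_add]
      simp [D, Fintype.linearCombination_apply]
    have hD' := congrArg (fun x : L => (x : E)) (b.sum_repr (D fun j => coordZ η j.succ))
    simp only [hD, Submodule.coe_sum, Submodule.coe_smul] at hD'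
    rw [Fin.sum_univ_succ] at hD'
    have hM : chartDir (fun j => (b j : E)) (T₀ η) =
        c • ∑ j : Fin m, b.repr (D fun j => coordZ η j.succ) j.succ • (b j.succ : E) -
        (c * b.coord 0 (D fun j => coordZ η j.succ)) •
          ∑ j : Fin m, coordZ y' j.succ • (b j.succ : E) := by
      rw [chartDir_apply, Fin.sum_univ_succ, coordZ_zero, zero_smul, zero_add, hT,
        Finset.smul_sum, Finset.smul_sum, ← Finset.sum_sub_distrib]
      refine Finset.sum_congr rfl fun j _ => ?_
      rw [coordZ_coordEquiv_succ]
      simp only [M, LinearMap.pi_apply, LinearMap.smul_apply, LinearMap.sub_apply,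
        LinearMap.comp_apply, Basis.coord_apply, smul_eq_mul]
      module
    have hy' : ∑ j : Fin m, coordZ y' j.succ • (b j.succ : E) =
        c • chartVec e y - (b 0 : E) := by
      rw [← hv', chartVec, chartDir_apply, Fin.sum_univ_succ, coordZ_zero]
      module
    rw [hM, hy', ← hD', Basis.coord_apply]
    module
  have hcomp : ∀ η, fderiv ℝ (chart e) y η =
      fderiv ℝ (chart fun j => (b j : E)) y' (LinearMap.toContinuousLinearMap T₀ η) := by
    intro η
    rw [LinearMap.coe_toContinuousLinearMap', fderiv_chart he y η rfl rfl rfl,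
      fderiv_chart hb y' _ hv' (hdir η) hl', hT, coordθ_coordEquiv, chart_deriv_rescale
      (chartVec_ne_zero he y) hc]
  refine ⟨LinearMap.toContinuousLinearMap T₀, ContinuousLinearMap.ext hcomp, ?_⟩
  -- a complex linear map has a nonnegative real determinant
  have hdet : (LinearMap.toContinuousLinearMap T₀).det = Complex.normSq (LinearMap.det M) := by
    rw [ContinuousLinearMap.det, LinearMap.coe_toContinuousLinearMap]
    refine (LinearMap.det_conj _ (coordEquiv m)).trans ?_
    rw [LinearMap.det_prodMap, LinearMap.det_id, one_mul, LinearMap.det_restrictScalars,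
      Algebra.norm_complex_apply]
  rw [hdet, Complex.normSq_pos]
  intro hM0
  rw [hM0, map_zero, ContinuousLinearMap.det] at hdet
  have hker := LinearMap.bot_lt_ker_of_det_eq_zero hdet
  refine hker.ne' (LinearMap.ker_eq_bot.2 fun η η' hη => hinj ?_)
  rw [hcomp, hcomp]
  exact congrArg _ hη

lemma oppChart_ne_one {e : Fin (m + 1) → E} (he : Orthonormal ℂ e) {y : Fin (2 * (m + 1) - 1) → ℝ}
    (hy : y ∈ chartDomain m) : oppChart e y ≠ 1 := by
  intro h
  have := inner_one_sub_oppChart_ne_zero he hy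
  simp [h] at this

section Reversing

variable [FiniteDimensional ℂ E] {W : ℕ → Submodule ℂ E} {e : Fin (m + 1) → E}

/-- `oppChart` is positively oriented, as it is a positively oriented coordinate system for `φ`
followed by a reflection. -/
lemma phiReversing_oppChart (he : Orthonormal ℂ e) (heW : ∀ j, e j ∈ (W (m + 1))ᗮ) :
    PhiReversing W (m + 1) (oppChart e) (chartDomain m) := by
  intro b y hy y' h h1
  rw [phiChart_eq_chart] at h ⊢
  have hinj : Function.Injective (fderiv ℝ (chart e) (reflect m y)) := by
    have := injective_fderiv_oppChart he hy
    rw [fderiv_oppChart he.linearIndependent] at this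
    intro η η' hη
    have h2 : reflect m η = reflect m η' := by
      refine this ?_
      simpa using hη
    rw [← reflect_reflect η, h2, reflect_reflect]
  obtain ⟨T, hT, hdet⟩ := exists_fderiv_chart_eq_comp b he.linearIndependent heW h h1 hinj
  refine ⟨T.comp (reflect m), ?_, ?_⟩
  · rw [fderiv_oppChart he.linearIndependent, hT]
    rfl
  · rw [det_comp, det_reflect]
    linarith

/-- Every positively oriented parametrization has the same orientation as `oppChart`. -/
lemma PhiReversing.exists_fderiv_eq_comp {ψ : (Fin (2 * (m + 1) - 1) → ℝ) → (E →L[ℂ] E)}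
    {Ω : Set (Fin (2 * (m + 1) - 1) → ℝ)} (hψ : PhiReversing W (m + 1) ψ Ω)
    (he : Orthonormal ℂ e) {b : Basis (Fin (m + 1)) ℂ ↥(W (m + 1))ᗮ}
    (hb : ∀ j, (b j : E) = e j) {x y : Fin (2 * (m + 1) - 1) → ℝ} (hx : x ∈ Ω)
    (hy : y ∈ chartDomain m) (hxy : oppChart e y = ψ x) :
    ∃ T : (Fin (2 * (m + 1) - 1) → ℝ) →L[ℝ] (Fin (2 * (m + 1) - 1) → ℝ),
      fderiv ℝ ψ x = (fderiv ℝ (oppChart e) y).comp T ∧ 0 < T.det := by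
  have hbe : (fun j => (b j : E)) = e := funext hb
  have hphi : phiChart b = chart e := by rw [phiChart_eq_chart, hbe]
  obtain ⟨T, hT, hdet⟩ := hψ b x hx (reflect m y) (by rw [hphi]; exact hxy)
    (by rw [← hxy]; exact oppChart_ne_one he hy)
  refine ⟨(reflect m).comp T, ?_, ?_⟩
  · rw [hT, hphi, fderiv_oppChart he.linearIndependent, ContinuousLinearMap.comp_assoc,
      ← ContinuousLinearMap.comp_assoc (reflect m), reflect_comp_reflect,
      ContinuousLinearMap.id_comp]
  · rw [det_comp, det_reflect]
    linarith

end Reversing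

end Orientation

/-! ### Unitary maps that differ from the identity by a map of rank one -/

section RankOne

variable {E : Type*} [NormedAddCommGroup E] [InnerProductSpace ℂ E] [FiniteDimensional ℂ E]

lemma mem_unitaryOps_iff {U : E →L[ℂ] E} : U ∈ unitaryOps E ↔
    haveI := FiniteDimensional.complete ℂ E
    star U * U = 1 ∧ U * star U = 1 := Iff.rfl

lemma norm_apply_of_mem_unitaryOps {U : E →L[ℂ] E} (hU : U ∈ unitaryOps E) (x : E) :
    ‖U x‖ = ‖x‖ := by
  have := FiniteDimensional.complete ℂ E
  have h1 : inner ℂ (U x) (U x) = inner ℂ x x := by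
    rw [← ContinuousLinearMap.adjoint_inner_right]
    have := DFunLike.congr_fun (mem_unitaryOps_iff.1 hU).1 x
    exact congrArg (inner ℂ x) this
  rw [inner_self_eq_norm_sq_to_K, inner_self_eq_norm_sq_to_K] at h1
  have h2 : ‖U x‖ ^ 2 = ‖x‖ ^ 2 := by exact_mod_cast h1
  exact (sq_eq_sq₀ (norm_nonneg _) (norm_nonneg _)).1 h2

/-- For unitary `U` the map `1 - U` is normal, so that its range is orthogonal to its kernel. -/
lemma inner_one_sub_eq_zero {U : E →L[ℂ] E} (hU : U ∈ unitaryOps E) {z : E}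
    (hz : (1 - U) z = 0) (x : E) : inner ℂ z ((1 - U) x) = 0 := by
  have := FiniteDimensional.complete ℂ E
  have hUz : U z = z := by
    rw [sub_apply, one_apply_eq_self, sub_eq_zero] at hz
    exact hz.symm
  have h1 : ContinuousLinearMap.adjoint U z = z := by
    have h2 := DFunLike.congr_fun (mem_unitaryOps_iff.1 hU).1 z
    have h3 : ContinuousLinearMap.adjoint U (U z) = z := h2
    rwa [hUz] at h3
  rw [sub_apply, one_apply_eq_self, inner_sub_right, ← ContinuousLinearMap.adjoint_inner_left, h1,
    sub_self]

/-- The converse of `inner_one_sub_eq_zero`: vectors orthogonal to the range of `1 - U` are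
fixed. -/
lemma one_sub_apply_eq_zero {U : E →L[ℂ] E} (hU : U ∈ unitaryOps E) {z : E}
    (hz : ∀ x, inner ℂ z ((1 - U) x) = 0) : (1 - U) z = 0 := by
  have := FiniteDimensional.complete ℂ E
  have h1 : ContinuousLinearMap.adjoint U z = z := by
    refine ext_inner_right ℂ fun x => ?_
    have := hz x
    rw [sub_apply, one_apply_eq_self, inner_sub_right, sub_eq_zero] at this
    rw [ContinuousLinearMap.adjoint_inner_left, this]
  have h2 : U (ContinuousLinearMap.adjoint U z) = z :=
    DFunLike.congr_fun (mem_unitaryOps_iff.1 hU).2 z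
  rw [h1] at h2
  rw [sub_apply, one_apply_eq_self, h2, sub_self]

/-- A unitary map `U` for which `1 - U` takes values in a line is a complex reflection in this
line. -/
lemma exists_eq_lineMul {U : E →L[ℂ] E} (hU : U ∈ unitaryOps E) {v : E} (hv : v ≠ 0)
    (hrange : ∀ x, ∃ a : ℂ, (1 - U) x = a • v) :
    ∃ l : ℂ, ‖l‖ = 1 ∧ U = lineMul (l - 1) v := by
  have hvv : inner ℂ v v ≠ 0 := inner_self_ne_zero.2 hv
  obtain ⟨a, ha⟩ := hrange v
  have hUv : U v = (1 - a) • v := by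
    rw [sub_apply, one_apply_eq_self] at ha
    rw [sub_smul, one_smul, ← ha]
    abel
  refine ⟨1 - a, ?_, ?_⟩
  · have h1 := norm_apply_of_mem_unitaryOps hU v
    rw [hUv, norm_smul] at h1
    exact (mul_eq_right₀ (norm_ne_zero_iff.2 hv)).1 h1
  · ext x
    have hz : ∀ w, inner ℂ (x - (inner ℂ v x / inner ℂ v v) • v) ((1 - U) w) = 0 := by
      intro w
      obtain ⟨c, hc⟩ := hrange w
      have h3 : inner ℂ v (x - (inner ℂ v x / inner ℂ v v) • v) = 0 := by
        rw [inner_sub_right, inner_smul_right, div_mul_cancel₀ _ hvv, sub_self]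
      rw [hc, inner_smul_right, ← inner_conj_symm, h3, map_zero, mul_zero]
    have h2 := one_sub_apply_eq_zero hU hz
    rw [map_sub, map_smul, ha, sub_eq_zero, sub_apply, one_apply_eq_self] at h2
    have h4 : U x = x - (inner ℂ v x / inner ℂ v v) • a • v := by rw [← h2]; abel
    rw [h4, lineMul_apply]
    module

lemma star_lineMul (a : ℂ) (v : E) :
    haveI := FiniteDimensional.complete ℂ E
    star (lineMul a v) = lineMul (star a) v := by
  have := FiniteDimensional.complete ℂ E
  symm
  refine (ContinuousLinearMap.eq_adjoint_iff _ _).2 fun x y => ?_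
  rw [lineMul_apply, lineMul_apply, inner_add_left, inner_add_right, inner_smul_left,
    inner_smul_right, map_mul, map_div₀, inner_conj_symm, inner_conj_symm]
  simp only [RCLike.star_def, Complex.conj_conj]
  ring

lemma lineMul_mem_unitaryOps {a : ℂ} {v : E} (hv : v ≠ 0) (ha : a + star a + a * star a = 0) :
    lineMul a v ∈ unitaryOps E := by
  have := FiniteDimensional.complete ℂ E
  refine mem_unitaryOps_iff.2 ?_
  rw [star_lineMul]
  exact ⟨lineMul_star_mul hv ha, lineMul_mul_star hv ha⟩

lemma sub_one_relation {l : ℂ} (hl : ‖l‖ = 1) :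
    (l - 1) + star (l - 1) + (l - 1) * star (l - 1) = 0 := by
  have h1 : l * star l = 1 := by
    have := Complex.mul_conj l
    rw [Complex.normSq_eq_norm_sq, hl] at this
    simpa using this
  rw [star_sub, star_one]
  linear_combination h1

section Incidence

variable {W : ℕ → Submodule ℂ E} {k : ℕ}

/-- For `U` in the incidence set `1 - U` has rank one, and its range is orthogonal to `W_k`. -/
lemma incidenceSet_subset_complexReflections (hk : 1 ≤ k)
    (hkn : k ≤ finrank ℂ E) (hdim : finrank ℂ (W k) = finrank ℂ E - k) :
    incidenceSet W k ⊆ complexReflections (W k)ᗮ := by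
  rintro U ⟨hU, hUW, hUk⟩
  have hle : W k ≤ LinearMap.ker ((1 - U : E →L[ℂ] E) : E →ₗ[ℂ] E) := by
    intro w hw
    rw [LinearMap.mem_ker]
    change (1 - U) w = 0
    rw [sub_apply, one_apply_eq_self, hUW w hw, sub_self]
  have h1 := Submodule.finrank_add_inf_finrank_orthogonal hle
  have h2 := LinearMap.finrank_range_add_finrank_ker ((1 - U : E →L[ℂ] E) : E →ₗ[ℂ] E)
  have h3 : finrank ℂ (LinearMap.range ((1 - U : E →L[ℂ] E) : E →ₗ[ℂ] E)) = 1 := by omega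
  obtain ⟨⟨v, w, rfl⟩, hv0, hv⟩ := finrank_eq_one_iff'.1 h3
  have hv0' : (1 - U) w ≠ 0 := fun h => hv0 (Subtype.ext h)
  obtain ⟨l, hl, hUl⟩ := exists_eq_lineMul hU hv0' fun x => by
    obtain ⟨c, hc⟩ := hv ⟨_, x, rfl⟩
    exact ⟨c, (congrArg Subtype.val hc).symm⟩
  rw [hUl]
  refine lineMul_mem_complexReflections hl ?_ hv0'
  exact (Submodule.mem_orthogonal _ _).2 fun z hz => inner_one_sub_eq_zero hU (hle hz) w

lemma lineMul_mem_incidenceSet (hk : 1 ≤ k)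
    (hkn : k ≤ finrank ℂ E) (hdim : finrank ℂ (W k) = finrank ℂ E - k) {l : ℂ} {v : E}
    (hl : ‖l‖ = 1) (hl1 : l ≠ 1) (hv : v ∈ (W k)ᗮ) (hv0 : v ≠ 0) :
    lineMul (l - 1) v ∈ incidenceSet W k := by
  have hfix : ∀ w ∈ W k, lineMul (l - 1) v w = w := by
    intro w hw
    rw [lineMul_apply, (Submodule.mem_orthogonal' _ _).1 hv w hw, mul_zero, zero_smul, add_zero]
  refine ⟨lineMul_mem_unitaryOps hv0 (sub_one_relation hl), hfix, ?_⟩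
  have hle : W k ≤ LinearMap.ker ((1 - lineMul (l - 1) v : E →L[ℂ] E) : E →ₗ[ℂ] E) := by
    intro w hw
    rw [LinearMap.mem_ker]
    change (1 - lineMul (l - 1) v) w = 0
    rw [sub_apply, one_apply_eq_self, hfix w hw, sub_self]
  have h1 := Submodule.finrank_add_inf_finrank_orthogonal hle
  have hker : LinearMap.ker ((1 - lineMul (l - 1) v : E →L[ℂ] E) : E →ₗ[ℂ] E) =
      (Submodule.span ℂ {v})ᗮ := by
    ext x
    rw [LinearMap.mem_ker, Submodule.mem_orthogonal_singleton_iff_inner_right]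
    change (1 - lineMul (l - 1) v) x = 0 ↔ _
    rw [one_sub_lineMul_apply, smul_eq_zero, or_iff_left hv0, neg_eq_zero, mul_eq_zero,
      or_iff_right (div_ne_zero (sub_ne_zero.2 hl1) (inner_self_ne_zero.2 hv0))]
  have h2 := (Submodule.span ℂ {v}).finrank_add_finrank_orthogonal
  rw [finrank_span_singleton hv0, ← hker] at h2
  omega

end Incidence

end RankOne

/-! ### Orthonormal bases adapted to the flag -/

section Flag

variable {E : Type*} [NormedAddCommGroup E] [InnerProductSpace ℂ E]

section DiagOp

variable {n : ℕ}

/-- The endomorphism with eigenvectors `u i` and eigenvalues `f i`. -/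
def diagOp (u : Fin n → E) (f : Fin n → ℂ) : E →L[ℂ] E := ∑ i, f i • outer (u i) (u i)

lemma diagOp_apply (u : Fin n → E) (f : Fin n → ℂ) (x : E) :
    diagOp u f x = ∑ i, f i • inner ℂ (u i) x • u i := by
  simp [diagOp, sum_apply, outer_apply]

lemma inner_diagOp (u : OrthonormalBasis (Fin n) ℂ E) (f : Fin n → ℂ) (i : Fin n) (x : E) :
    inner ℂ (u i) (diagOp u f x) = f i * inner ℂ (u i) x := by
  rw [diagOp_apply, inner_sum, Finset.sum_eq_single i]
  · rw [inner_smul_right, inner_smul_right, orthonormal_iff_ite.1 u.orthonormal, if_pos rfl,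
      mul_one]
  · intro j _ hj
    rw [inner_smul_right, inner_smul_right, orthonormal_iff_ite.1 u.orthonormal, if_neg hj.symm,
      mul_zero, mul_zero]
  · simp

lemma ext_inner_basis (u : OrthonormalBasis (Fin n) ℂ E) {x y : E}
    (h : ∀ i, inner ℂ (u i) x = inner ℂ (u i) y) : x = y := by
  rw [← u.sum_repr' x, ← u.sum_repr' y]
  simp only [h]

lemma diagOp_mul (u : OrthonormalBasis (Fin n) ℂ E) (f g : Fin n → ℂ) :
    diagOp u f * diagOp u g = diagOp u fun i => f i * g i := by
  ext x
  refine ext_inner_basis u fun i => ?_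
  rw [mul_apply_eq_comp, inner_diagOp, inner_diagOp, inner_diagOp, mul_assoc]

lemma diagOp_one (u : OrthonormalBasis (Fin n) ℂ E) : (diagOp u fun _ => 1) = 1 := by
  ext x
  refine ext_inner_basis u fun i => ?_
  rw [inner_diagOp, one_mul, one_apply_eq_self]

lemma hasDerivAt_diagOp (u : Fin n → E) {f : ℝ → Fin n → ℂ} {f' : Fin n → ℂ} {t : ℝ}
    (hf : ∀ i, HasDerivAt (fun s => f s i) (f' i) t) :
    HasDerivAt (fun s => diagOp u (f s)) (diagOp u f') t :=
  HasDerivAt.fun_sum fun i _ => (hf i).smul_const (outer (u i) (u i))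

end DiagOp

section FlagBasis

variable {W : ℕ → Submodule ℂ E}

/-- The orthonormal basis `u` is adapted to the flag `W`: the line `E_{i+1}` is spanned by `u i`.
The indices of the basis start at `0`, those of the lines at `1`. -/
def IsFlagBasis (W : ℕ → Submodule ℂ E) (u : OrthonormalBasis (Fin (finrank ℂ E)) ℂ E) : Prop :=
  ∀ i : Fin (finrank ℂ E), u i ∈ W (i : ℕ) ∧ u i ∈ (W ((i : ℕ) + 1))ᗮ

variable {u : OrthonormalBasis (Fin (finrank ℂ E)) ℂ E}

lemma inner_flagBasis_eq_zero (hW : Antitone W) (hu : IsFlagBasis W u) {k : ℕ}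
    {v : E} (hv : v ∈ (W k)ᗮ) (i : Fin (finrank ℂ E)) (hi : k ≤ i) : inner ℂ (u i) v = 0 :=
  (Submodule.mem_orthogonal _ _).1 hv _ (hW hi (hu i).1)

lemma mem_orthogonal_of_inner_flagBasis (hW : Antitone W)
    (hu : IsFlagBasis W u) {k : ℕ}
    {v : E} (hv : ∀ i : Fin (finrank ℂ E), k ≤ i → inner ℂ (u i) v = 0) : v ∈ (W k)ᗮ := by
  rw [← u.sum_repr' v]
  refine Submodule.sum_mem _ fun i _ => ?_
  by_cases hi : k ≤ i
  · rw [hv i hi, zero_smul]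
    exact Submodule.zero_mem _
  · exact Submodule.smul_mem _ _ (Submodule.orthogonal_le (hW (not_le.1 hi)) (hu i).2)

variable [FiniteDimensional ℂ E]

lemma exists_flagBasis (hW : Antitone W)
    (hdim : ∀ m ≤ finrank ℂ E, finrank ℂ (W m) = finrank ℂ E - m) :
    ∃ u : OrthonormalBasis (Fin (finrank ℂ E)) ℂ E, IsFlagBasis W u := by
  have h1 : ∀ i : Fin (finrank ℂ E), ∃ x : E, ‖x‖ = 1 ∧ x ∈ W (i : ℕ) ∧ x ∈ (W ((i : ℕ) + 1))ᗮ := by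
    intro i
    have h2 := Submodule.finrank_add_inf_finrank_orthogonal (hW (Nat.le_succ (i : ℕ)))
    rw [hdim _ i.2, hdim _ i.2.le] at h2
    have h3 : finrank ℂ ↥((W ((i : ℕ) + 1))ᗮ ⊓ W (i : ℕ)) ≠ 0 := by
      have := i.2
      change finrank ℂ E - (i + 1) + finrank ℂ ↥((W ((i : ℕ) + 1))ᗮ ⊓ W (i : ℕ)) = _ at h2
      omega
    obtain ⟨x, hx, hx0⟩ := Submodule.exists_mem_ne_zero_of_ne_bot
      (p := (W ((i : ℕ) + 1))ᗮ ⊓ W (i : ℕ)) (fun h => h3 (by rw [h, finrank_bot]))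
    refine ⟨((‖x‖⁻¹ : ℝ) : ℂ) • x, ?_, Submodule.smul_mem _ _ hx.2, Submodule.smul_mem _ _ hx.1⟩
    rw [norm_smul, Complex.norm_real, norm_inv, norm_norm,
      inv_mul_cancel₀ (norm_ne_zero_iff.2 hx0)]
  choose x hx1 hxW hxo using h1
  have hlt : ∀ i j : Fin (finrank ℂ E), i < j → inner ℂ (x i) (x j) = 0 := fun i j hij =>
    (Submodule.mem_orthogonal' _ _).1 (hxo i) _ (hW (Nat.succ_le_of_lt hij) (hxW j))
  have hon : Orthonormal ℂ x := by
    refine ⟨hx1, fun i j hij => ?_⟩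
    rcases lt_or_gt_of_ne hij with h | h
    · exact hlt i j h
    · rw [← inner_conj_symm, hlt j i h, map_zero]
  refine ⟨OrthonormalBasis.mk hon ?_, fun i => ?_⟩
  · rw [hon.linearIndependent.span_eq_top_of_card_eq_finrank' (by simp)]
  · rw [OrthonormalBasis.coe_mk]
    exact ⟨hxW i, hxo i⟩

lemma flagLine_starProjection (hW : Antitone W) (hu : IsFlagBasis W u)
    (j : ℕ) (i : Fin (finrank ℂ E)) :
    (flagLine W j).starProjection (u i) = if (i : ℕ) + 1 = j then u i else 0 := by
  split_ifs with h
  · subst h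
    exact Submodule.starProjection_eq_self_iff.2 ⟨(hu i).1, (hu i).2⟩
  · refine (Submodule.starProjection_apply_eq_zero_iff _).2 ?_
    rcases lt_or_gt_of_ne h with h | h
    · exact Submodule.orthogonal_le (inf_le_left.trans (hW (Nat.le_sub_one_of_lt h))) (hu i).2
    · refine (Submodule.mem_orthogonal' _ _).2 fun x hx => ?_
      exact (Submodule.mem_orthogonal _ _).1 hx.2 _ (hW (Nat.le_of_lt_succ h) (hu i).1)

lemma flagOp_eq_diagOp (hW : Antitone W) (hu : IsFlagBasis W u) :
    flagOp W = diagOp u fun i => ((i : ℕ) : ℂ) + 1 := by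
  refine ContinuousLinearMap.coe_injective (u.toBasis.ext fun i => ?_)
  rw [OrthonormalBasis.coe_toBasis]
  change flagOp W (u i) = diagOp u _ (u i)
  have hr : diagOp u (fun i => ((i : ℕ) : ℂ) + 1) (u i) = (((i : ℕ) : ℂ) + 1) • u i := by
    refine ext_inner_basis u fun j => ?_
    rw [inner_diagOp, inner_smul_right, orthonormal_iff_ite.1 u.orthonormal]
    split_ifs with h
    · rw [h]
    · simp
  rw [hr, flagOp, sum_apply, Finset.sum_eq_single ((i : ℕ) + 1)]
  · rw [smul_apply, flagLine_starProjection hW hu, if_pos rfl]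
    push_cast
    rfl
  · intro j _ hj
    rw [smul_apply, flagLine_starProjection hW hu, if_neg hj.symm, smul_zero]
  · intro h
    exact absurd (Finset.mem_Icc.2 ⟨by omega, i.2⟩) h

lemma critPoint_eq_lineMul (hW : Antitone W) (hu : IsFlagBasis W u)
    (i₀ : Fin (finrank ℂ E)) : critPoint W (i₀ + 1) = lineMul (-2) (u i₀) := by
  refine ContinuousLinearMap.coe_injective (u.toBasis.ext fun i => ?_)
  rw [OrthonormalBasis.coe_toBasis]
  change critPoint W (i₀ + 1) (u i) = lineMul (-2) (u i₀) (u i)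
  rw [critPoint, Submodule.starProjection_orthogonal', lineMul_apply]
  simp only [add_apply, neg_apply, sub_apply, one_apply_eq_self, flagLine_starProjection hW hu,
    orthonormal_iff_ite.1 u.orthonormal]
  by_cases h : i = i₀
  · subst h
    simp only [if_true]
    module
  · have h' : ¬ ((i : ℕ) + 1 = i₀ + 1) := fun hh => h (Fin.ext (by omega))
    rw [if_neg h', if_neg (Ne.symm h)]
    simp

/-- A basis `e` of `W_{m+1}^⊥` of which `e₀` spans the line `E_{m+1}`: the vectors `u m, …, u 0` in
this order. -/
lemma exists_basis_orthogonal_flag (hW : Antitone W)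
    (hdim : ∀ m ≤ finrank ℂ E, finrank ℂ (W m) = finrank ℂ E - m)
    (hu : IsFlagBasis W u) {m : ℕ} (hm : m < finrank ℂ E) :
    ∃ (e : Fin (m + 1) → E) (b : Basis (Fin (m + 1)) ℂ ↥(W (m + 1))ᗮ),
      Orthonormal ℂ e ∧ (∀ j, (b j : E) = e j) ∧ e 0 = u ⟨m, hm⟩ ∧
      ∀ v ∈ (W (m + 1))ᗮ, ∑ j, inner ℂ (e j) v • e j = v := by
  let e : Fin (m + 1) → E := fun j => u ⟨m - j, by omega⟩
  have he : Orthonormal ℂ e := by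
    refine u.orthonormal.comp (fun j : Fin (m + 1) => (⟨m - j, by omega⟩ : Fin (finrank ℂ E)))
      fun i j hij => ?_
    have := congrArg Fin.val hij
    simp only at this
    exact Fin.ext (by omega)
  have heW : ∀ j, e j ∈ (W (m + 1))ᗮ := fun j =>
    Submodule.orthogonal_le (hW (by simp)) (hu ⟨m - j, by omega⟩).2
  let e' : Fin (m + 1) → ↥(W (m + 1))ᗮ := fun j => ⟨e j, heW j⟩
  have he' : LinearIndependent ℂ e' :=
    LinearIndependent.of_comp (W (m + 1))ᗮ.subtype he.linearIndependent
  have hcard : Fintype.card (Fin (m + 1)) = finrank ℂ ↥(W (m + 1))ᗮ := by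
    have := (W (m + 1)).finrank_add_finrank_orthogonal
    rw [hdim _ hm] at this
    rw [Fintype.card_fin]
    omega
  let b := basisOfLinearIndependentOfCardEqFinrank he' hcard
  have hb : ∀ j, (b j : E) = e j := fun j => by
    simp only [b, coe_basisOfLinearIndependentOfCardEqFinrank]
    rfl
  refine ⟨e, b, he, hb, rfl, fun v hv => ?_⟩
  have h1 := congrArg (fun x : ↥(W (m + 1))ᗮ => (x : E)) (b.sum_repr ⟨v, hv⟩)
  simp only [Submodule.coe_sum, Submodule.coe_smul, hb] at h1
  rw [← h1]
  refine Finset.sum_congr rfl fun j _ => ?_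
  rw [he.inner_right_fintype]

end FlagBasis

end Flag

/-! ### The trajectories in the unstable manifold -/

section WeightFlow

variable {E : Type*} [NormedAddCommGroup E] [InnerProductSpace ℂ E] {n : ℕ}

/-- The operator with eigenvectors `u i` and eigenvalues `1, …, n`. -/
def weightOp (u : Fin n → E) : E →L[ℂ] E := diagOp u fun i => ((i : ℕ) : ℂ) + 1

/-- The one-parameter group generated by `weightOp u`. -/
def weightFlow (u : Fin n → E) (t : ℝ) : E →L[ℂ] E :=
  diagOp u fun i => Complex.exp (t * (((i : ℕ) : ℂ) + 1))

lemma weightFlow_zero (u : OrthonormalBasis (Fin n) ℂ E) : weightFlow u 0 = 1 := by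
  simp [weightFlow, diagOp_one]

lemma weightFlow_mul (u : OrthonormalBasis (Fin n) ℂ E) (s t : ℝ) :
    weightFlow u s * weightFlow u t = weightFlow u (s + t) := by
  rw [weightFlow, weightFlow, diagOp_mul, weightFlow]
  congr 1
  funext i
  rw [← Complex.exp_add]
  push_cast
  ring_nf

lemma weightFlow_mul_neg (u : OrthonormalBasis (Fin n) ℂ E) (t : ℝ) :
    weightFlow u t * weightFlow u (-t) = 1 := by
  rw [weightFlow_mul, add_neg_cancel, weightFlow_zero]

lemma weightOp_mul_weightFlow (u : OrthonormalBasis (Fin n) ℂ E) (t : ℝ) :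
    weightOp u * weightFlow u t =
      diagOp u fun i => (((i : ℕ) : ℂ) + 1) * Complex.exp (t * (((i : ℕ) : ℂ) + 1)) :=
  diagOp_mul u _ _

lemma hasDerivAt_weightFlow (u : OrthonormalBasis (Fin n) ℂ E) (t : ℝ) :
    HasDerivAt (weightFlow u) (weightOp u * weightFlow u t) t := by
  rw [weightOp_mul_weightFlow]
  refine hasDerivAt_diagOp u fun i => ?_
  have h1 : HasDerivAt (fun s : ℝ => (s : ℂ) * (((i : ℕ) : ℂ) + 1)) (((i : ℕ) : ℂ) + 1) t := by
    simpa using (Complex.ofRealCLM.hasDerivAt (x := t)).mul_const (((i : ℕ) : ℂ) + 1)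
  refine h1.cexp.congr_deriv ?_
  ring

lemma hasDerivAt_weightFlow_neg (u : OrthonormalBasis (Fin n) ℂ E) (t : ℝ) :
    HasDerivAt (fun s => weightFlow u (-s)) (-(weightOp u * weightFlow u (-t))) t := by
  exact ((hasDerivAt_weightFlow u (-t)).scomp t (hasDerivAt_neg t)).congr_deriv (by simp)

lemma tendsto_exp_mul_atBot {a : ℝ} (ha : 0 < a) :
    Tendsto (fun t : ℝ => Complex.exp (t * (a : ℂ))) atBot (𝓝 0) := by
  rw [tendsto_zero_iff_norm_tendsto_zero]
  have h1 : Tendsto (fun t : ℝ => Real.exp (t * a)) atBot (𝓝 0) :=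
    Real.tendsto_exp_atBot.comp (tendsto_id.atBot_mul_const ha)
  refine h1.congr fun t => ?_
  rw [Complex.norm_exp, ← Complex.ofReal_mul, Complex.ofReal_re]

lemma tendsto_exp_mul_natCast_add_one_atBot (i : ℕ) :
    Tendsto (fun t : ℝ => Complex.exp (t * ((i : ℂ) + 1))) atBot (𝓝 0) := by
  simpa using tendsto_exp_mul_atBot (a := i + 1) (by positivity)

lemma tendsto_weightFlow_atBot (u : Fin n → E) : Tendsto (weightFlow u) atBot (𝓝 0) := by
  have h3 : Tendsto (weightFlow u) atBot (𝓝 (∑ i, (0 : ℂ) • outer (u i) (u i))) :=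
    tendsto_finsetSum _ fun i _ =>
      (tendsto_exp_mul_natCast_add_one_atBot i).smul_const (outer (u i) (u i))
  simpa using h3

/-- Backwards in time the component with the largest eigenvalue dominates `exp(-t A) x`. -/
lemma tendsto_smul_weightFlow_neg (u : Fin n → E) {x : E} {j : Fin n}
    (hx : ∀ i : Fin n, j < i → inner ℂ (u i) x = 0) :
    Tendsto (fun t : ℝ => Complex.exp (t * (((j : ℕ) : ℂ) + 1)) • weightFlow u (-t) x) atBot
      (𝓝 (inner ℂ (u j) x • u j)) := by
  have h1 : ∀ t : ℝ, Complex.exp (t * (((j : ℕ) : ℂ) + 1)) • weightFlow u (-t) x =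
      ∑ i : Fin n, Complex.exp (t * (((j : ℕ) : ℂ) - ((i : ℕ) : ℂ))) • inner ℂ (u i) x • u i := by
    intro t
    rw [weightFlow, diagOp_apply, Finset.smul_sum]
    refine Finset.sum_congr rfl fun i _ => ?_
    rw [smul_smul, ← Complex.exp_add]
    congr 2
    push_cast
    ring
  simp only [h1]
  have h2 : inner ℂ (u j) x • u j =
      ∑ i, (if i = j then (1 : ℂ) else 0) • inner ℂ (u i) x • u i := by simp
  rw [h2]
  refine tendsto_finsetSum _ fun i _ => ?_
  rcases lt_trichotomy i j with h | h | h
  · refine Tendsto.smul_const ?_ _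
    have hpos : (0 : ℝ) < (j : ℕ) - (i : ℕ) := by
      rw [sub_pos]; exact_mod_cast h
    rw [if_neg h.ne]
    simpa using tendsto_exp_mul_atBot hpos
  · subst h
    simp
  · simp [hx i h]

lemma inner_weightOp (u : Fin n → E) (x y : E) :
    inner ℂ (weightOp u x) y = inner ℂ x (weightOp u y) := by
  rw [weightOp, diagOp_apply, diagOp_apply, sum_inner, inner_sum]
  refine Finset.sum_congr rfl fun i _ => ?_
  simp only [inner_smul_left, inner_smul_right, inner_conj_symm, map_add, map_natCast, map_one]
  ring

lemma weightOp_mul_outer (u : Fin n → E) (v : E) :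
    weightOp u * outer v v = outer (weightOp u v) v := by
  ext x
  simp [outer_apply]

lemma outer_mul_weightOp (u : Fin n → E) (v : E) :
    outer v v * weightOp u = outer v (weightOp u v) := by
  ext x
  simp [outer_apply, inner_weightOp]

lemma outer_mul_outer (x y z w : E) : outer x y * outer z w = inner ℂ y z • outer x w := by
  ext a
  simp [outer_apply, smul_smul, mul_comm]

section Trajectory

variable (u : OrthonormalBasis (Fin n) ℂ E) (v : E) (c : ℂ)

/-- The trajectory `1 + 2 (c - ⟨v_t, v_t⟩)⁻¹ ⟨v_t, ·⟩ v_t`, where `v_t = exp(-t A) v`: the line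
moves under the flow of `-A`, and the reciprocal of the coefficient moves with the velocity
`⟨v_t, A v_t⟩`. It is unitary if `c` is imaginary. -/
def lineTrajectory (t : ℝ) : E →L[ℂ] E :=
  1 + (2 / (c - inner ℂ (weightFlow u (-t) v) (weightFlow u (-t) v))) •
    outer (weightFlow u (-t) v) (weightFlow u (-t) v)

variable {v c}

lemma weightFlow_apply_ne_zero (hv : v ≠ 0) (t : ℝ) : weightFlow u t v ≠ 0 := by
  intro h
  have h1 := DFunLike.congr_fun (weightFlow_mul_neg u (-t)) v
  rw [neg_neg, mul_apply_eq_comp, h, map_zero, one_apply_eq_self] at h1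
  exact hv h1.symm

/-- An imaginary number is different from the square of a norm. -/
lemma sub_inner_self_ne_zero (hc : c.re = 0) {w : E} (hw : w ≠ 0) : c - inner ℂ w w ≠ 0 := by
  intro h
  have h1 := congrArg Complex.re h
  rw [Complex.sub_re, hc, Complex.zero_re, zero_sub, neg_eq_zero] at h1
  rw [inner_self_eq_norm_sq_to_K] at h1
  exact hw (norm_eq_zero.1 (pow_eq_zero_iff two_ne_zero |>.1 (by exact_mod_cast h1)))

lemma hasDerivAt_lineTrajectory (hv : v ≠ 0) (hc : c.re = 0) (t : ℝ) :
    HasDerivAt (lineTrajectory u v c) (weightOp u -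
      lineTrajectory u v c t * weightOp u * lineTrajectory u v c t) t := by
  have hw : HasDerivAt (fun s => weightFlow u (-s) v) (-(weightOp u (weightFlow u (-t) v))) t := by
    have h1 : HasFDerivAt (fun T : E →L[ℂ] E => T v)
        ((ContinuousLinearMap.apply ℂ E v).restrictScalars ℝ) (weightFlow u (-t)) :=
      ((ContinuousLinearMap.apply ℂ E v).restrictScalars ℝ).hasFDerivAt
    exact h1.comp_hasDerivAt t (hasDerivAt_weightFlow_neg u t)
  have hne := sub_inner_self_ne_zero hc (weightFlow_apply_ne_zero u hv (-t))
  have hN := hw.inner ℂ hw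
  have hO := (isBoundedBilinearMap_outer (E := E)).hasFDerivAt
    (weightFlow u (-t) v, weightFlow u (-t) v) |>.comp_hasDerivAt t (hw.prodMk hw)
  have hβ := ((hN.const_sub c).fun_inv hne).const_mul (2 : ℂ)
  have hγ := (hβ.fun_smul hO).const_add (1 : E →L[ℂ] E)
  have hfun : lineTrajectory u v c = fun s => 1 +
      (2 * (c - inner ℂ (weightFlow u (-s) v) (weightFlow u (-s) v))⁻¹) •
        outer (weightFlow u (-s) v) (weightFlow u (-s) v) := rfl
  rw [hfun]
  refine hγ.congr_deriv ?_
  simp only [Function.comp_apply, IsBoundedBilinearMap.deriv_apply]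
  generalize weightFlow u (-t) v = w at *
  have o1 : outer w (-(weightOp u w)) = -(outer w w * weightOp u) := by
    rw [outer_mul_weightOp]; ext x; simp [outer_apply]
  have o2 : outer (-(weightOp u w)) w = -(weightOp u * outer w w) := by
    rw [weightOp_mul_outer]; ext x; simp [outer_apply]
  have o3 : outer w w * weightOp u * outer w w = inner ℂ w (weightOp u w) • outer w w := by
    rw [mul_assoc, weightOp_mul_outer, outer_mul_outer]
  rw [o1, o2, inner_neg_left, inner_neg_right, inner_weightOp]
  have o4 : ∀ β : ℂ, (1 + β • outer w w) * weightOp u * (1 + β • outer w w) =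
      weightOp u + β • (outer w w * weightOp u) + β • (weightOp u * outer w w) +
        (β * β) • (outer w w * weightOp u * outer w w) := by
    intro β
    simp only [add_mul, mul_add, one_mul, mul_one, smul_mul_assoc, mul_smul_comm]
    module
  rw [o4, o3]
  match_scalars <;> field_simp <;> ring

lemma lineTrajectory_eq_lineMul (hv : v ≠ 0) (t : ℝ) :
    lineTrajectory u v c t = lineMul (2 * inner ℂ (weightFlow u (-t) v) (weightFlow u (-t) v) /
      (c - inner ℂ (weightFlow u (-t) v) (weightFlow u (-t) v))) (weightFlow u (-t) v) := by
  have hN : inner ℂ (weightFlow u (-t) v) (weightFlow u (-t) v) ≠ 0 :=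
    inner_self_ne_zero.2 (weightFlow_apply_ne_zero u hv (-t))
  rw [lineTrajectory, lineMul]
  congr 2
  field_simp

lemma lineTrajectory_mem_unitaryOps [FiniteDimensional ℂ E] (hv : v ≠ 0) (hc : c.re = 0) (t : ℝ) :
    lineTrajectory u v c t ∈ unitaryOps E := by
  have hw := weightFlow_apply_ne_zero u hv (-t)
  rw [lineTrajectory_eq_lineMul u hv]
  refine lineMul_mem_unitaryOps hw ?_
  have hne := sub_inner_self_ne_zero hc hw
  have hsc : star c = -c := by
    apply Complex.ext
    · simp [hc]
    · simp
  have hsN : star (inner ℂ (weightFlow u (-t) v) (weightFlow u (-t) v) : ℂ) =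
      inner ℂ (weightFlow u (-t) v) (weightFlow u (-t) v) := inner_conj_symm _ _
  have hne' : -c - inner ℂ (weightFlow u (-t) v) (weightFlow u (-t) v) ≠ 0 := by
    rw [← hsc, ← hsN, ← star_sub]
    exact star_ne_zero.2 hne
  rw [star_div₀, star_mul, star_sub, hsN, hsc, show star (2 : ℂ) = 2 from Complex.conj_ofNat 2]
  generalize (inner ℂ (weightFlow u (-t) v) (weightFlow u (-t) v) : ℂ) = N at *
  field_simp
  ring

/-- The constant for which the trajectory starts at a given complex reflection. -/
lemma lineTrajectory_zero {l : ℂ} (hl1 : l ≠ 1) (hv : v ≠ 0) :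
    lineTrajectory u v (inner ℂ v v * ((l + 1) / (l - 1))) 0 = lineMul (l - 1) v := by
  have hN : inner ℂ v v ≠ 0 := inner_self_ne_zero.2 hv
  have hl := sub_ne_zero.2 hl1
  rw [lineTrajectory_eq_lineMul u hv, neg_zero, weightFlow_zero, one_apply_eq_self]
  congr 1
  have h1 : inner ℂ v v * ((l + 1) / (l - 1)) - inner ℂ v v = 2 * inner ℂ v v / (l - 1) := by
    field_simp
    ring
  rw [h1]
  field_simp

/-- The Cayley transform `(l + 1) / (l - 1)` of a number of modulus one is imaginary. -/
lemma re_inner_self_mul_eq_zero {l : ℂ} (hl : ‖l‖ = 1) (hl1 : l ≠ 1) (v : E) :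
    (inner ℂ v v * ((l + 1) / (l - 1))).re = 0 := by
  have h1 : l * star l = 1 := by
    have := Complex.mul_conj l
    rw [Complex.normSq_eq_norm_sq, hl] at this
    simpa using this
  have h3 : star l - 1 ≠ 0 := by
    rw [← star_one, ← star_sub]
    exact star_ne_zero.2 (sub_ne_zero.2 hl1)
  have h2 : star (inner ℂ v v * ((l + 1) / (l - 1))) = -(inner ℂ v v * ((l + 1) / (l - 1))) := by
    rw [star_mul', star_div₀, star_add, star_sub, star_one,
      show star (inner ℂ v v : ℂ) = inner ℂ v v from inner_conj_symm _ _, ← mul_neg]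
    congr 1
    have := sub_ne_zero.2 hl1
    rw [div_eq_iff h3, neg_mul, eq_neg_iff_add_eq_zero]
    field_simp
    linear_combination 2 * h1
  have h4 := congrArg Complex.re h2
  rw [Complex.star_def, Complex.conj_re, Complex.neg_re] at h4
  linarith

/-- Backwards in time the line of `v` converges to the line of `u j`, where `j` is the largest index
that occurs in `v`, and the eigenvalue to `-1`, because `⟨v_t, v_t⟩` outgrows the constant `c`. -/
lemma tendsto_lineTrajectory {j : Fin n} (hj : inner ℂ (u j) v ≠ 0)
    (hv : ∀ i : Fin n, j < i → inner ℂ (u i) v = 0) :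
    Tendsto (lineTrajectory u v c) atBot (𝓝 (lineMul (-2) (u j))) := by
  have hv0 : v ≠ 0 := by rintro rfl; simp at hj
  let r : ℝ → ℂ := fun t => Complex.exp (t * (((j : ℕ) : ℂ) + 1))
  have hr0 : Tendsto r atBot (𝓝 0) := tendsto_exp_mul_natCast_add_one_atBot j
  -- the vector `v_t`, rescaled so that it converges
  let w : ℝ → E := fun t => r t • weightFlow u (-t) v
  have hw : Tendsto w atBot (𝓝 (inner ℂ (u j) v • u j)) := tendsto_smul_weightFlow_neg u hv
  have hrr : ∀ t, starRingEnd ℂ (r t) = r t := by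
    intro t
    rw [← Complex.exp_conj]
    simp [r]
  have hrne : ∀ t, r t ≠ 0 := fun t => Complex.exp_ne_zero _
  have heq : ∀ t, lineTrajectory u v c t =
      1 + (2 / (c * r t ^ 2 - inner ℂ (w t) (w t))) • outer (w t) (w t) := by
    intro t
    have ho : outer (w t) (w t) =
        (r t ^ 2) • outer (weightFlow u (-t) v) (weightFlow u (-t) v) := by
      ext x
      simp only [w, outer_apply, inner_smul_left, hrr, smul_apply]
      module
    have hi : inner ℂ (w t) (w t) =
        r t ^ 2 * inner ℂ (weightFlow u (-t) v) (weightFlow u (-t) v) := by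
      simp only [w, inner_smul_left, inner_smul_right, hrr]
      ring
    rw [ho, hi, smul_smul, lineTrajectory, mul_comm c, ← mul_sub]
    congr 2
    have := hrne t
    rw [div_mul_eq_mul_div, mul_comm (2 : ℂ) (r t ^ 2), mul_div_mul_left _ _ (pow_ne_zero 2 this)]
  have hlim : Tendsto (fun t => 1 + (2 / (c * r t ^ 2 - inner ℂ (w t) (w t))) • outer (w t) (w t))
      atBot (𝓝 (1 + (2 / (c * 0 ^ 2 - inner ℂ (inner ℂ (u j) v • u j) (inner ℂ (u j) v • u j))) •
        outer (inner ℂ (u j) v • u j) (inner ℂ (u j) v • u j))) := by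
    have hN := hw.inner (𝕜 := ℂ) hw
    have hO : Tendsto (fun t => outer (w t) (w t)) atBot
        (𝓝 (outer (inner ℂ (u j) v • u j) (inner ℂ (u j) v • u j))) := by
      have hcont : Continuous fun x : E => outer x x :=
        isBoundedBilinearMap_outer.continuous.comp (continuous_id.prodMk continuous_id)
      exact (hcont.tendsto _).comp hw
    refine tendsto_const_nhds.add ((Tendsto.div tendsto_const_nhds
      ((((hr0.pow 2).const_mul c)).sub hN) ?_).smul hO)
    simpa using And.intro hj (u.orthonormal.ne_zero j)
  rw [funext heq]
  convert hlim using 2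
  rw [← lineMul_smul hj, lineMul]
  congr 2
  ring

end Trajectory

section UnstableManifold

variable [FiniteDimensional ℂ E] {W : ℕ → Submodule ℂ E}
  {u : OrthonormalBasis (Fin (finrank ℂ E)) ℂ E}

lemma lineMul_mem_unstableManifold (hW : Antitone W) (hu : IsFlagBasis W u)
    (i₀ : Fin (finrank ℂ E)) {l : ℂ} (hl : ‖l‖ = 1) (hl1 : l ≠ 1) {v : E}
    (hv : v ∈ (W (i₀ + 1))ᗮ) (h0 : inner ℂ (u i₀) v ≠ 0) :
    lineMul (l - 1) v ∈ unstableManifold W (i₀ + 1) := by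
  have hv0 : v ≠ 0 := by rintro rfl; simp at h0
  have hc := re_inner_self_mul_eq_zero hl hl1 v
  refine ⟨lineTrajectory u v (inner ℂ v v * ((l + 1) / (l - 1))), lineTrajectory_zero u hl1 hv0,
    lineTrajectory_mem_unitaryOps u hv0 hc, fun t => ?_, ?_⟩
  · rw [flagOp_eq_diagOp hW hu]
    exact hasDerivAt_lineTrajectory u hv0 hc t
  · rw [critPoint_eq_lineMul hW hu]
    exact tendsto_lineTrajectory u h0 fun i hi => inner_flagBasis_eq_zero hW hu hv i hi

end UnstableManifold

end WeightFlow

/-! ### Backward limits of trajectories -/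

section Linearization

variable {E : Type*} [NormedAddCommGroup E] [InnerProductSpace ℂ E] [FiniteDimensional ℂ E]
  {n : ℕ} (u : OrthonormalBasis (Fin n) ℂ E) {γ : ℝ → (E →L[ℂ] E)}

lemma norm_le_one_of_mem_unitaryOps {U : E →L[ℂ] E} (hU : U ∈ unitaryOps E) : ‖U‖ ≤ 1 :=
  ContinuousLinearMap.opNorm_le_bound _ zero_le_one fun x => by
    rw [norm_apply_of_mem_unitaryOps hU, one_mul]

/-- The Riccati flow `γ' = A - γ A γ` is linearized by
`γ = (sinh tA + cosh tA γ₀) (cosh tA + sinh tA γ₀)⁻¹`; the identity is stated without the inverse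
and multiplied by two. -/
lemma trajectory_mul_eq (hγU : ∀ t, γ t ∈ unitaryOps E)
    (hγ : ∀ t, HasDerivAt γ (weightOp u - γ t * weightOp u * γ t) t) (t : ℝ) :
    γ t * (weightFlow u t * (1 + γ 0) + weightFlow u (-t) * (1 - γ 0)) =
      weightFlow u t * (1 + γ 0) - weightFlow u (-t) * (1 - γ 0) := by
  have := FiniteDimensional.complete ℂ E
  set A : E →L[ℂ] E := weightOp u with hA
  let D : ℝ → (E →L[ℂ] E) := fun t =>
    weightFlow u t * (1 + γ 0) + weightFlow u (-t) * (1 - γ 0)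
  let N : ℝ → (E →L[ℂ] E) := fun t =>
    weightFlow u t * (1 + γ 0) - weightFlow u (-t) * (1 - γ 0)
  have hX : ∀ t, HasDerivAt (fun s => weightFlow u s * (1 + γ 0))
      (A * (weightFlow u t * (1 + γ 0))) t := fun t => by
    rw [← mul_assoc]; exact (hasDerivAt_weightFlow u t).mul_const _
  have hX' : ∀ t, HasDerivAt (fun s => weightFlow u (-s) * (1 - γ 0))
      (-(A * (weightFlow u (-t) * (1 - γ 0)))) t := fun t => by
    rw [← mul_assoc, ← neg_mul]; exact (hasDerivAt_weightFlow_neg u t).mul_const _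
  have hD : ∀ t, HasDerivAt D (A * N t) t := fun t =>
    ((hX t).add (hX' t)).congr_deriv (by simp only [N]; noncomm_ring)
  have hN : ∀ t, HasDerivAt N (A * D t) t := fun t =>
    ((hX t).sub (hX' t)).congr_deriv (by simp only [D]; noncomm_ring)
  -- the defect solves a linear equation and vanishes at `0`
  have hR : ∀ t, HasDerivAt (fun s => γ s * D s - N s) (-(γ t * A * (γ t * D t - N t))) t := by
    intro t
    refine (((hγ t).mul (hD t)).sub (hN t)).congr_deriv ?_
    noncomm_ring
  have hzero : (fun s => γ s * D s - N s) = fun _ => 0 := by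
    refine ODE_solution_unique_univ (v := fun t R => -(γ t * A * R)) (s := fun _ => Set.univ)
      (K := ‖A‖₊) (t₀ := 0) (fun t => ?_) (fun t => ⟨hR t, Set.mem_univ _⟩)
      (fun t => ⟨by simpa using hasDerivAt_const t (0 : E →L[ℂ] E), Set.mem_univ _⟩) ?_
    · refine (LipschitzWith.of_dist_le_mul fun R R' => ?_).lipschitzOnWith
      rw [dist_eq_norm, dist_eq_norm, coe_nnnorm,
        show -(γ t * A * R) - -(γ t * A * R') = -(γ t * A * (R - R')) by noncomm_ring, norm_neg]
      refine (norm_mul_le _ _).trans (mul_le_mul_of_nonneg_right ?_ (norm_nonneg _))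
      refine (norm_mul_le _ _).trans ?_
      exact mul_le_of_le_one_left (norm_nonneg _) (norm_le_one_of_mem_unitaryOps (hγU t))
    · simp only [D, N, neg_zero, weightFlow_zero, one_mul]
      noncomm_ring
  exact sub_eq_zero.1 (congrFun hzero t)

/-- The relation `(1 + γ) exp(-tA) (1 - γ₀) = (1 - γ) exp(tA) (1 + γ₀)`, in which the right hand
side tends to zero as `t → -∞`. -/
lemma one_add_mul_weightFlow (hγU : ∀ t, γ t ∈ unitaryOps E)
    (hγ : ∀ t, HasDerivAt γ (weightOp u - γ t * weightOp u * γ t) t) (t : ℝ) :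
    (1 + γ t) * (weightFlow u (-t) * (1 - γ 0)) = (1 - γ t) * (weightFlow u t * (1 + γ 0)) := by
  have h := trajectory_mul_eq u hγU hγ t
  rw [mul_add] at h
  rw [add_mul, sub_mul, one_mul, one_mul]
  linear_combination (norm := module) h

end Linearization

section Limit

variable {E : Type*} [NormedAddCommGroup E] [InnerProductSpace ℂ E] [FiniteDimensional ℂ E]
  {n : ℕ} {u : OrthonormalBasis (Fin n) ℂ E} {γ : ℝ → (E →L[ℂ] E)}

/-- If a trajectory comes out of `-id ⊕ id`, with `-1` on the line of `u i₀`, then the largest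
index which occurs in a vector of the range of `1 - γ 0` is `i₀`. -/
lemma range_one_sub_of_tendsto (hγU : ∀ t, γ t ∈ unitaryOps E)
    (hγ : ∀ t, HasDerivAt γ (weightOp u - γ t * weightOp u * γ t) t) {i₀ : Fin n}
    (hlim : Tendsto γ atBot (𝓝 (lineMul (-2) (u i₀)))) {x : E} (hx : x ≠ 0)
    (hxr : ∃ w, (1 - γ 0) w = x) :
    inner ℂ (u i₀) x ≠ 0 ∧ ∀ i : Fin n, i₀ < i → inner ℂ (u i) x = 0 := by
  obtain ⟨w, hw⟩ := hxr
  have hex : ∃ i, inner ℂ (u i) x ≠ 0 := by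
    by_contra! hall
    exact hx (ext_inner_basis u fun i => by rw [hall i, inner_zero_right])
  obtain ⟨j, hj, hmax⟩ : ∃ j, inner ℂ (u j) x ≠ 0 ∧ ∀ i : Fin n, j < i → inner ℂ (u i) x = 0 := by
    obtain ⟨j, hj, hmax⟩ := (Set.toFinite {i | inner ℂ (u i) x ≠ 0}).exists_maximal hex
    refine ⟨j, hj, fun i hi => ?_⟩
    by_contra h
    exact absurd (hmax h hi.le) (not_le.2 hi)
  -- `1 + γ t` has to annihilate the limit of the lines of `exp(-tA) x`, which is the line of `u j`
  suffices hij : j = i₀ by subst hij; exact ⟨hj, hmax⟩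
  have h1 := tendsto_smul_weightFlow_neg u hmax
  have hr0 : Tendsto (fun t : ℝ => Complex.exp (t * (((j : ℕ) : ℂ) + 1))) atBot (𝓝 0) :=
    tendsto_exp_mul_natCast_add_one_atBot j
  have heval : Continuous fun p : (E →L[ℂ] E) × E => p.1 p.2 :=
    isBoundedBilinearMap_apply.continuous
  have h2 : Tendsto (fun t : ℝ => (1 + γ t)
      (Complex.exp (t * (((j : ℕ) : ℂ) + 1)) • weightFlow u (-t) x)) atBot
      (𝓝 ((1 + lineMul (-2) (u i₀)) (inner ℂ (u j) x • u j))) :=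
    (heval.tendsto (1 + lineMul (-2) (u i₀), inner ℂ (u j) x • u j)).comp
      ((hlim.const_add 1).prodMk_nhds h1)
  have h3 : Tendsto (fun t : ℝ => Complex.exp (t * (((j : ℕ) : ℂ) + 1)) •
      ((1 - γ t) * (weightFlow u t * (1 + γ 0))) w) atBot
      (𝓝 ((0 : ℂ) • ((1 - lineMul (-2) (u i₀)) * (0 * (1 + γ 0))) w)) := by
    refine hr0.smul ?_
    exact (heval.tendsto (_, w)).comp (((hlim.const_sub 1).mul
      ((tendsto_weightFlow_atBot u).mul_const (1 + γ 0))).prodMk_nhds tendsto_const_nhds)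
  have h4 : ∀ t : ℝ, (1 + γ t) (Complex.exp (t * (((j : ℕ) : ℂ) + 1)) • weightFlow u (-t) x) =
      Complex.exp (t * (((j : ℕ) : ℂ) + 1)) •
        ((1 - γ t) * (weightFlow u t * (1 + γ 0))) w := by
    intro t
    rw [map_smul, ← one_add_mul_weightFlow u hγU hγ, ← hw]
    rfl
  rw [funext h4] at h2
  have h5 := tendsto_nhds_unique h2 h3
  rw [zero_smul, map_smul, smul_eq_zero, or_iff_right hj, add_apply, one_apply_eq_self,
    lineMul_apply] at h5
  by_contra hne
  rw [u.orthonormal.inner_eq_zero (Ne.symm hne), mul_zero, zero_smul, add_zero,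
    ← two_smul ℂ, smul_eq_zero] at h5
  exact h5.elim two_ne_zero (u.orthonormal.ne_zero j)

/-- The identity is a stationary point, different from the limit. -/
lemma apply_zero_ne_one_of_tendsto (hγU : ∀ t, γ t ∈ unitaryOps E)
    (hγ : ∀ t, HasDerivAt γ (weightOp u - γ t * weightOp u * γ t) t) {i₀ : Fin n}
    (hlim : Tendsto γ atBot (𝓝 (lineMul (-2) (u i₀)))) : γ 0 ≠ 1 := by
  intro h
  have h1 : ∀ t, γ t = 1 := by
    intro t
    have h2 := one_add_mul_weightFlow u hγU hγ t
    rw [h, sub_self, mul_zero, mul_zero] at h2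
    have h3 : (1 - γ t) * (weightFlow u t * (1 + 1)) * weightFlow u (-t) = (2 : ℂ) • (1 - γ t) := by
      rw [show (1 - γ t) * (weightFlow u t * (1 + 1)) * weightFlow u (-t) =
        (1 - γ t) * (weightFlow u t * weightFlow u (-t)) +
          (1 - γ t) * (weightFlow u t * weightFlow u (-t)) by noncomm_ring, weightFlow_mul_neg,
        mul_one, two_smul]
    rw [← h2, zero_mul, eq_comm, smul_eq_zero, or_iff_right two_ne_zero, sub_eq_zero] at h3
    exact h3.symm
  have h2 : lineMul (-2) (u i₀) = 1 :=
    tendsto_nhds_unique hlim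
      ((tendsto_const_nhds (x := (1 : E →L[ℂ] E))).congr fun t => (h1 t).symm)
  have h3 := DFunLike.congr_fun h2 (u i₀)
  rw [lineMul_apply_self (u.orthonormal.ne_zero i₀), one_apply_eq_self] at h3
  have h4 : (-2 : ℂ) • u i₀ = 0 := by linear_combination (norm := module) h3
  exact (smul_eq_zero.1 h4).elim (by norm_num) (u.orthonormal.ne_zero i₀)

/-- The initial point of a trajectory which comes out of `-id ⊕ id` is a complex reflection. As no
nonzero vector in the range of `1 - γ 0` is orthogonal to `u i₀`, this range is a line. -/
lemma exists_lineMul_of_tendsto (hγU : ∀ t, γ t ∈ unitaryOps E)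
    (hγ : ∀ t, HasDerivAt γ (weightOp u - γ t * weightOp u * γ t) t) {i₀ : Fin n}
    (hlim : Tendsto γ atBot (𝓝 (lineMul (-2) (u i₀)))) :
    ∃ (l : ℂ) (v : E), ‖l‖ = 1 ∧ l ≠ 1 ∧ γ 0 = lineMul (l - 1) v ∧ inner ℂ (u i₀) v ≠ 0 ∧
      ∀ i : Fin n, i₀ < i → inner ℂ (u i) v = 0 := by
  have h1 := apply_zero_ne_one_of_tendsto hγU hγ hlim
  obtain ⟨w, hw⟩ : ∃ w, (1 - γ 0) w ≠ 0 := by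
    by_contra! hall
    refine h1 (sub_eq_zero.1 ?_).symm
    ext w
    simpa using hall w
  obtain ⟨hv0, hv⟩ := range_one_sub_of_tendsto hγU hγ hlim hw ⟨w, rfl⟩
  obtain ⟨l, hl, hlU⟩ := exists_eq_lineMul (hγU 0) hw fun x => by
    -- a combination of two vectors of the range without component along `u i₀` vanishes
    refine ⟨inner ℂ (u i₀) ((1 - γ 0) x) / inner ℂ (u i₀) ((1 - γ 0) w), ?_⟩
    by_contra hne
    refine (range_one_sub_of_tendsto hγU hγ hlim (sub_ne_zero.2 hne)
      ⟨x - (inner ℂ (u i₀) ((1 - γ 0) x) / inner ℂ (u i₀) ((1 - γ 0) w)) • w, by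
        rw [map_sub, map_smul]⟩).1 ?_
    rw [inner_sub_right, inner_smul_right, div_mul_cancel₀ _ hv0, sub_self]
  refine ⟨l, (1 - γ 0) w, hl, ?_, hlU, hv0, hv⟩
  rintro rfl
  refine h1 ?_
  rw [hlU, sub_self, lineMul_zero]

end Limit

section UnstableManifold

variable {E : Type*} [NormedAddCommGroup E] [InnerProductSpace ℂ E] [FiniteDimensional ℂ E]
  {W : ℕ → Submodule ℂ E} {u : OrthonormalBasis (Fin (finrank ℂ E)) ℂ E}

/-- The unstable manifold consists of the reflections in the lines of `W_k^⊥` which are not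
orthogonal to `E_k`. -/
lemma mem_unstableManifold_iff (hW : Antitone W) (hu : IsFlagBasis W u)
    (i₀ : Fin (finrank ℂ E)) {U : E →L[ℂ] E} :
    U ∈ unstableManifold W (i₀ + 1) ↔ ∃ (l : ℂ) (v : E), ‖l‖ = 1 ∧ l ≠ 1 ∧ v ∈ (W (i₀ + 1))ᗮ ∧
      inner ℂ (u i₀) v ≠ 0 ∧ U = lineMul (l - 1) v := by
  constructor
  · rintro ⟨γ, rfl, hγU, hγ, hlim⟩
    rw [flagOp_eq_diagOp hW hu] at hγ
    rw [critPoint_eq_lineMul hW hu] at hlim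
    obtain ⟨l, v, hl, hl1, hU, hv0, hv⟩ := exists_lineMul_of_tendsto hγU hγ hlim
    exact ⟨l, v, hl, hl1, mem_orthogonal_of_inner_flagBasis hW hu fun i hi => hv i hi, hv0, hU⟩
  · rintro ⟨l, v, hl, hl1, hv, h0, rfl⟩
    exact lineMul_mem_unstableManifold hW hu i₀ hl hl1 hv h0

end UnstableManifold

/-! ### Integration over the unstable manifold and over the incidence set -/

section Integral

variable {E : Type*} [NormedAddCommGroup E] [InnerProductSpace ℂ E] {m : ℕ}

lemma chartVec_mem {L : Submodule ℂ E} {e : Fin (m + 1) → E} (heL : ∀ j, e j ∈ L)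
    (y : Fin (2 * (m + 1) - 1) → ℝ) : chartVec e y ∈ L := by
  rw [chartVec, chartDir_apply]
  exact L.add_mem (heL 0) (L.sum_mem fun j _ => L.smul_mem _ (heL j))

lemma exists_oppChart_eq_lineMul {L : Submodule ℂ E} {e : Fin (m + 1) → E} (he : Orthonormal ℂ e)
    (heL : ∀ j, e j ∈ L) {y : Fin (2 * (m + 1) - 1) → ℝ} (hy : y ∈ chartDomain m) :
    ∃ (l : ℂ) (v : E), ‖l‖ = 1 ∧ l ≠ 1 ∧ v ∈ L ∧ inner ℂ (e 0) v ≠ 0 ∧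
      oppChart e y = lineMul (l - 1) v := by
  refine ⟨Complex.exp ((-coordθ y : ℝ) * Complex.I), chartVec e (reflect m y),
    Complex.norm_exp_ofReal_mul_I _, exp_ne_one_of_mem (neg_coordθ_mem hy), chartVec_mem heL _, ?_,
    ?_⟩
  · rw [inner_chartVec he, if_pos rfl]
    exact one_ne_zero
  · rw [oppChart, chart, coordθ_reflect]

variable [FiniteDimensional ℂ E] {W : ℕ → Submodule ℂ E}

/-- The integral is the same over every set of complex reflections in `W_k^⊥` which contains the
affine chart. -/
lemma hasIntegral_Tc {e : Fin (m + 1) → E} (he : Orthonormal ℂ e)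
    {b : Basis (Fin (m + 1)) ℂ ↥(W (m + 1))ᗮ} (hb : ∀ j, (b j : E) = e j)
    (heW : ∀ v ∈ (W (m + 1))ᗮ, ∑ j, inner ℂ (e j) v • e j = v) {S : Set (E →L[ℂ] E)}
    (hS : oppChart e '' chartDomain m ⊆ S) (hSW : S ⊆ complexReflections (W (m + 1))ᗮ) :
    HasIntegral S (PhiReversing W (m + 1)) (Tc (m + 1)) 1 := by
  obtain ⟨hint, hval⟩ := integrableOn_and_integral_chartDensity m
  have hcoeff : pullbackCoeff (Tc (m + 1)) (oppChart e) = fun y => (chartDensity y : ℂ) :=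
    funext (pullbackCoeff_oppChart he)
  refine hasIntegral_of_param (isLocalParam_oppChart he heW hS hSW)
    (phiReversing_oppChart he fun j => hb j ▸ (b j).2)
    (measure_mono_null (Set.sdiff_subset_sdiff_left hSW)
      (hausdorffMeasure_complexReflections_sdiff he heW))
    (fun y hy => chartInv_oppChart he hy)
    (fun y hy => differentiableAt_chartInv (oppChart_mem_chartTarget he hy))
    (fun ψ Ω hψ x hx y hy hxy => hψ.exists_fderiv_eq_comp he hb hx hy hxy)
    (fun y hy T => by rw [Tc_oppChart he, pullbackCoeff_oppChart he]) ?_ ?_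
  · rw [hcoeff]
    exact hint.ofReal
  · rw [hcoeff, integral_complex_ofReal, hval, Complex.ofReal_one]

end Integral

end OddChern

end

theorem mainTheorem7 {E : Type*} [NormedAddCommGroup E] [InnerProductSpace ℂ E]
    [FiniteDimensional ℂ E] (W : ℕ → Submodule ℂ E) (hW : Antitone W)
    (hdim : ∀ m ≤ Module.finrank ℂ E, Module.finrank ℂ (W m) = Module.finrank ℂ E - m)
    (k : ℕ) (hk : 1 ≤ k) (hkn : k ≤ Module.finrank ℂ E) :
    OddChern.HasIntegral (OddChern.unstableManifold W k) (OddChern.PhiReversing W k)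
      (OddChern.Tc k) 1 ∧
    OddChern.HasIntegral (closure (OddChern.incidenceSet W k)) (OddChern.PhiReversing W k)
      (OddChern.Tc k) 1 := by
  obtain ⟨m, rfl⟩ : ∃ m, k = m + 1 := ⟨k - 1, by omega⟩
  obtain ⟨u, hu⟩ := OddChern.exists_flagBasis hW hdim
  obtain ⟨e, b, he, hb, he0, heW⟩ := OddChern.exists_basis_orthogonal_flag hW hdim hu hkn
  have heL : ∀ j, e j ∈ (W (m + 1))ᗮ := fun j => hb j ▸ (b j).2
  have hne : ∀ {x v : E}, inner ℂ x v ≠ 0 → v ≠ 0 := fun h hv => h (by rw [hv, inner_zero_right])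
  constructor
  · refine OddChern.hasIntegral_Tc he hb heW ?_ fun U hU => ?_
    · rintro _ ⟨y, hy, rfl⟩
      obtain ⟨l, v, hl, hl1, hv, hv0, hU⟩ := OddChern.exists_oppChart_eq_lineMul he heL hy
      exact (OddChern.mem_unstableManifold_iff hW hu ⟨m, hkn⟩).2
        ⟨l, v, hl, hl1, hv, he0 ▸ hv0, hU⟩
    · obtain ⟨l, v, hl, -, hv, hv0, rfl⟩ :=
        (OddChern.mem_unstableManifold_iff hW hu ⟨m, hkn⟩).1 hU
      exact OddChern.lineMul_mem_complexReflections hl hv (hne hv0)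
  · refine OddChern.hasIntegral_Tc he hb heW (Set.Subset.trans ?_ subset_closure)
      (closure_minimal (OddChern.incidenceSet_subset_complexReflections hk hkn (hdim _ hkn))
        (OddChern.isClosed_complexReflections _))
    rintro _ ⟨y, hy, rfl⟩
    obtain ⟨l, v, hl, hl1, hv, hv0, hU⟩ := OddChern.exists_oppChart_eq_lineMul he heL hy
    rw [hU]
    exact OddChern.lineMul_mem_incidenceSet hk hkn (hdim _ hkn) hl hl1 hv (hne hv0)
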